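/- A *constraint* of arity $k$ is a function $f:\{0,1\}^k\to\mathbb{R}^{\ge 0}$; it is presented by the series of its $2^k$ values in lexicographic order of the arguments. Let $\mathcal{U}$ be the set of all unary constraints, $EQ=(1,0,0,1)$ and $XOR=(0,1,1,0)$. Let $\mathcal{ED}$ be the set of all constraints that are products of unary constraints $u(x_i)$, equalities $EQ(x_i,x_j)$ and disequalities $XOR(x_i,x_j)$. Let $\mathcal{AF}$ be the set of all constraints of the form $g(x_1,\dots,x_k)\prod_{j\ne i}R_j(x_i,x_j)$ for some fixed index $i\in[k]$, where $g(x_1,\dots,x_k)=\prod_{l}u_l(x_l)$ is a product of unary constraints applied to different variables and every $R_j\subseteq\{0,1\}^2$ is an affine relation, i.e. the solution set of a system of linear equations over $GF(2)$, viewed as a $\{0,1\}$-valued function. For a set $\mathcal{F}$ of constraints, $\mathrm{MAX\text{-}PROD\text{-}CSP}^*(\mathcal{F})$ is the following maximization problem. An instance consists of a number $n$ of Boolean variables $x_1,\dots,x_n$ and a finite set $H$ of elements $\langle h,(x_{i_1},\dots,x_{i_k})\rangle$ with $h\in\mathcal{F}\cup\mathcal{U}$ of arity $k$ and $i_1,\dots,i_k\in[n]$;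 a solution is a truth assignment $\sigma$ to $x_1,\dots,x_n$; the measure to be maximized is $\prod_{\langle h,(x_{i_1},\dots,x_{i_k})\rangle\in H}h(\sigma(x_{i_1}),\dots,\sigma(x_{i_k}))$. Algorithms are deterministic programs of a real random access machine (equivalently, Blum–Shub–Smale machines): real numbers are stored exactly, and each arithmetic operation on or comparison of reals takes one step. The size of an instance counts every table entry as $1$ and writes $n$, the arities and the indices in unary. A maximization problem is in $\mathrm{NPO}$ if (1) its instances, and the solutions of a given instance, can be recognized in polynomial time, (2) the size of solutions is polynomially bounded in the size of the instance, and (3) the measure can be computed in polynomial time; it is in $\mathrm{PO}$ if in addition a deterministic algorithm returns an optimal solution of every instance in time polynomial in the size of the instance. **Proposition.** Let $\mathcal{F}$ be any set of constraints, finite or infinite, with $\mathcal{F}\subseteq\mathcal{AF}$ or $\mathcal{F}\subseteq\mathcal{ED}$. Then a deterministic polynomial-time algorithm returns an optimal solution of every instance of $\mathrm{MAX\text{-}PROD\text{-}CSP}^*(\mathcal{F})$; moreover, solutions of a given instance are recognizable in polynomial time, solutions are polynomially bounded, and the measure is computable in polynomial time. If furthermore $\mathcal{F}$ is finite or, more generally,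 membership of a constraint in $\mathcal{F}\cup\mathcal{U}$ can be decided in polynomial time (so that instances can be recognized at all), then $\mathrm{MAX\text{-}PROD\text{-}CSP}^*(\mathcal{F})$ belongs to $\mathrm{PO}$. -/

import Mathlib

open scoped NNReal

noncomputable section

/-! ## Constraints and special sets of constraints -/

/-- A nonnegative-real-weighted Boolean constraint `f : {0,1}^k → ℝ≥0`, together with its arity. -/
structure Constraint where
  arity : ℕ
  val : (Fin arity → Bool) → ℝ≥0

namespace Constraint

/-- The set of all unary constraints. -/
def unary : Set Constraint := {f | f.arity = 1}

/-- A bit as an element of the field with two elements. -/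
def bit (b : Bool) : ZMod 2 := if b then 1 else 0

/-- A relation is affine if it is the solution set of a system of linear equations over `GF(2)`. -/
def IsAffine {k : ℕ} (R : Set (Fin k → Bool)) : Prop :=
  ∃ (m : ℕ) (A : Matrix (Fin m) (Fin k) (ZMod 2)) (b : Fin m → ZMod 2),
    R = {x | A.mulVec (fun i => bit (x i)) = b}

/-- A degenerate function: a product of unary constraints applied to different variables. -/
def IsDegenerate {k : ℕ} (g : (Fin k → Bool) → ℝ≥0) : Prop :=
  ∃ u : Fin k → Bool → ℝ≥0, ∀ x, g x = ∏ i, u i (x i)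

/-- The set `AF`: constraints of the form `g(x₁,…,x_k) ∏_{j ≠ i} R_j(x_i, x_j)` with `i` a fixed
index, `g` degenerate and every `R_j` an affine binary relation (as a `0`-`1`-valued function). -/
def AF : Set Constraint :=
  {f | ∃ (i : Fin f.arity) (g : (Fin f.arity → Bool) → ℝ≥0)
      (R : Fin f.arity → Set (Fin 2 → Bool)),
    IsDegenerate g ∧ (∀ j, IsAffine (R j)) ∧
    ∀ x, f.val x = g x * ∏ j ∈ Finset.univ.erase i, (R j).indicator 1 ![x i, x j]}

/-- The possible factors of the constraints in `ED`, over `k` variables. -/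
inductive EDFactor (k : ℕ) where
  | unary (u : Bool → ℝ≥0) (i : Fin k)
  | eq (i j : Fin k)
  | xor (i j : Fin k)

/-- Value of a factor on an assignment; `EQ = (1,0,0,1)` and `XOR = (0,1,1,0)`. -/
def EDFactor.eval {k : ℕ} (x : Fin k → Bool) : EDFactor k → ℝ≥0
  | .unary u i => u (x i)
  | .eq i j => if x i = x j then 1 else 0
  | .xor i j => if x i = x j then 0 else 1

/-- The set `ED`: products of unary constraints, equalities and disequalities. -/
def ED : Set Constraint :=
  {f | ∃ L : List (EDFactor f.arity), ∀ x, f.val x = (L.map (EDFactor.eval x)).prod}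

end Constraint

/-! ## The machine model: a real random access machine with unit cost

Real numbers are handled exactly and at unit cost, as in the Blum–Shub–Smale model: a program may
contain real constants, and it may add, subtract, multiply, divide and compare real numbers. Natural
numbers serve for counting and indexing; on them only addition, (truncated) subtraction and
comparison are available, so that no number of superpolynomial length arises in polynomial time. -/

/-- The data that machines read and write: a finite sequence of naturals and one of reals. -/
structure Word where
  nats : List ℕ
  reals : List ℝ

namespace Word

/-- Size of a word: every real counts `1` and naturals are counted in unary. -/
def size (w : Word) : ℕ := w.nats.length + w.nats.sum + w.reals.length

/-- Two words written as one; the two lengths in front make the pairing unambiguous. -/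
def pair (w v : Word) : Word :=
  ⟨w.nats.length :: w.reals.length :: (w.nats ++ v.nats), w.reals ++ v.reals⟩

/-- The answer "yes". -/
def yes : Word := ⟨[1], []⟩

/-- The answer "no". -/
def no : Word := ⟨[0], []⟩

theorem pair_injective {w v w' v' : Word} (h : pair w v = pair w' v') : w = w' ∧ v = v' := by
  obtain ⟨a, b⟩ := w
  obtain ⟨c, d⟩ := v
  obtain ⟨a', b'⟩ := w'
  obtain ⟨c', d'⟩ := v'
  simp only [pair, Word.mk.injEq, List.cons.injEq] at h
  obtain ⟨⟨h1, h2, h3⟩, h4⟩ := h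
  obtain ⟨rfl, rfl⟩ := List.append_inj h3 h1
  obtain ⟨rfl, rfl⟩ := List.append_inj h4 h2
  exact ⟨rfl, rfl⟩

end Word

namespace RealRAM

/-- Memory: registers and dynamic arrays, for naturals and for reals. A program mentions only
finitely many of them. -/
structure State where
  natReg : ℕ → ℕ
  realReg : ℕ → ℝ
  natArr : ℕ → List ℕ
  realArr : ℕ → List ℝ

/-- Expressions for naturals: constants, registers, array lengths, array entries, `+`, `-`. -/
inductive NatExp where
  | const (c : ℕ)
  | reg (r : ℕ)
  | natLen (a : ℕ)
  | realLen (a : ℕ)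
  | get (a : ℕ) (i : NatExp)
  | add (e₁ e₂ : NatExp)
  | sub (e₁ e₂ : NatExp)

/-- Value of an expression; an array entry outside the array reads as `0`. -/
def NatExp.eval (s : State) : NatExp → ℕ
  | .const c => c
  | .reg r => s.natReg r
  | .natLen a => (s.natArr a).length
  | .realLen a => (s.realArr a).length
  | .get a i => (s.natArr a).getD (i.eval s) 0
  | .add e₁ e₂ => e₁.eval s + e₂.eval s
  | .sub e₁ e₂ => e₁.eval s - e₂.eval s

/-- Expressions for reals: constants, registers, array entries and the field operations. -/
inductive RealExp where
  | const (c : ℝ)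
  | reg (r : ℕ)
  | get (a : ℕ) (i : NatExp)
  | add (e₁ e₂ : RealExp)
  | sub (e₁ e₂ : RealExp)
  | mul (e₁ e₂ : RealExp)
  | div (e₁ e₂ : RealExp)

/-- Value of an expression; an array entry outside the array reads as `0`. -/
def RealExp.eval (s : State) : RealExp → ℝ
  | .const c => c
  | .reg r => s.realReg r
  | .get a i => (s.realArr a).getD (i.eval s) 0
  | .add e₁ e₂ => e₁.eval s + e₂.eval s
  | .sub e₁ e₂ => e₁.eval s - e₂.eval s
  | .mul e₁ e₂ => e₁.eval s * e₂.eval s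
  | .div e₁ e₂ => e₁.eval s / e₂.eval s

/-- Branching conditions. -/
inductive Test where
  | natLe (e₁ e₂ : NatExp)
  | realLe (e₁ e₂ : RealExp)
  | not (b : Test)
  | and (b₁ b₂ : Test)

def Test.Holds (s : State) : Test → Prop
  | .natLe e₁ e₂ => e₁.eval s ≤ e₂.eval s
  | .realLe e₁ e₂ => e₁.eval s ≤ e₂.eval s
  | .not b => ¬ b.Holds s
  | .and b₁ b₂ => b₁.Holds s ∧ b₂.Holds s

/-- Elementary instructions. -/
inductive Instr where
  | setNat (r : ℕ) (e : NatExp)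
  | setReal (r : ℕ) (e : RealExp)
  | clearNat (a : ℕ)
  | clearReal (a : ℕ)
  | pushNat (a : ℕ) (e : NatExp)
  | pushReal (a : ℕ) (e : RealExp)
  | popNat (a : ℕ)
  | popReal (a : ℕ)
  | writeNat (a : ℕ) (i e : NatExp)
  | writeReal (a : ℕ) (i : NatExp) (e : RealExp)

/-- Effect of an instruction. Arrays grow and shrink at their right end; writing outside an array
has no effect. -/
def Instr.exec (s : State) : Instr → State
  | .setNat r e => { s with natReg := Function.update s.natReg r (e.eval s) }
  | .setReal r e => { s with realReg := Function.update s.realReg r (e.eval s) }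
  | .clearNat a => { s with natArr := Function.update s.natArr a [] }
  | .clearReal a => { s with realArr := Function.update s.realArr a [] }
  | .pushNat a e => { s with natArr := Function.update s.natArr a (s.natArr a ++ [e.eval s]) }
  | .pushReal a e => { s with realArr := Function.update s.realArr a (s.realArr a ++ [e.eval s]) }
  | .popNat a => { s with natArr := Function.update s.natArr a (s.natArr a).dropLast }
  | .popReal a => { s with realArr := Function.update s.realArr a (s.realArr a).dropLast }
  | .writeNat a i e =>
      { s with natArr := Function.update s.natArr a ((s.natArr a).set (i.eval s) (e.eval s)) }
  | .writeReal a i e =>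
      { s with realArr := Function.update s.realArr a ((s.realArr a).set (i.eval s) (e.eval s)) }

/-- Deterministic programs. -/
inductive Prog where
  | instr (a : Instr)
  | seq (c d : Prog)
  | ite (b : Test) (c d : Prog)
  | loop (b : Test) (c : Prog)

/-- `Exec c s s' t`: the program `c`, started in state `s`, halts in state `s'` after `t` steps,
where every execution of an instruction and every evaluation of a test counts as one step. -/
inductive Exec : Prog → State → State → ℕ → Prop
  | instr (a : Instr) (s : State) : Exec (.instr a) s (a.exec s) 1
  | seq {c d : Prog} {s s' s'' : State} {t t' : ℕ} :
      Exec c s s' t → Exec d s' s'' t' → Exec (.seq c d) s s'' (t + t')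
  | iteTrue {b : Test} {c d : Prog} {s s' : State} {t : ℕ} :
      b.Holds s → Exec c s s' t → Exec (.ite b c d) s s' (t + 1)
  | iteFalse {b : Test} {c d : Prog} {s s' : State} {t : ℕ} :
      ¬ b.Holds s → Exec d s s' t → Exec (.ite b c d) s s' (t + 1)
  | loopTrue {b : Test} {c : Prog} {s s' s'' : State} {t t' : ℕ} :
      b.Holds s → Exec c s s' t → Exec (.loop b c) s' s'' t' →
      Exec (.loop b c) s s'' (t + t' + 1)
  | loopFalse {b : Test} {c : Prog} {s : State} :
      ¬ b.Holds s → Exec (.loop b c) s s 1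

/-- The initial state on input `w`: the input stands in the arrays number `0`. -/
def State.init (w : Word) : State where
  natReg := fun _ => 0
  realReg := fun _ => 0
  natArr := fun a => if a = 0 then w.nats else []
  realArr := fun a => if a = 0 then w.reals else []

/-- The output is the content of the arrays number `0`. -/
def State.output (s : State) : Word := ⟨s.natArr 0, s.realArr 0⟩

/-- On input `w` the program `c` halts within `T` steps with output `v`. -/
def Prog.Yields (c : Prog) (w v : Word) (T : ℕ) : Prop :=
  ∃ (s : State) (t : ℕ), Exec c (State.init w) s t ∧ t ≤ T ∧ s.output = v

/-- Among the words in `D`, membership in `L` can be decided in polynomial time. -/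
def PolyDecidableOn (D L : Set Word) : Prop :=
  ∃ (c : Prog) (p : Polynomial ℕ), ∀ w ∈ D,
    (w ∈ L → c.Yields w Word.yes (p.eval w.size)) ∧
    (w ∉ L → c.Yields w Word.no (p.eval w.size))

end RealRAM

/-! ## Maximization problems and the class `PO` -/

/-- A maximization problem, with the encodings of its instances and of its solutions. -/
structure MaxProblem where
  Inst : Type
  Sol : Inst → Type
  measure : (x : Inst) → Sol x → ℝ≥0
  encInst : Inst → Word
  encSol : (x : Inst) → Sol x → Word
  encInst_injective : Function.Injective encInst
  encSol_injective : ∀ x, Function.Injective (encSol x)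

namespace MaxProblem

open RealRAM

variable (P : MaxProblem)

/-- Input instances can be recognized in polynomial time. -/
def InstancesRecognizable : Prop :=
  PolyDecidableOn Set.univ (Set.range P.encInst)

/-- Solutions of a given instance can be recognized in polynomial time. -/
def SolutionsRecognizable : Prop :=
  PolyDecidableOn {w | ∃ (x : P.Inst) (v : Word), w = Word.pair (P.encInst x) v}
    {w | ∃ (x : P.Inst) (y : P.Sol x), w = Word.pair (P.encInst x) (P.encSol x y)}

/-- Solutions are polynomially bounded in the size of the instance. -/
def SolutionsBounded : Prop :=
  ∃ p : Polynomial ℕ, ∀ (x : P.Inst) (y : P.Sol x),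
    (P.encSol x y).size ≤ p.eval (P.encInst x).size

/-- The measure function can be computed in polynomial time. -/
def MeasureComputable : Prop :=
  ∃ (c : Prog) (p : Polynomial ℕ), ∀ (x : P.Inst) (y : P.Sol x),
    c.Yields (Word.pair (P.encInst x) (P.encSol x y)) ⟨[], [(P.measure x y : ℝ)]⟩
      (p.eval (Word.pair (P.encInst x) (P.encSol x y)).size)

/-- A solution of maximum measure. -/
def IsOptimal (x : P.Inst) (y : P.Sol x) : Prop := ∀ y' : P.Sol x, P.measure x y' ≤ P.measure x y

/-- A deterministic program returns, for every instance, an optimal solution in polynomial time. -/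
def OptimumComputable : Prop :=
  ∃ (c : Prog) (p : Polynomial ℕ), ∀ x : P.Inst, ∃ y : P.Sol x,
    P.IsOptimal x y ∧ c.Yields (P.encInst x) (P.encSol x y) (p.eval (P.encInst x).size)

/-- The class `NPO`. -/
def InNPO : Prop :=
  P.InstancesRecognizable ∧ P.SolutionsRecognizable ∧ P.SolutionsBounded ∧ P.MeasureComputable

/-- The class `PO`. -/
def InPO : Prop := P.InNPO ∧ P.OptimumComputable

end MaxProblem

/-! ## The problems `MAX-PROD-CSP` -/

namespace Constraint

/-- The `m`-th element of `{0,1}^k` in lexicographic order, for `m < 2^k`. -/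
def lexTuple (k m : ℕ) : Fin k → Bool := fun i => m.testBit (k - 1 - i)

/-- The series of output values of a constraint, in lexicographic order of the arguments. -/
def table (f : Constraint) : List ℝ :=
  List.ofFn fun m : Fin (2 ^ f.arity) => (f.val (lexTuple f.arity m) : ℝ)

/-- A constraint as machine data. -/
def enc (f : Constraint) : Word := ⟨[f.arity], f.table⟩

/-- Membership of a given constraint in the set `F` can be decided in polynomial time. -/
def Recognizable (F : Set Constraint) : Prop :=
  RealRAM.PolyDecidableOn Set.univ (enc '' F)

theorem lexTuple_surjective (k : ℕ) (x : Fin k → Bool) : ∃ m : Fin (2 ^ k), lexTuple k m = x := by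
  refine ⟨⟨Nat.ofBits fun i => x i.rev, Nat.ofBits_lt_two_pow _⟩, ?_⟩
  funext i
  have hi : k - 1 - (i : ℕ) < k := by omega
  simp only [lexTuple]
  rw [Nat.testBit_ofBits_lt _ _ hi]
  congr 1
  ext
  simp only [Fin.val_rev]
  omega

theorem table_length (f : Constraint) : f.table.length = 2 ^ f.arity := by simp [table]

theorem val_eq_of_table_eq {k : ℕ} {u v : (Fin k → Bool) → ℝ≥0}
    (h : table ⟨k, u⟩ = table ⟨k, v⟩) : u = v := by
  funext x
  obtain ⟨m, rfl⟩ := lexTuple_surjective k x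
  have := congrFun (List.ofFn_injective h) m
  exact NNReal.coe_injective this

end Constraint

/-- An element `⟨h, (x_{i₁},…,x_{i_k})⟩`: a constraint applied to some of the variables
`x₁,…,x_n`, which are indexed here by `0,…,n-1`. -/
structure Application (n : ℕ) where
  con : Constraint
  vars : Fin con.arity → Fin n

namespace Application

variable {n : ℕ}

/-- Value of an applied constraint under a truth assignment. -/
def value (a : Application n) (σ : Fin n → Bool) : ℝ≥0 := a.con.val fun i => σ (a.vars i)

/-- The natural numbers that describe an application: arity and indices of the variables. -/
def nats (a : Application n) : List ℕ := a.con.arity :: List.ofFn fun i => (a.vars i : ℕ)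

theorem flatMap_inj : ∀ L L' : List (Application n), L.flatMap nats = L'.flatMap nats →
    L.flatMap (fun a => a.con.table) = L'.flatMap (fun a => a.con.table) → L = L'
  | [], [], _, _ => rfl
  | [], _ :: _, h, _ => by simp [nats] at h
  | _ :: _, [], h, _ => by simp [nats] at h
  | ⟨⟨k, f⟩, v⟩ :: L, ⟨⟨k', f'⟩, v'⟩ :: L', h, h' => by
      simp only [List.flatMap_cons, nats, List.cons_append, List.cons.injEq] at h h'
      obtain ⟨hk, h⟩ := h
      subst hk
      obtain ⟨h1, h2⟩ := List.append_inj h (by simp)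
      obtain ⟨h3, h4⟩ := List.append_inj h' (by simp [Constraint.table_length])
      obtain rfl := Constraint.val_eq_of_table_eq h3
      have hv : v = v' := by
        funext i
        exact Fin.ext (congrFun (List.ofFn_injective h1) i)
      rw [hv, flatMap_inj L L' h2 h4]

end Application

/-- An instance of `MAX-PROD-CSP(F)`: a number `n` of variables and a finite set of applications of
constraints from `F`, listed without repetition. -/
structure CSPInstance (F : Set Constraint) where
  n : ℕ
  apps : List (Application n)
  nodup : apps.Nodup
  mem : ∀ a ∈ apps, a.con ∈ F

/-- An instance as machine data. -/
def CSPInstance.enc {F : Set Constraint} (x : CSPInstance F) : Word :=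
  ⟨x.n :: x.apps.flatMap Application.nats, x.apps.flatMap fun a => a.con.table⟩

theorem CSPInstance.enc_injective (F : Set Constraint) :
    Function.Injective (CSPInstance.enc (F := F)) := by
  rintro ⟨n, L, _, _⟩ ⟨n', L', _, _⟩ h
  simp only [CSPInstance.enc, Word.mk.injEq, List.cons.injEq] at h
  obtain ⟨⟨rfl, h1⟩, h2⟩ := h
  obtain rfl := Application.flatMap_inj L L' h1 h2
  rfl

/-- A truth assignment as machine data: its sequence of bits. -/
def encAssignment {n : ℕ} (σ : Fin n → Bool) : Word := ⟨List.ofFn fun i => (σ i).toNat, []⟩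

theorem encAssignment_injective (n : ℕ) : Function.Injective (encAssignment (n := n)) := by
  intro σ τ h
  simp only [encAssignment, Word.mk.injEq, and_true] at h
  funext i
  have hi : (σ i).toNat = (τ i).toNat := congrFun (List.ofFn_injective h) i
  revert hi
  cases σ i <;> cases τ i <;> simp

/-- `MAX-PROD-CSP(F)`: the solutions are the truth assignments, and the measure is the product of the
values of all applied constraints. -/
def maxProdCSP (F : Set Constraint) : MaxProblem where
  Inst := CSPInstance F
  Sol x := Fin x.n → Bool
  measure x σ := (x.apps.map fun a => a.value σ).prod
  encInst := CSPInstance.enc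
  encSol _ := encAssignment
  encInst_injective := CSPInstance.enc_injective F
  encSol_injective x := encAssignment_injective x.n

/-- `MAX-PROD-CSP*(F)`: all unary constraints are available for free. -/
def maxProdCSPStar (F : Set Constraint) : MaxProblem := maxProdCSP (F ∪ Constraint.unary)

end

/-! Everything reduces to `ED`. A linear equation over GF(2) in two variables is a condition on one
of them, an equality or a disequality, so `AF_subset_ED`; unary constraints lie in `ED` trivially.

To optimize over constraints in `ED`, add a variable `n` whose value is meant to be false. A
decomposition into factors is never computed; it occurs only in the correctness proof. The program
reads from each table which pairs of places, including an extra place that stands for `n`, have a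
constant sum of bits on the support. Each such tie merges two classes of variables and shifts one of
them so that the current assignment `σ` respects the tie. In the end `σ` agrees on every class, up
to a flip of the whole class, with every assignment of nonzero measure (`Sound`), and every
equality, every disequality and every unary factor with a zero lives inside a single class
(`Complete`). Hence `σ` has nonzero measure if any assignment has (`total_ne_zero`), and on the
variables of the instance every assignment of nonzero measure is `σ` with some classes flipped. A
factor that can be changed by flips depends on one class only, so flips of disjoint sets of classes
have independent effects (`total_flipBy_mul`). Deciding class by class whether a flip helps is
therefore optimal (`BestBelow.le_max`, `BestBelow.optimal`).

For the running time, `Runs` bounds an execution by assuming at most `B` iterations of every loop;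
for a fixed program this is a polynomial in `B`. Tables are written out in full, so even loops over
all `2 ^ k` entries are bounded by the size of the instance.

Instances are recognized by parsing one application after the other. The given recognizer of
constraints runs as a subroutine on shifted registers (`Exec.shift`, `runs_callProg`). For finite
`F` such a recognizer exists because programs may contain real constants, so that one test decides
membership. -/

noncomputable section

namespace RealRAM

/-! ## Cost bounds and frames of programs -/

/-- A bound for the running time when every loop is iterated at most `B` times. -/
def Prog.cost (B : ℕ) : Prog → ℕ
  | .instr _ => 1
  | .seq c d => c.cost B + d.cost B
  | .ite _ c d => c.cost B + d.cost B + 1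
  | .loop _ c => B * (c.cost B + 1) + 1

/-- The nesting depth of loops is fixed by the program text, and each level multiplies by `B`. -/
theorem Prog.exists_cost_poly (c : Prog) : ∃ p : Polynomial ℕ, ∀ B, p.eval B = c.cost B := by
  induction c with
  | instr a => exact ⟨1, by simp [Prog.cost]⟩
  | seq c d hc hd =>
    obtain ⟨p, hp⟩ := hc
    obtain ⟨q, hq⟩ := hd
    exact ⟨p + q, by simp [Prog.cost, hp, hq]⟩
  | ite b c d hc hd =>
    obtain ⟨p, hp⟩ := hc
    obtain ⟨q, hq⟩ := hd
    exact ⟨p + q + 1, by simp [Prog.cost, hp, hq]⟩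
  | loop b c hc =>
    obtain ⟨p, hp⟩ := hc
    exact ⟨Polynomial.X * (p + 1) + 1, by simp [Prog.cost, hp]⟩

/-- Needed when the iteration bound is itself a polynomial in the input size, as for programs that
call a subroutine. -/
theorem Prog.exists_poly_comp_cost (c : Prog) (f : Polynomial ℕ) :
    ∃ p : Polynomial ℕ, ∀ N, p.eval N = c.cost (f.eval N) := by
  obtain ⟨p, hp⟩ := c.exists_cost_poly
  exact ⟨p.comp f, by simp [hp]⟩

/-- An execution of at most `B` steps respects the cost bound for `B`. -/
theorem Exec.le_cost {B : ℕ} {c : Prog} {s s' : State} {t : ℕ} (h : Exec c s s' t)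
    (ht : t ≤ B) : t ≤ c.cost B := by
  -- The bound for a single loop already exceeds `B`, so nothing has to be known about its
  -- iterations. This is how a program known only by its running time enters the calculus.
  have key : ∀ k, B ≤ B * (k + 1) + 1 := fun k => by nlinarith
  induction h with
  | instr a s => simp [Prog.cost]
  | seq _ _ h1 h2 => have := h1 (by omega); have := h2 (by omega); simp only [Prog.cost]; omega
  | iteTrue _ _ h1 => have := h1 (by omega); simp only [Prog.cost]; omega
  | iteFalse _ _ h1 => have := h1 (by omega); simp only [Prog.cost]; omega
  | loopTrue _ _ _ _ _ => simp only [Prog.cost]; exact ht.trans (key _)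
  | loopFalse _ => simp only [Prog.cost]; exact ht.trans (key _)

/-- The instruction changes the natural register `x`. -/
def Instr.wNat : Instr → ℕ → Bool
  | .setNat r _, x => r == x
  | _, _ => false

/-- The instruction changes the real register `x`. -/
def Instr.wReal : Instr → ℕ → Bool
  | .setReal r _, x => r == x
  | _, _ => false

/-- The instruction changes the array `x` of naturals. -/
def Instr.wNatArr : Instr → ℕ → Bool
  | .clearNat a, x => a == x
  | .pushNat a _, x => a == x
  | .popNat a, x => a == x
  | .writeNat a _ _, x => a == x
  | _, _ => false

/-- The instruction changes the array `x` of reals. -/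
def Instr.wRealArr : Instr → ℕ → Bool
  | .clearReal a, x => a == x
  | .pushReal a _, x => a == x
  | .popReal a, x => a == x
  | .writeReal a _ _, x => a == x
  | _, _ => false

/-- Some instruction of the program satisfies `f`. -/
def Prog.any (f : Instr → Bool) : Prog → Bool
  | .instr a => f a
  | .seq c d => c.any f || d.any f
  | .ite _ c d => c.any f || d.any f
  | .loop _ c => c.any f

/-- `s'` agrees with `s` on everything that `c` does not write. -/
structure Frame (c : Prog) (s s' : State) : Prop where
  nat : ∀ r, c.any (Instr.wNat · r) = false → s'.natReg r = s.natReg r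
  real : ∀ r, c.any (Instr.wReal · r) = false → s'.realReg r = s.realReg r
  natArr : ∀ r, c.any (Instr.wNatArr · r) = false → s'.natArr r = s.natArr r
  realArr : ∀ r, c.any (Instr.wRealArr · r) = false → s'.realArr r = s.realArr r

theorem Frame.refl (c : Prog) (s : State) : Frame c s s :=
  ⟨fun _ _ => rfl, fun _ _ => rfl, fun _ _ => rfl, fun _ _ => rfl⟩

theorem Frame.trans {c : Prog} {s s' s'' : State} (h : Frame c s s') (h' : Frame c s' s'') :
    Frame c s s'' :=
  ⟨fun r hr => (h'.nat r hr).trans (h.nat r hr), fun r hr => (h'.real r hr).trans (h.real r hr),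
    fun r hr => (h'.natArr r hr).trans (h.natArr r hr),
    fun r hr => (h'.realArr r hr).trans (h.realArr r hr)⟩

theorem Frame.mono {c d : Prog} {s s' : State} (h : Frame c s s')
    (hcd : ∀ f, d.any f = false → c.any f = false) : Frame d s s' :=
  ⟨fun r hr => h.nat r (hcd _ hr), fun r hr => h.real r (hcd _ hr),
    fun r hr => h.natArr r (hcd _ hr), fun r hr => h.realArr r (hcd _ hr)⟩

theorem Frame.exec (a : Instr) (s : State) : Frame (.instr a) s (a.exec s) := by
  constructor <;> intro r hr <;> cases a <;>
    simp_all [Prog.any, Instr.wNat, Instr.wReal, Instr.wNatArr, Instr.wRealArr, Instr.exec,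
      Function.update_apply] <;> exact fun h => absurd h.symm hr

/-- The sets of written registers and arrays are syntactic, so for a concrete program a fact like
"register 3 is unchanged" follows from this by `rfl`. -/
theorem Exec.frame {c : Prog} {s s' : State} {t : ℕ} (h : Exec c s s' t) : Frame c s s' := by
  induction h with
  | instr a s => exact Frame.exec a s
  | seq _ _ h1 h2 =>
    exact (h1.mono (by simp +contextual [Prog.any])).trans (h2.mono (by simp +contextual [Prog.any]))
  | iteTrue _ _ h1 => exact h1.mono (by simp +contextual [Prog.any])
  | iteFalse _ _ h1 => exact h1.mono (by simp +contextual [Prog.any])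
  | loopTrue _ _ _ h1 h2 => exact (h1.mono (by simp +contextual [Prog.any])).trans h2
  | loopFalse _ => exact Frame.refl _ _

/-! ## A program logic -/

/-- Started in `s`, the program `c` halts in a state with property `Q`, within the time that
corresponds to at most `B` iterations of every loop. -/
def Runs (B : ℕ) (c : Prog) (s : State) (Q : State → Prop) : Prop :=
  ∃ s' t, Exec c s s' t ∧ t ≤ c.cost B ∧ Q s'

variable {B : ℕ} {a : Instr} {b : Test} {c d : Prog} {s : State} {P Q : State → Prop}

theorem runs_instr : Runs B (.instr a) s Q ↔ Q (a.exec s) := by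
  constructor
  · rintro ⟨s', t, h, -, hQ⟩
    cases h
    exact hQ
  · exact fun h => ⟨_, _, .instr a s, le_rfl, h⟩

theorem runs_seq (h : Runs B c s fun s' => Runs B d s' Q) : Runs B (.seq c d) s Q := by
  obtain ⟨s', t, h1, h2, s'', t', h3, h4, h5⟩ := h
  exact ⟨s'', _, .seq h1 h3, by simp only [Prog.cost]; omega, h5⟩

theorem runs_instr_seq (h : Runs B d (a.exec s) Q) : Runs B (.seq (.instr a) d) s Q :=
  runs_seq (runs_instr.2 h)

theorem runs_ite (h1 : b.Holds s → Runs B c s Q) (h2 : ¬ b.Holds s → Runs B d s Q) :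
    Runs B (.ite b c d) s Q := by
  by_cases hb : b.Holds s
  · obtain ⟨s', t, h3, h4, h5⟩ := h1 hb
    exact ⟨s', _, .iteTrue hb h3, by simp only [Prog.cost]; omega, h5⟩
  · obtain ⟨s', t, h3, h4, h5⟩ := h2 hb
    exact ⟨s', _, .iteFalse hb h3, by simp only [Prog.cost]; omega, h5⟩

/-- Use of a specification of `c`. -/
theorem Runs.call (h : Runs B c s P) (hQ : ∀ s', Frame c s s' → P s' → Q s') : Runs B c s Q := by
  obtain ⟨s', t, h1, h2, h3⟩ := h
  exact ⟨s', t, h1, h2, hQ s' h1.frame h3⟩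

/-- Use of a specification of the first part of a program. -/
theorem Runs.call_seq (h : Runs B c s P) (hQ : ∀ s', Frame c s s' → P s' → Runs B d s' Q) :
    Runs B (.seq c d) s Q :=
  runs_seq (h.call hQ)

/-- Loops with a decreasing variant. -/
theorem runs_while (Inv : State → Prop) (μ : State → ℕ) (h0 : Inv s) (hB : μ s ≤ B)
    (step : ∀ s', Frame c s s' → Inv s' → b.Holds s' →
      Runs B c s' fun s'' => Inv s'' ∧ μ s'' < μ s')
    (post : ∀ s', Frame c s s' → Inv s' → ¬ b.Holds s' → Q s') : Runs B (.loop b c) s Q := by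
  -- The variant bounds the number of remaining iterations, so induction on a bound `N` for it gives
  -- `N` times the cost of the body.
  have key : ∀ N s', Frame c s s' → Inv s' → μ s' ≤ N →
      ∃ s'' t, Exec (.loop b c) s' s'' t ∧ t ≤ N * (c.cost B + 1) + 1 ∧ Q s'' := by
    intro N
    induction N with
    | zero =>
      intro s' hf hI hμ
      by_cases hb : b.Holds s'
      · obtain ⟨_, _, _, _, _, h⟩ := step s' hf hI hb
        omega
      · exact ⟨s', 1, .loopFalse hb, by simp, post s' hf hI hb⟩
    | succ N ih =>
      intro s' hf hI hμ
      by_cases hb : b.Holds s'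
      · obtain ⟨s1, t1, h1, h2, h3, h4⟩ := step s' hf hI hb
        obtain ⟨s2, t2, h5, h6, h7⟩ := ih s1 (hf.trans h1.frame) h3 (by omega)
        exact ⟨s2, _, .loopTrue hb h1 h5, by rw [Nat.succ_mul]; omega, h7⟩
      · exact ⟨s', 1, .loopFalse hb, by simp, post s' hf hI hb⟩
  exact key B s (.refl _ _) h0 hB

/-- Loops with a known number `N` of iterations. -/
theorem runs_loop (N : ℕ) (hN : N ≤ B) (Inv : ℕ → State → Prop) (h0 : Inv 0 s)
    (hb : ∀ i s', Frame c s s' → i ≤ N → Inv i s' → (b.Holds s' ↔ i < N))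
    (step : ∀ i s', Frame c s s' → i < N → Inv i s' → Runs B c s' (Inv (i + 1)))
    (post : ∀ s', Frame c s s' → Inv N s' → Q s') : Runs B (.loop b c) s Q := by
  have key : ∀ M i s', i + M = N → Frame c s s' → Inv i s' →
      ∃ s'' t, Exec (.loop b c) s' s'' t ∧ t ≤ M * (c.cost B + 1) + 1 ∧ Q s'' := by
    intro M
    induction M with
    | zero =>
      intro i s' hi hf hI
      obtain rfl : i = N := by omega
      have := (hb i s' hf le_rfl hI).not.2 (lt_irrefl _)
      exact ⟨s', 1, .loopFalse this, by simp, post s' hf hI⟩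
    | succ M ih =>
      intro i s' hi hf hI
      obtain ⟨s1, t1, h1, h2, h3⟩ := step i s' hf (by omega) hI
      obtain ⟨s2, t2, h5, h6, h7⟩ := ih (i + 1) s1 (by omega) (hf.trans h1.frame) h3
      refine ⟨s2, _, .loopTrue ((hb i s' hf (by omega) hI).2 (by omega)) h1 h5, ?_, h7⟩
      rw [Nat.succ_mul]; omega
  obtain ⟨s', t, h1, h2, h3⟩ := key N 0 s (by omega) (.refl _ _) h0
  refine ⟨s', t, h1, h2.trans ?_, h3⟩
  simp only [Prog.cost]
  gcongr

theorem Runs.yields {w v : Word} {T : ℕ} (h : Runs B c (State.init w) fun s => s.output = v)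
    (hT : c.cost B ≤ T) : c.Yields w v T := by
  obtain ⟨s, t, h1, h2, h3⟩ := h
  exact ⟨s, t, h1, h2.trans hT, h3⟩

/-! ## Notation for expressions and instructions -/

instance : Add NatExp := ⟨.add⟩
instance : Sub NatExp := ⟨.sub⟩

@[simp] theorem NatExp.eval_add' (e₁ e₂ : NatExp) : (e₁ + e₂).eval s = e₁.eval s + e₂.eval s := rfl
@[simp] theorem NatExp.eval_sub' (e₁ e₂ : NatExp) : (e₁ - e₂).eval s = e₁.eval s - e₂.eval s := rfl

/-- `e₁ < e₂` -/
abbrev Test.lt (e₁ e₂ : NatExp) : Test := .not (.natLe e₂ e₁)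

/-- `e₁ = e₂` -/
abbrev Test.eq (e₁ e₂ : NatExp) : Test := .and (.natLe e₁ e₂) (.natLe e₂ e₁)

/-- `e₁ = e₂` for reals -/
abbrev Test.realEq (e₁ e₂ : RealExp) : Test := .and (.realLe e₁ e₂) (.realLe e₂ e₁)

@[simp] theorem Test.holds_lt (e₁ e₂ : NatExp) :
    (Test.lt e₁ e₂).Holds s ↔ e₁.eval s < e₂.eval s := by simp [Test.Holds]

@[simp] theorem Test.holds_eq (e₁ e₂ : NatExp) :
    (Test.eq e₁ e₂).Holds s ↔ e₁.eval s = e₂.eval s := by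
  simp only [Test.Holds]; omega

@[simp] theorem Test.holds_realEq (e₁ e₂ : RealExp) :
    (Test.realEq e₁ e₂).Holds s ↔ e₁.eval s = e₂.eval s := by
  simp only [Test.Holds]; exact ⟨fun h => le_antisymm h.1 h.2, fun h => ⟨h.le, h.ge⟩⟩

/-- Assignment to a natural register. -/
abbrev setN (r : ℕ) (e : NatExp) : Prog := .instr (.setNat r e)

/-- Assignment to a real register. -/
abbrev setR (r : ℕ) (e : RealExp) : Prog := .instr (.setReal r e)

infixr:60 " ;; " => Prog.seq

end RealRAM

end

/-! ### Combinatorics of constraints in `ED`: ties, classes and greedy optimality -/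

noncomputable section

/-! ## All available constraints are in `ED` -/

namespace Constraint

/-- If a coefficient vanishes, the equation concerns at most one variable and is a unary factor,
possibly constant. If both are `1`, it says that the bits are equal or that they differ. -/
theorem exists_edFactor_of_equation {k : ℕ} (i j : Fin k) (a b e : ZMod 2) :
    ∃ E : EDFactor k, ∀ x, E.eval x = if a * bit (x i) + b * bit (x j) = e then 1 else 0 := by
  have h2 : ∀ z : ZMod 2, z = 0 ∨ z = 1 := by decide
  rcases h2 b with rfl | rfl
  · exact ⟨.unary (fun t => if a * bit t = e then 1 else 0) i, by simp [EDFactor.eval]⟩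
  rcases h2 a with rfl | rfl
  · exact ⟨.unary (fun t => if bit t = e then 1 else 0) j, by simp [EDFactor.eval]⟩
  rcases h2 e with rfl | rfl
  · refine ⟨.eq i j, fun x => ?_⟩
    cases hi : x i <;> cases hj : x j <;> simp [EDFactor.eval, hi, hj, bit]
    decide
  · refine ⟨.xor i j, fun x => ?_⟩
    cases hi : x i <;> cases hj : x j <;> simp [EDFactor.eval, hi, hj, bit]

/-- The indicator of a solution set is the product of the indicators of its equations. -/
theorem IsAffine.exists_edFactors {R : Set (Fin 2 → Bool)} (hR : IsAffine R) {k : ℕ}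
    (i j : Fin k) : ∃ L : List (EDFactor k), ∀ x : Fin k → Bool,
      (L.map (EDFactor.eval x)).prod = R.indicator (1 : (Fin 2 → Bool) → ℝ≥0) ![x i, x j] := by
  obtain ⟨m, A, b, rfl⟩ := hR
  choose E hE using fun r : Fin m => exists_edFactor_of_equation i j (A r 0) (A r 1) (b r)
  refine ⟨List.ofFn E, fun x => ?_⟩
  rw [List.map_ofFn, List.prod_ofFn]
  simp only [Function.comp_apply, hE]
  rw [Finset.prod_ite_zero]
  simp only [Set.indicator_apply, Set.mem_ofPred_eq, funext_iff, Matrix.mulVec, dotProduct,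
    Fin.sum_univ_two]
  simp

theorem AF_subset_ED : AF ⊆ ED := by
  rintro f ⟨i, g, R, ⟨u, hu⟩, hR, hf⟩
  choose L hL using fun j => (hR j).exists_edFactors i j
  refine ⟨List.ofFn (fun l => EDFactor.unary (u l) l) ++ (Finset.univ.erase i).toList.flatMap L,
    fun x => ?_⟩
  rw [hf, hu, List.map_append, List.prod_append, List.map_ofFn, List.prod_ofFn, List.map_flatMap,
    List.flatMap_def, List.prod_flatten, List.map_map,
    ← Finset.prod_map_toList (Finset.univ.erase i)]
  congr 2
  exact List.map_congr_left fun j _ => (hL j x).symm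

theorem unary_subset_ED : unary ⊆ ED := by
  rintro ⟨k, f⟩ (rfl : k = 1)
  refine ⟨[.unary (fun t => f fun _ => t) 0], fun x => ?_⟩
  simp only [List.map_cons, List.map_nil, List.prod_cons, List.prod_nil, mul_one, EDFactor.eval]
  congr 1
  funext i
  rw [Subsingleton.elim i 0]

end Constraint

/-! ## Ties between variables -/

/-- A tuple of bits, continued by zeros. -/
def padTuple {k : ℕ} (z : Fin k → Bool) (x : ℕ) : Bool := if h : x < k then z ⟨x, h⟩ else false

namespace Application

variable {n : ℕ}

/-- The measure of an assignment, given as a function on all naturals. -/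
def total (L : List (Application n)) (σ : ℕ → Bool) : ℝ≥0 :=
  (L.map fun a => a.value fun v => σ v).prod

/-- The variable at place `x` of an application; behind the last place stands the additional
variable `n`, whose value is meant to be `false`. -/
def varAt (a : Application n) (x : ℕ) : ℕ := if h : x < a.con.arity then a.vars ⟨x, h⟩ else n

/-- In the support of the constraint, the sum of the bits at the places `x` and `y` is `e`. -/
def Tied (a : Application n) (x y : ℕ) (e : Bool) : Prop :=
  ∀ z, a.con.val z ≠ 0 → (padTuple z x ^^ padTuple z y) = e

theorem apply_varAt (a : Application n) {τ : ℕ → Bool} (hτ : τ n = false) (x : ℕ) :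
    τ (a.varAt x) = padTuple (fun i => τ (a.vars i)) x := by
  unfold varAt padTuple
  split_ifs <;> simp [hτ]

theorem value_ne_zero_of_total {L : List (Application n)} {τ : ℕ → Bool} (h : total L τ ≠ 0)
    {a : Application n} (ha : a ∈ L) : (a.value fun v => τ v) ≠ 0 :=
  fun h0 => h (List.prod_eq_zero (h0 ▸ List.mem_map_of_mem ha))

theorem Tied.apply {L : List (Application n)} {τ : ℕ → Bool} (h : total L τ ≠ 0)
    (hτ : τ n = false) {a : Application n} (ha : a ∈ L) {x y : ℕ} {e : Bool} (ht : a.Tied x y e) :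
    (τ (a.varAt x) ^^ τ (a.varAt y)) = e := by
  rw [apply_varAt a hτ, apply_varAt a hτ]
  exact ht _ (value_ne_zero_of_total h ha)

/-! ## Classes of variables -/

/-- Rename the class `c` to `c'`. -/
def relabel (lab : ℕ → ℕ) (c c' : ℕ) (w : ℕ) : ℕ := if lab w = c then c' else lab w

/-- Add `d` to the values of the variables in the class `c`. -/
def shiftClass (lab : ℕ → ℕ) (σ : ℕ → Bool) (c : ℕ) (d : Bool) (w : ℕ) : Bool :=
  if lab w = c then σ w ^^ d else σ w

/-- Flip the values of all variables in the classes selected by `S`. -/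
def flipBy (lab : ℕ → ℕ) (S : ℕ → Bool) (σ : ℕ → Bool) (w : ℕ) : Bool := σ w ^^ S (lab w)

/-- Within every class, `σ` agrees with every assignment of nonzero measure, or differs from it
everywhere. -/
def Sound (L : List (Application n)) (lab : ℕ → ℕ) (σ : ℕ → Bool) : Prop :=
  ∀ τ, total L τ ≠ 0 → τ n = false → ∀ u v, lab u = lab v → (σ u ^^ σ v) = (τ u ^^ τ v)

/-- Tied variables of applications in `L` are in the same class. -/
def Complete (L : List (Application n)) (lab : ℕ → ℕ) : Prop :=
  ∀ a ∈ L, ∀ x ≤ a.con.arity, ∀ y ≤ a.con.arity, ∀ e, a.Tied x y e →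
    lab (a.varAt x) = lab (a.varAt y)

/-- For `a` in the class of `u` and `b` in that of `v`, the new sum of values is `(σ a + σ u) + (σ v
+ σ b) + e`. By soundness and the tie this equals `(τ a + τ u) + (τ v + τ b) + (τ u + τ v) = τ a + τ
b`. -/
theorem Sound.merge {L : List (Application n)} {lab : ℕ → ℕ} {σ : ℕ → Bool} (h : Sound L lab σ)
    (u v : ℕ) (e : Bool)
    (he : ∀ τ, total L τ ≠ 0 → τ n = false → (τ u ^^ τ v) = e) :
    Sound L (relabel lab (lab u) (lab v)) (shiftClass lab σ (lab u) (σ u ^^ σ v ^^ e)) := by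
  intro τ hτ hn a b hab
  have h' := h τ hτ hn
  have he' := he τ hτ hn
  have h1 := h' a b
  have h2 := h' a u
  have h3 := h' b u
  have h4 := h' a v
  have h5 := h' b v
  have h6 := h' u v
  clear h' h he hτ
  simp only [relabel, shiftClass] at hab ⊢
  split_ifs at hab ⊢ with ha hb hb
  · have := h1 (ha.trans hb.symm)
    revert this
    generalize σ a = a1, σ b = a2, (σ u ^^ σ v ^^ e) = a3, τ a = a4, τ b = a5
    revert a1 a2 a3 a4 a5
    decide
  · have := h2 ha
    have := h5 hab.symm
    subst he'
    clear h1 h2 h3 h4 h5 h6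
    revert this
    revert this
    generalize σ a = a1, σ b = a2, σ u = a3, σ v = a6, τ a = a4, τ b = a5, τ u = a7, τ v = a8
    revert a1 a2 a3 a4 a5 a6 a7 a8
    decide
  · have := h3 hb
    have := h4 hab
    subst he'
    clear h1 h2 h3 h4 h5 h6
    revert this
    revert this
    generalize σ a = a1, σ b = a2, σ u = a3, σ v = a6, τ a = a4, τ b = a5, τ u = a7, τ v = a8
    revert a1 a2 a3 a4 a5 a6 a7 a8
    decide
  · exact h1 hab

/-- Two variables of one class receive the same additional bit, which cancels in their sum. -/
theorem Sound.flipBy {L : List (Application n)} {lab : ℕ → ℕ} {σ : ℕ → Bool} (h : Sound L lab σ)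
    (S : ℕ → Bool) : Sound L lab (flipBy lab S σ) := by
  intro τ hτ hn a b hab
  rw [← h τ hτ hn a b hab]
  simp only [Application.flipBy, hab]
  generalize σ a = a1, σ b = a2, S (lab b) = a3
  revert a1 a2 a3
  decide

/-- Together with `relabel_self` this lets one program serve both for merging classes and for
flipping a single class. -/
theorem shiftClass_eq_flipBy (lab : ℕ → ℕ) (σ : ℕ → Bool) (c : ℕ) (d : Bool) :
    shiftClass lab σ c d = flipBy lab (fun b => (b == c) && d) σ := by
  funext w
  by_cases h : lab w = c
  · simp [shiftClass, flipBy, h]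
  · simp [shiftClass, flipBy, h, beq_eq_false_iff_ne.2 h]

theorem relabel_self (lab : ℕ → ℕ) (c : ℕ) : relabel lab c c = lab := by
  funext w
  by_cases h : lab w = c <;> simp [relabel, h]

theorem factor_ne_zero {a : Application n} {M : List (Constraint.EDFactor a.con.arity)}
    (hM : ∀ x, a.con.val x = (M.map (Constraint.EDFactor.eval x)).prod)
    {E : Constraint.EDFactor a.con.arity} (hE : E ∈ M) {z : Fin a.con.arity → Bool}
    (hz : a.con.val z ≠ 0) : E.eval z ≠ 0 :=
  fun h0 => hz ((hM z).trans (List.prod_eq_zero (h0 ▸ List.mem_map_of_mem hE)))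

theorem tied_of_eq_mem {a : Application n} {M : List (Constraint.EDFactor a.con.arity)}
    (hM : ∀ x, a.con.val x = (M.map (Constraint.EDFactor.eval x)).prod)
    {i j : Fin a.con.arity} (hE : .eq i j ∈ M) : a.Tied i j false := by
  intro z hz
  have := factor_ne_zero hM hE hz
  simp only [Constraint.EDFactor.eval, ne_eq, ite_eq_right_iff, one_ne_zero, imp_false,
    not_not] at this
  simp [padTuple, this]

theorem tied_of_xor_mem {a : Application n} {M : List (Constraint.EDFactor a.con.arity)}
    (hM : ∀ x, a.con.val x = (M.map (Constraint.EDFactor.eval x)).prod)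
    {i j : Fin a.con.arity} (hE : .xor i j ∈ M) : a.Tied i j true := by
  intro z hz
  have := factor_ne_zero hM hE hz
  simp only [Constraint.EDFactor.eval, ne_eq, ite_eq_left_iff, one_ne_zero, imp_false,
    not_not] at this
  simpa [padTuple] using this

/-- A unary factor with a zero forces its bit on the support. Since the place `a.con.arity` always
carries `false`, a forced bit is a tie with that place, so constants need no separate treatment. -/
theorem tied_of_unary_mem {a : Application n} {M : List (Constraint.EDFactor a.con.arity)}
    (hM : ∀ x, a.con.val x = (M.map (Constraint.EDFactor.eval x)).prod)
    {u : Bool → ℝ≥0} {i : Fin a.con.arity} (hE : .unary u i ∈ M) {t : Bool} (ht : u (!t) = 0) :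
    a.Tied i a.con.arity t := by
  intro z hz
  have := factor_ne_zero hM hE hz
  simp only [Constraint.EDFactor.eval] at this
  simp only [padTuple, Fin.is_lt, dite_true, lt_irrefl, dite_false, Bool.xor_false]
  by_contra h
  apply this
  rw [← ht]
  congr 1
  exact Bool.eq_not.2 h

theorem Complete.lab_eq {L : List (Application n)} {lab : ℕ → ℕ} (hc : Complete L lab)
    {a : Application n} (ha : a ∈ L) {i j : Fin a.con.arity} {e : Bool} (h : a.Tied i j e) :
    lab (a.vars i) = lab (a.vars j) := by
  simpa [varAt] using hc a ha i i.2.le j j.2.le e h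

/-- Flipping two disjoint sets of classes has independent effects on the measure. -/
theorem total_flipBy_mul {L : List (Application n)} {lab : ℕ → ℕ}
    (hL : ∀ a ∈ L, a.con ∈ Constraint.ED) (hc : Complete L lab) (S T : ℕ → Bool)
    (hST : ∀ c, (S c && T c) = false) (σ : ℕ → Bool) :
    total L σ * total L (flipBy lab (fun c => S c || T c) σ) =
      total L (flipBy lab S σ) * total L (flipBy lab T σ) := by
  simp only [total, ← List.prod_map_mul]
  congr 1
  refine List.map_congr_left fun a ha => ?_
  obtain ⟨M, hM⟩ := hL a ha
  simp only [value, hM, ← List.prod_map_mul]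
  congr 1
  refine List.map_congr_left fun E hE => ?_
  cases E with
  -- The factor depends on one class, which lies in at most one of `S` and `T`; the two products
  -- then consist of the same two factors. In the other cases both variables are in the same class,
  -- and no flip changes the factor.
  | unary u i =>
    have := hST (lab (a.vars i))
    simp only [Constraint.EDFactor.eval, flipBy]
    cases hS : S (lab (a.vars i)) <;> cases hT : T (lab (a.vars i)) <;> simp_all [mul_comm]
  | eq i j =>
    simp only [Constraint.EDFactor.eval, flipBy, hc.lab_eq ha (tied_of_eq_mem hM hE),
      Bool.xor_left_inj]
  | xor i j =>
    simp only [Constraint.EDFactor.eval, flipBy, hc.lab_eq ha (tied_of_xor_mem hM hE),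
      Bool.xor_left_inj]

/-- Sound and complete classes yield an assignment of nonzero measure, if there is one. -/
theorem total_ne_zero {L : List (Application n)} {lab : ℕ → ℕ} {σ : ℕ → Bool}
    (hL : ∀ a ∈ L, a.con ∈ Constraint.ED) (hs : Sound L lab σ) (hc : Complete L lab)
    (hn : σ n = false) {τ : ℕ → Bool} (hτ : total L τ ≠ 0) (hτn : τ n = false) :
    total L σ ≠ 0 := by
  have hs := hs τ hτ hτn
  simp only [total, ne_eq, List.prod_eq_zero_iff, List.mem_map, not_exists, not_and]
  intro a ha
  obtain ⟨M, hM⟩ := hL a ha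
  have hτa := value_ne_zero_of_total hτ ha
  simp only [value, hM, List.prod_eq_zero_iff, List.mem_map, not_exists, not_and]
  intro E hE
  have hτE := factor_ne_zero hM hE hτa
  cases E with
  | unary u i =>
    simp only [Constraint.EDFactor.eval] at hτE ⊢
    intro h0
    have hne : σ (a.vars i) ≠ τ (a.vars i) := fun h => hτE (h ▸ h0)
    -- The factor vanishes at the value of `σ` but not at that of `τ`, so it forces the bit of `τ`
    -- and ties the variable to `n`. Completeness puts both in one class, and since `σ` and `τ`
    -- agree at `n`, soundness makes them agree at the variable.
    have ht : a.Tied i a.con.arity (τ (a.vars i)) := by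
      refine tied_of_unary_mem hM hE ?_
      rw [← h0]
      congr 1
      revert hne
      generalize σ (a.vars i) = x, τ (a.vars i) = y
      revert x y
      decide
    have h1 := hc a ha _ i.2.le _ le_rfl _ ht
    have h2 := hs _ _ h1
    apply hne
    simpa [varAt, hn, hτn] using h2
  | eq i j =>
    have := hs _ _ (hc.lab_eq ha (tied_of_eq_mem hM hE))
    simp only [Constraint.EDFactor.eval] at hτE ⊢
    simp only [ne_eq, ite_eq_right_iff, one_ne_zero, imp_false, not_not] at hτE ⊢
    simpa [hτE] using this
  | xor i j =>
    have := hs _ _ (hc.lab_eq ha (tied_of_xor_mem hM hE))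
    simp only [Constraint.EDFactor.eval] at hτE ⊢
    simp only [ne_eq, ite_eq_left_iff, one_ne_zero, imp_false, not_not] at hτE ⊢
    intro h
    rw [h, Bool.xor_self] at this
    exact hτE (by simpa using this.symm)

/-! ## Greedy improvement -/

/-- Flipping classes of variables below `v` does not increase the measure. -/
def BestBelow (L : List (Application n)) (lab : ℕ → ℕ) (σ : ℕ → Bool) (v : ℕ) : Prop :=
  ∀ S : ℕ → Bool, (∀ c, S c = true → ∃ w < v, lab w = c) → total L (flipBy lab S σ) ≤ total L σ

theorem bestBelow_zero (L : List (Application n)) (lab : ℕ → ℕ) (σ : ℕ → Bool) :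
    BestBelow L lab σ 0 := by
  intro S hS
  have : flipBy lab S σ = σ := by
    funext w
    have : S (lab w) = false := by
      by_contra h
      simpa using hS _ (by simpa using h)
    simp [flipBy, this]
  rw [this]

/-- If `S` contains the class of `v`, split it off, leaving `S'`. By `total_flipBy_mul`, the measure
of `σ` times that after flipping `S` equals the measure after flipping `S'` times that after
flipping the class of `v`. The flip of `S'` gains nothing over `σ`, and the measure of `σ` is
nonzero and cancels. The class of `v` may have occurred before; this does no harm. -/
theorem BestBelow.le_max {L : List (Application n)} {lab : ℕ → ℕ} {σ : ℕ → Bool} {v : ℕ}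
    (hL : ∀ a ∈ L, a.con ∈ Constraint.ED) (hc : Complete L lab) (h : BestBelow L lab σ v)
    (h0 : total L σ ≠ 0) (S : ℕ → Bool) (hS : ∀ c, S c = true → ∃ w < v + 1, lab w = c) :
    total L (flipBy lab S σ) ≤ max (total L σ) (total L (flipBy lab (fun c => c == lab v) σ)) := by
  have hS' : ∀ c, c ≠ lab v → S c = true → ∃ w < v, lab w = c := by
    intro c hcv hc
    obtain ⟨w, hw, rfl⟩ := hS c hc
    refine ⟨w, ?_, rfl⟩
    have : w ≠ v := fun h => hcv (h ▸ rfl)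
    omega
  cases hv : S (lab v) with
  | false =>
    refine le_max_of_le_left (h S fun c hc => hS' c ?_ hc)
    rintro rfl
    simp [hv] at hc
  | true =>
    have hx := total_flipBy_mul hL hc (fun c => S c && !(c == lab v)) (fun c => c == lab v)
      (fun c => by cases S c <;> cases (c == lab v) <;> rfl) σ
    have h1 : (fun c => (S c && !(c == lab v)) || (c == lab v)) = S := by
      funext c
      by_cases hcv : c = lab v
      · simp [hcv, hv]
      · simp [beq_eq_false_iff_ne.2 hcv]
    rw [h1] at hx
    have h2 := h (fun c => S c && !(c == lab v)) fun c hc => by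
      obtain ⟨h3, h4⟩ := Bool.and_eq_true_iff.1 hc
      exact hS' c (by simpa using h4) h3
    refine le_max_of_le_right (le_of_mul_le_mul_left ?_ (pos_iff_ne_zero.2 h0))
    rw [hx]
    gcongr

theorem flipBy_flipBy (lab : ℕ → ℕ) (S T : ℕ → Bool) (σ : ℕ → Bool) :
    flipBy lab S (flipBy lab T σ) = flipBy lab (fun c => T c ^^ S c) σ := by
  funext w
  simp [flipBy]

theorem BestBelow.keep {L : List (Application n)} {lab : ℕ → ℕ} {σ : ℕ → Bool} {v : ℕ}
    (hL : ∀ a ∈ L, a.con ∈ Constraint.ED) (hc : Complete L lab) (h : BestBelow L lab σ v)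
    (h0 : total L σ ≠ 0) (hlt : total L (flipBy lab (fun c => c == lab v) σ) ≤ total L σ) :
    BestBelow L lab σ (v + 1) :=
  fun S hS => (h.le_max hL hc h0 S hS).trans (max_le le_rfl hlt)

/-- A further flip of `S` amounts to flipping, from `σ`, the symmetric difference of `S` with the
class of `v`, to which `BestBelow.le_max` applies. -/
theorem BestBelow.flip {L : List (Application n)} {lab : ℕ → ℕ} {σ : ℕ → Bool} {v : ℕ}
    (hL : ∀ a ∈ L, a.con ∈ Constraint.ED) (hc : Complete L lab) (h : BestBelow L lab σ v)
    (h0 : total L σ ≠ 0) (hle : total L σ ≤ total L (flipBy lab (fun c => c == lab v) σ)) :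
    BestBelow L lab (flipBy lab (fun c => c == lab v) σ) (v + 1) := by
  intro S hS
  rw [flipBy_flipBy]
  refine (h.le_max hL hc h0 _ fun c hc => ?_).trans (max_le hle le_rfl)
  by_cases hcv : c = lab v
  · exact ⟨v, by omega, hcv.symm⟩
  · exact hS c (by simpa [beq_eq_false_iff_ne.2 hcv] using hc)

/-- If no flip of classes increases the measure, then it is maximal. -/
theorem BestBelow.optimal {L : List (Application n)} {lab : ℕ → ℕ} {σ : ℕ → Bool}
    (h : BestBelow L lab σ (n + 1)) (hs : Sound L lab σ) {τ : ℕ → Bool} (hτ : total L τ ≠ 0)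
    (hτn : τ n = false) : total L τ ≤ total L σ := by
  classical
  -- The classes on which `σ` and `τ` differ somewhere. By soundness they differ there everywhere,
  -- so flipping `S` turns `σ` into `τ` on all variables of the instance.
  set S : ℕ → Bool := fun c => decide (∃ w < n + 1, lab w = c ∧ σ w ≠ τ w) with hS
  have h1 : total L (flipBy lab S σ) = total L τ := by
    unfold total
    congr 1
    refine List.map_congr_left fun a _ => ?_
    congr 1
    funext v
    have hv : (v : ℕ) < n + 1 := by omega
    have hx : S (lab v) = (σ v ^^ τ v) := by
      by_cases hne : σ v = τ v
      · simp only [hne, Bool.xor_self, hS, decide_eq_false_iff_not, not_exists, not_and]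
        intro w _ hl
        have := hs τ hτ hτn w v hl
        simpa [hne] using this
      · have : (σ v ^^ τ v) = true := by simpa using hne
        rw [this]
        simp only [hS, decide_eq_true_eq]
        exact ⟨v, hv, rfl, hne⟩
    simp only [flipBy, hx]
    cases σ v <;> simp
  rw [← h1]
  refine h S fun c hc => ?_
  simp only [hS, decide_eq_true_eq] at hc
  obtain ⟨w, hw, hl, -⟩ := hc
  exact ⟨w, hw, hl⟩

end Application

end

/-! ### Encoded lists of applications and the evaluation of the measure -/

noncomputable section

attribute [-simp] List.getD_eq_getElem?_getD

/-! ## Encoded applications -/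

namespace Application

variable {n : ℕ}

/-- The application `a` is described by the naturals from position `p` on and the reals from
position `q` on. -/
structure StoredAt (a : Application n) (N : List ℕ) (R : List ℝ) (p q : ℕ) : Prop where
  arity : N.getD p 0 = a.con.arity
  vars : ∀ i (h : i < a.con.arity), N.getD (p + 1 + i) 0 = a.vars ⟨i, h⟩
  table : ∀ m < 2 ^ a.con.arity,
    R.getD (q + m) 0 = (a.con.val (Constraint.lexTuple a.con.arity m) : ℝ)

/-- Position of the naturals of the `i`-th application. -/
def natPos (start : ℕ) (L : List (Application n)) (i : ℕ) : ℕ :=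
  start + ((L.take i).flatMap nats).length

/-- Position of the reals of the `i`-th application. -/
def realPos (L : List (Application n)) (i : ℕ) : ℕ :=
  ((L.take i).flatMap fun a => a.con.table).length

theorem nats_length (a : Application n) : a.nats.length = a.con.arity + 1 := by simp [nats]

theorem natPos_succ (start : ℕ) {L : List (Application n)} {i : ℕ} (h : i < L.length) :
    natPos start L (i + 1) = natPos start L i + L[i].con.arity + 1 := by
  simp only [natPos, List.take_succ_eq_append_getElem h, List.flatMap_append, List.length_append,
    List.flatMap_cons, List.flatMap_nil, List.append_nil, nats_length]
  omega

theorem realPos_succ {L : List (Application n)} {i : ℕ} (h : i < L.length) :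
    realPos L (i + 1) = realPos L i + 2 ^ L[i].con.arity := by
  simp only [realPos, List.take_succ_eq_append_getElem h, List.flatMap_append, List.length_append,
    List.flatMap_cons, List.flatMap_nil, List.append_nil, Constraint.table_length]

/-- Every application occupies at least one natural, its arity. Hence comparing the position with
the limit tells whether applications remain. -/
theorem natPos_lt (start : ℕ) (L : List (Application n)) {i : ℕ} (h : i < L.length) :
    natPos start L i < natPos start L L.length := by
  have hj : ∀ j, i + 1 + j ≤ L.length → natPos start L i < natPos start L (i + 1 + j) := by
    intro j
    induction j with
    | zero => intro _; rw [Nat.add_zero, natPos_succ start h]; omega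
    | succ j ih =>
      intro hj
      rw [← Nat.add_assoc, natPos_succ start (by omega : i + 1 + j < L.length)]
      have := ih (by omega)
      omega
  obtain ⟨j, hj'⟩ := Nat.exists_eq_add_of_lt h
  rw [hj']
  have := hj j (by omega)
  rwa [show i + 1 + j = i + j + 1 by omega] at this

theorem total_take_succ {L : List (Application n)} {i : ℕ} (h : i < L.length) (σ : ℕ → Bool) :
    total (L.take (i + 1)) σ = total (L.take i) σ * L[i].value fun v => σ v := by
  simp only [total, List.take_succ_eq_append_getElem h, List.map_append, List.prod_append,
    List.map_cons, List.map_nil, List.prod_cons, List.prod_nil, mul_one]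

/-- The list `L` of applications is described by the naturals between the positions `start` and
`limit` and by the reals from position `0` on. -/
structure Encodes (L : List (Application n)) (N : List ℕ) (R : List ℝ) (start limit : ℕ) :
    Prop where
  stored : ∀ i (h : i < L.length), L[i].StoredAt N R (natPos start L i) (realPos L i)
  limit_eq : natPos start L L.length = limit

theorem getD_append_append {α : Type*} (l₁ l₂ l₃ : List α) (i : ℕ) (d : α) (h : i < l₂.length) :
    (l₁ ++ l₂ ++ l₃).getD (l₁.length + i) d = l₂[i] := by
  rw [List.append_assoc, List.getD_append_right _ _ _ _ (by omega),
    List.getD_append _ _ _ _ (by omega)]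
  simp [List.getD_eq_getElem _ _ h]

theorem storedAt_append (a : Application n) (N₁ N₂ : List ℕ) (R₁ R₂ : List ℝ) :
    a.StoredAt (N₁ ++ a.nats ++ N₂) (R₁ ++ a.con.table ++ R₂) N₁.length R₁.length := by
  refine ⟨?_, fun i h => ?_, fun m h => ?_⟩
  · have := getD_append_append N₁ a.nats N₂ 0 0 (by simp [nats])
    simpa [nats] using this
  · have := getD_append_append N₁ a.nats N₂ (1 + i) 0 (by rw [nats_length]; omega)
    rw [Nat.add_assoc, this]
    simp [nats, Nat.add_comm 1 i]
  · rw [getD_append_append R₁ a.con.table R₂ m 0 (by rw [Constraint.table_length]; exact h)]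
    simp [Constraint.table]

/-- The naturals `N₁` in front are `n` in an instance, and two lengths and `n` in a pair. The data
behind allow for an assignment, or for the unread rest of an input that is being parsed. -/
theorem encodes_append (L : List (Application n)) (N₁ N₂ : List ℕ) (R₂ : List ℝ) :
    Encodes L (N₁ ++ L.flatMap nats ++ N₂) (L.flatMap (fun a => a.con.table) ++ R₂) N₁.length
      (N₁.length + (L.flatMap nats).length) := by
  refine ⟨fun i h => ?_, by simp [natPos]⟩
  have hL : L = L.take i ++ L[i] :: L.drop (i + 1) := by simp
  have := storedAt_append L[i] (N₁ ++ (L.take i).flatMap nats)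
    ((L.drop (i + 1)).flatMap nats ++ N₂) ((L.take i).flatMap fun a => a.con.table)
    ((L.drop (i + 1)).flatMap (fun a => a.con.table) ++ R₂)
  rw [List.length_append] at this
  convert this using 1
  · conv_lhs => rw [hL]
    simp only [List.flatMap_append, List.flatMap_cons, List.append_assoc]
  · conv_lhs => rw [hL]
    simp only [List.flatMap_append, List.flatMap_cons, List.append_assoc]
  · rfl
  · rfl

end Application

namespace RealRAM

open Application

variable {B n : ℕ} {s : State} {Q : State → Prop} {L : List (Application n)}

/-! ## Programs that run through the applications

Registers: `1` and `2` hold the positions of the current application, `3` its arity `k`, `4` the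
power `2 ^ k`; `20` and `21` hold the limits of the encoding. -/

/-- Execute `body` for all applications; `body` has to compute the length of the table. -/
def scan (body : Prog) : Prog :=
  setN 1 (.reg 20) ;; setN 2 (.const 0) ;; .loop (.lt (.reg 1) (.reg 21))
    (setN 3 (.get 0 (.reg 1)) ;; body ;; setN 1 (.reg 1 + .reg 3 + .const 1) ;;
      setN 2 (.reg 2 + .reg 4))

/-- The invariant must be insensitive to the registers `1`, `2`, `3`, which the scan itself changes
between executions of the body. Frames refer to the whole scan, so that `step` and `post` can
recover whatever the scan never writes. -/
theorem runs_scan {body : Prog} (h1 : body.any (Instr.wNat · 1) = false)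
    (h2 : body.any (Instr.wNat · 2) = false) (h3 : body.any (Instr.wNat · 3) = false)
    (h20 : body.any (Instr.wNat · 20) = false) (h21 : body.any (Instr.wNat · 21) = false)
    (hN : body.any (Instr.wNatArr · 0) = false) (hR : body.any (Instr.wRealArr · 0) = false)
    (hE : Encodes L (s.natArr 0) (s.realArr 0) (s.natReg 20) (s.natReg 21)) (hB : L.length ≤ B)
    (Inv : ℕ → State → Prop)
    (hInv : ∀ i s r v, r = 1 ∨ r = 2 ∨ r = 3 → Inv i s →
      Inv i { s with natReg := Function.update s.natReg r v })
    (h0 : Inv 0 s)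
    (step : ∀ i (h : i < L.length) s', Frame (scan body) s s' → Inv i s' →
      L[i].StoredAt (s'.natArr 0) (s'.realArr 0) (s'.natReg 1) (s'.natReg 2) →
      s'.natReg 1 = natPos (s.natReg 20) L i → s'.natReg 2 = realPos L i →
      s'.natReg 3 = L[i].con.arity →
      Runs B body s' fun s'' => s''.natReg 4 = 2 ^ L[i].con.arity ∧ Inv (i + 1) s'')
    (post : ∀ s', Frame (scan body) s s' → Inv L.length s' → Q s') :
    Runs B (scan body) s Q := by
  have ha1 : (scan body).any (Instr.wNat · 20) = false := by
    simp only [scan, Prog.any, h20]; rfl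
  have ha2 : (scan body).any (Instr.wNat · 21) = false := by
    simp only [scan, Prog.any, h21]; rfl
  have ha3 : (scan body).any (Instr.wNatArr · 0) = false := by
    simp only [scan, Prog.any, hN]; rfl
  have ha4 : (scan body).any (Instr.wRealArr · 0) = false := by
    simp only [scan, Prog.any, hR]; rfl
  suffices h : Runs B (scan body) s fun s' => Inv L.length s' from h.call post
  refine runs_instr_seq (runs_instr_seq ?_)
  have hF : Frame (scan body) s
      (Instr.exec (Instr.exec s (.setNat 1 (.reg 20))) (.setNat 2 (.const 0))) := by
    refine ((Frame.exec (.setNat 1 (.reg 20)) s).mono ?_).trans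
      ((Frame.exec (.setNat 2 (.const 0)) _).mono ?_) <;>
      simp +contextual [scan, Prog.any]
  refine runs_loop L.length hB (fun i s' => Frame (scan body) s s' ∧ Inv i s' ∧
    s'.natReg 1 = natPos (s.natReg 20) L i ∧ s'.natReg 2 = realPos L i)
    ⟨hF, hInv _ _ _ _ (.inr (.inl rfl)) (hInv _ _ _ _ (.inl rfl) h0), ?_, ?_⟩ ?_ ?_ ?_
  · simp [Instr.exec, natPos, NatExp.eval]
  · simp [Instr.exec, realPos, NatExp.eval]
  · rintro i s' - hi ⟨hf, -, hp, -⟩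
    simp only [Test.holds_lt, NatExp.eval, hp, hf.nat _ ha2, ← hE.limit_eq]
    refine ⟨fun h => lt_of_le_of_ne hi ?_, fun h => natPos_lt _ _ h⟩
    rintro rfl
    exact lt_irrefl _ h
  · rintro i s' - hi ⟨hf, hI, hp, hq⟩
    refine runs_instr_seq ?_
    have hs := hE.stored i hi
    have hf' : Frame (scan body) s (Instr.exec s' (.setNat 3 (.get 0 (.reg 1)))) :=
      hf.trans ((Frame.exec _ s').mono (by simp +contextual [scan, Prog.any]))
    refine (step i hi _ hf' (hInv _ _ _ _ (.inr (.inr rfl)) hI) ?_ ?_ ?_ ?_).call_seq ?_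
    · simpa [Instr.exec, hp, hq, hf.natArr _ ha3, hf.realArr _ ha4] using hs
    · simpa [Instr.exec] using hp
    · simpa [Instr.exec] using hq
    · simpa [Instr.exec, NatExp.eval, hf.natArr _ ha3, hp] using hs.arity
    · intro s2 hf2 ⟨h4, hI2⟩
      refine runs_instr_seq (runs_instr.2 ⟨?_, hInv _ _ _ _ (.inr (.inl rfl))
        (hInv _ _ _ _ (.inl rfl) hI2), ?_, ?_⟩)
      · refine hf'.trans ((hf2.mono ?_).trans (((Frame.exec _ _).mono ?_).trans
          ((Frame.exec _ _).mono ?_))) <;> simp +contextual [scan, Prog.any]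
      · simp only [Instr.exec, NatExp.eval, Function.update_apply]
        simp [hf2.nat 1 h1, hf2.nat 3 h3, Instr.exec, NatExp.eval, natPos_succ _ hi, hp,
          hf.natArr _ ha3, hs.arity]
      · simp [hf2.nat 2 h2, Instr.exec, NatExp.eval, realPos_succ hi, hq, h4]
  · rintro s' - ⟨-, hI, -⟩
    exact hI

/-- Horner's scheme. -/
def hornerVal (b : ℕ → Bool) : ℕ → ℕ
  | 0 => 0
  | i + 1 => 2 * hornerVal b i + (b i).toNat

theorem hornerVal_lt (b : ℕ → Bool) (i : ℕ) : hornerVal b i < 2 ^ i := by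
  induction i with
  | zero => simp [hornerVal]
  | succ i ih =>
    have := Bool.toNat_le (b i)
    rw [hornerVal, pow_succ]
    omega

theorem testBit_hornerVal (b : ℕ → Bool) {i j : ℕ} (h : j < i) :
    (hornerVal b i).testBit (i - 1 - j) = b j := by
  induction i with
  | zero => omega
  | succ i ih =>
    rcases Nat.lt_succ_iff_lt_or_eq.1 h with hj | rfl
    · rw [show i + 1 - 1 - j = (i - 1 - j) + 1 by omega, Nat.testBit_succ, ← ih hj, hornerVal]
      congr 1
      have := Bool.toNat_le (b i)
      omega
    · rw [show j + 1 - 1 - j = 0 by omega, hornerVal, Nat.testBit_zero]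
      cases b j <;> simp

/-- Horner's scheme takes the first argument as the most significant bit, which is the lexicographic
order of the table. -/
theorem lexTuple_hornerVal (b : ℕ → Bool) (k : ℕ) :
    Constraint.lexTuple k (hornerVal b k) = fun i : Fin k => b i := by
  funext i
  exact testBit_hornerVal b i.2

/-- Compute the table index that belongs to the assignment in array `2`, in register `6`. -/
def horner : Prog :=
  setN 6 (.const 0) ;; setN 4 (.const 1) ;; setN 5 (.const 0) ;; .loop (.lt (.reg 5) (.reg 3))
    (setN 6 (.reg 6 + .reg 6 + .get 2 (.get 0 (.reg 1 + .const 1 + .reg 5))) ;;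
      -- Repeated doubling also produces the length `2 ^ k` of the table, which `scan` expects in
      -- register `4`.
      setN 4 (.reg 4 + .reg 4) ;; setN 5 (.reg 5 + .const 1))

theorem runs_horner (b : ℕ → Bool) (hB : s.natReg 3 ≤ B)
    (hb : ∀ i < s.natReg 3,
      (s.natArr 2).getD ((s.natArr 0).getD (s.natReg 1 + 1 + i) 0) 0 = (b i).toNat) :
    Runs B horner s fun s' =>
      s'.natReg 4 = 2 ^ s.natReg 3 ∧ s'.natReg 6 = hornerVal b (s.natReg 3) := by
  refine runs_instr_seq (runs_instr_seq (runs_instr_seq ?_))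
  refine runs_loop (s.natReg 3) hB (fun i s' => s'.natReg 5 = i ∧ s'.natReg 4 = 2 ^ i ∧
    s'.natReg 6 = hornerVal b i) ?_ ?_ ?_ ?_
  · simp [Instr.exec, hornerVal, NatExp.eval]
  · rintro i s' hf - ⟨h5, -, -⟩
    rw [Test.holds_lt]
    simp [NatExp.eval, h5, hf.nat 3 rfl, Instr.exec]
  · rintro i s' hf hi ⟨h5, h4, h6⟩
    refine runs_instr_seq (runs_instr_seq (runs_instr.2 ?_))
    have := hb i hi
    simp [Instr.exec, NatExp.eval, h5, h4, h6, hf.nat 1 rfl, hf.natArr 0 rfl, hf.natArr 2 rfl,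
      hornerVal, pow_succ, this] at this ⊢
    omega
  · rintro s' - ⟨-, h4, h6⟩
    exact ⟨h4, h6⟩

/-- Compute the measure of the assignment in array `2`, in the real register `0`. -/
def evalTotal : Prog :=
  setR 0 (.const 1) ;;
    scan (horner ;; setR 0 (.mul (.reg 0) (.get 0 (.reg 2 + .reg 6))))

theorem runs_evalTotal (σ : ℕ → Bool)
    (hE : Encodes L (s.natArr 0) (s.realArr 0) (s.natReg 20) (s.natReg 21)) (hB : L.length ≤ B)
    (hk : ∀ a ∈ L, a.con.arity ≤ B)
    (hσ : ∀ v < n, (s.natArr 2).getD v 0 = (σ v).toNat) :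
    Runs B evalTotal s fun s' => s'.realReg 0 = total L σ := by
  refine runs_instr_seq ?_
  refine runs_scan rfl rfl rfl rfl rfl rfl rfl ?_ hB
    (fun i s' => s'.realReg 0 = total (L.take i) σ) ?_ ?_ ?_ ?_
  · simpa [Instr.exec] using hE
  · exact fun _ _ _ _ _ h => h
  · simp [Instr.exec, total, RealExp.eval]
  · intro i hi s' hf hI hs _ _ h3
    have hval : ∀ j (hj : j < L[i].con.arity), (s'.natArr 2).getD
        ((s'.natArr 0).getD (s'.natReg 1 + 1 + j) 0) 0 =
          ((fun j => if h : j < L[i].con.arity then σ (L[i].vars ⟨j, h⟩) else false) j).toNat := by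
      intro j hj
      rw [hs.vars j hj, hf.natArr 2 rfl]
      simp [Instr.exec, hσ, hj]
    refine (runs_horner _ (h3 ▸ hk _ (List.getElem_mem hi)) (by rw [h3]; exact hval)).call_seq ?_
    rintro s2 hf2 ⟨h4, h6⟩
    refine runs_instr.2 ⟨?_, ?_⟩
    · simp [Instr.exec, h4, h3]
    · have h1 := hs.table _ (hornerVal_lt
        (fun j => if h : j < L[i].con.arity then σ (L[i].vars ⟨j, h⟩) else false) _)
      rw [lexTuple_hornerVal] at h1
      rw [h3] at h6
      simp only [Instr.exec, RealExp.eval, NatExp.eval, hf2.real 0 rfl,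
        hf2.realArr 0 rfl, hf2.nat 2 rfl, h6, h1, hI, Function.update_self]
      simp [total_take_succ hi, value]
  · exact fun s' _ h => by simpa using h

end RealRAM

end

/-! ### Programs that recognize solutions and compute the measure -/

noncomputable section

attribute [-simp] List.getD_eq_getElem?_getD List.length_flatMap

namespace Application

variable {n : ℕ}

theorem length_le_flatMap (L : List (Application n)) : L.length ≤ (L.flatMap nats).length := by
  induction L with
  | nil => simp
  | cons a L ih =>
    rw [List.flatMap_cons, List.length_append, List.length_cons, nats_length]
    omega

theorem arity_lt_flatMap {L : List (Application n)} {a : Application n} (h : a ∈ L) :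
    a.con.arity < (L.flatMap nats).length := by
  obtain ⟨L₁, L₂, rfl⟩ := List.append_of_mem h
  simp only [List.flatMap_append, List.flatMap_cons, List.length_append, nats_length]
  omega

/-- This is why loops over all entries of a table are polynomial in the size of the instance. -/
theorem two_pow_le_flatMap {L : List (Application n)} {a : Application n} (h : a ∈ L) :
    2 ^ a.con.arity ≤ (L.flatMap fun a => a.con.table).length := by
  obtain ⟨L₁, L₂, rfl⟩ := List.append_of_mem h
  simp only [List.flatMap_append, List.flatMap_cons, List.length_append, Constraint.table_length]
  omega

end Application

namespace RealRAM

open Application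

variable {B n : ℕ} {s : State} {Q : State → Prop} {L : List (Application n)}

/-! ## Flags -/

open Classical in
/-- A truth value as a number. -/
def flag (p : Prop) : ℕ := if p then 1 else 0

theorem flag_of {p : Prop} (h : p) : flag p = 1 := if_pos h

theorem flag_of_not {p : Prop} (h : ¬ p) : flag p = 0 := if_neg h

theorem flag_congr {p q : Prop} (h : p ↔ q) : flag p = flag q := by rw [propext h]

theorem flag_eq_one {p : Prop} : flag p = 1 ↔ p := by
  by_cases h : p <;> simp [flag, h]

/-- Clear the flag `f` unless the test `b` holds after `pre` for all values of the register `r` up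
to the limit `e`. -/
def checkAll (r : ℕ) (e : NatExp) (pre : Prog) (b : Test) (f : ℕ) : Prog :=
  setN r (.const 0) ;; .loop (.lt (.reg r) e)
    (pre ;; .ite b (setN r (.reg r + .const 1)) (setN f (.const 0) ;; setN r (.reg r + .const 1)))

/-- The flag may already carry a condition `p`, so that several checks can be accumulated in one
register. -/
theorem runs_checkAll {r f : ℕ} {e : NatExp} {pre : Prog} {b : Test} (hrf : r ≠ f)
    (hr : pre.any (Instr.wNat · r) = false) (hf : pre.any (Instr.wNat · f) = false)
    (N : ℕ) (hN : N ≤ B) (p : Prop) (q : ℕ → Prop) (hp : s.natReg f = flag p)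
    (he : ∀ s', Frame (checkAll r e pre b f) s s' → e.eval s' = N)
    (hq : ∀ i < N, ∀ s', Frame (checkAll r e pre b f) s s' → s'.natReg r = i →
      Runs B pre s' fun s'' => (b.Holds s'' ↔ q i)) :
    Runs B (checkAll r e pre b f) s fun s' => s'.natReg f = flag (p ∧ ∀ i < N, q i) := by
  refine runs_instr_seq ?_
  have hF : Frame (checkAll r e pre b f) s (Instr.exec s (.setNat r (.const 0))) :=
    (Frame.exec _ s).mono (by simp +contextual [checkAll, Prog.any])
  refine runs_loop N hN (fun i s' => Frame (checkAll r e pre b f) s s' ∧ s'.natReg r = i ∧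
    s'.natReg f = flag (p ∧ ∀ j < i, q j)) ⟨hF, ?_, ?_⟩ ?_ ?_ ?_
  · simp [Instr.exec, NatExp.eval]
  · simp [Instr.exec, hp, hrf.symm]
  · rintro i s' - - ⟨h1, h2, -⟩
    rw [Test.holds_lt, he s' h1, NatExp.eval, h2]
  · rintro i s' - hi ⟨h1, h2, h3⟩
    refine (hq i hi s' h1 h2).call_seq fun s2 hf2 hb => ?_
    have hF2 : Frame (checkAll r e pre b f) s s2 :=
      h1.trans (hf2.mono (by simp +contextual [checkAll, Prog.any]))
    have h2' := (hf2.nat r hr).trans h2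
    have h3' := (hf2.nat f hf).trans h3
    refine runs_ite (fun h => ?_) fun h => ?_
    · refine runs_instr.2
        ⟨hF2.trans ((Frame.exec _ _).mono (by simp +contextual [checkAll, Prog.any])), ?_, ?_⟩
      · simp [Instr.exec, NatExp.eval, h2']
      · simp only [Instr.exec, Function.update_apply, hrf.symm, if_false, h3']
        refine flag_congr (and_congr_right fun _ => ?_)
        rw [Nat.forall_lt_succ_right]
        exact (and_iff_left (hb.1 h)).symm
    · refine runs_instr_seq (runs_instr.2 ⟨hF2.trans (((Frame.exec _ _).mono ?_).trans
        ((Frame.exec _ _).mono ?_)), ?_, ?_⟩)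
      · simp +contextual [checkAll, Prog.any]
      · simp +contextual [checkAll, Prog.any]
      · simp [Instr.exec, NatExp.eval, h2', hrf]
      · simp only [Instr.exec, Function.update_apply, hrf.symm, if_false, if_true, NatExp.eval]
        exact (flag_of_not fun h' => h (hb.2 (h'.2 i (Nat.lt_succ_self i)))).symm
  · rintro s' - ⟨-, -, h⟩
    exact h

/-- An instruction without effect. -/
def skip : Prog := setN 5 (.reg 5)

/-- Output the flag in register `8`. -/
def answer : Prog :=
  .instr (.clearReal 0) ;; .instr (.clearNat 0) ;; .instr (.pushNat 0 (.reg 8))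

theorem runs_answer {p : Prop} (h : s.natReg 8 = flag p) :
    Runs B answer s fun s' => (p → s'.output = Word.yes) ∧ (¬ p → s'.output = Word.no) := by
  refine runs_instr_seq (runs_instr_seq (runs_instr.2 ?_))
  constructor <;> intro hp
  · simp [Instr.exec, State.output, Word.yes, NatExp.eval, h, flag_of hp]
  · simp [Instr.exec, State.output, Word.no, NatExp.eval, h, flag_of_not hp]

/-! ## Recognition of solutions -/

/-- Decide whether the second component of a pair encodes an assignment for the first one. -/
def solutionProg : Prog :=
  setN 8 (.const 1) ;;
  -- In a pair, the entries `0` and `1` are the lengths of the two lists of the first word and entry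
  -- `2` is its `n`. The naturals of the second word begin two places behind the first length.
  .ite (.and (.natLe (.realLen 0) (.get 0 (.const 1)))
      (.eq (.natLen 0) (.get 0 (.const 0) + .const 2 + .get 0 (.const 2))))
    (checkAll 16 (.get 0 (.const 2)) skip
      (.natLe (.get 0 (.get 0 (.const 0) + .const 2 + .reg 16)) (.const 1)) 8)
    (setN 8 (.const 0)) ;;
  answer

theorem exists_encAssignment_iff (n : ℕ) (v : Word) :
    (∃ σ : Fin n → Bool, v = encAssignment σ) ↔
      v.reals = [] ∧ v.nats.length = n ∧ ∀ i < n, v.nats.getD i 0 ≤ 1 := by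
  constructor
  · rintro ⟨σ, rfl⟩
    refine ⟨rfl, by simp [encAssignment], fun i hi => ?_⟩
    simp [encAssignment, List.getD_eq_getElem?_getD, hi, Bool.toNat_le]
  · obtain ⟨N, R⟩ := v
    rintro ⟨h1, h2, h3⟩
    dsimp only at h1 h2 h3
    subst h1 h2
    refine ⟨fun i => N[i] == 1, ?_⟩
    simp only [encAssignment, Word.mk.injEq, and_true]
    refine List.ext_getElem (by simp) fun i hi _ => ?_
    have := h3 i hi
    rw [List.getD_eq_getElem _ _ hi] at this
    simp only [List.getElem_ofFn]
    rcases Nat.le_one_iff_eq_zero_or_eq_one.1 this with h | h <;> simp [h]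

theorem runs_solutionProg {F : Set Constraint} (x : CSPInstance F) (v : Word)
    (hB : x.n ≤ B) : Runs B solutionProg (State.init (x.enc.pair v)) fun s =>
      ((∃ σ : Fin x.n → Bool, v = encAssignment σ) → s.output = Word.yes) ∧
      (¬ (∃ σ : Fin x.n → Bool, v = encAssignment σ) → s.output = Word.no) := by
  have hw : x.enc.pair v = ⟨x.enc.nats.length :: x.enc.reals.length :: x.n ::
    (x.apps.flatMap nats ++ v.nats), x.enc.reals ++ v.reals⟩ := rfl
  have hl : x.enc.nats.length = (x.apps.flatMap nats).length + 1 := rfl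
  refine runs_instr_seq (runs_seq (Runs.call (P := fun s' => s'.natReg 8 =
    flag (∃ σ : Fin x.n → Bool, v = encAssignment σ)) (runs_ite (fun h => ?_) fun h => ?_)
    fun s' _ h => runs_answer h))
  · refine (runs_checkAll (by decide) rfl rfl x.n hB True (fun i => v.nats.getD i 0 ≤ 1) ?_ ?_
      ?_).call fun s' _ h' => ?_
    · simp [Instr.exec, NatExp.eval, flag_of]
    · intro s' hf
      simp [NatExp.eval, hf.natArr 0 rfl, Instr.exec, State.init, hw, List.getD_cons_succ,
        List.getD_cons_zero]
    · intro i hi s' hf h16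
      refine runs_instr.2 ?_
      simp only [Test.Holds, NatExp.eval, Instr.exec, hf.natArr 0 rfl, State.init,
        if_true, hw, List.getD_cons_zero, Function.update_apply, h16, hl]
      rw [if_neg (by decide)]
      rw [show (x.apps.flatMap nats).length + 1 + 2 + i =
        ((x.apps.flatMap nats).length + i) + 1 + 1 + 1 by omega]
      simp [List.getD_cons_succ, List.getD_append_right]
    · rw [h']
      refine flag_congr ?_
      rw [exists_encAssignment_iff]
      simp [Test.Holds, NatExp.eval, Instr.exec, State.init, hw, hl, List.getD_cons_succ,
        List.getD_cons_zero] at h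
      have h1 : v.reals.length = 0 := by simp [h.1]
      have h2 : v.nats.length = x.n := by omega
      simp [List.length_eq_zero_iff.1 h1, h2]
  · refine runs_instr.2 ?_
    rw [exists_encAssignment_iff, flag_of_not]
    · simp [Instr.exec, NatExp.eval]
    · rintro ⟨h1, h2, -⟩
      apply h
      simp [Test.Holds, NatExp.eval, Instr.exec, State.init, hw, hl, List.getD_cons_succ,
        List.getD_cons_zero, h1, h2]
      omega

/-! ## Computation of the measure -/

/-- Compute the measure of a pair of an instance and an assignment. -/
def measureProg : Prog :=
  -- Two lengths and `n` precede the applications. Register `21` is both the end of the applications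
  -- and the beginning of the assignment.
  setN 0 (.get 0 (.const 2)) ;; setN 20 (.const 3) ;; setN 21 (.get 0 (.const 0) + .const 2) ;;
  setN 16 (.const 0) ;;
  .loop (.lt (.reg 16) (.reg 0))
    (.instr (.pushNat 2 (.get 0 (.reg 21 + .reg 16))) ;; setN 16 (.reg 16 + .const 1)) ;;
  evalTotal ;; .instr (.clearNat 0) ;; .instr (.clearReal 0) ;; .instr (.pushReal 0 (.reg 0))

/-- An assignment as a function on all naturals. -/
def extend {n : ℕ} (σ : Fin n → Bool) (v : ℕ) : Bool := if h : v < n then σ ⟨v, h⟩ else false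

theorem extend_fin {n : ℕ} (σ : Fin n → Bool) : (fun v : Fin n => extend σ v) = σ := by
  funext v
  simp [extend]

theorem total_extend (L : List (Application n)) (σ : Fin n → Bool) :
    total L (extend σ) = (L.map fun a => a.value σ).prod := by
  simp only [total, extend_fin]

theorem getD_map_range {α : Type*} (f : ℕ → α) (d : α) {N i : ℕ} (h : i < N) :
    ((List.range N).map f).getD i d = f i := by
  rw [List.getD_eq_getElem _ _ (by simpa using h)]
  simp

theorem runs_measureProg {F : Set Constraint} (x : CSPInstance F) (σ : Fin x.n → Bool)
    (hB : x.enc.size ≤ B) : Runs B measureProg (State.init (x.enc.pair (encAssignment σ))) fun s =>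
      s.output = ⟨[], [(((x.apps.map fun a => a.value σ).prod : ℝ≥0) : ℝ)]⟩ := by
  have hN : (x.enc.pair (encAssignment σ)).nats = [x.enc.nats.length, x.enc.reals.length, x.n] ++
    x.apps.flatMap nats ++ List.ofFn fun i => (σ i).toNat := by
    simp [Word.pair, CSPInstance.enc, encAssignment]
  have hR : (x.enc.pair (encAssignment σ)).reals =
    (x.apps.flatMap fun a => a.con.table) ++ [] := rfl
  have hl : x.enc.nats.length = (x.apps.flatMap nats).length + 1 := rfl
  have hsz : (x.apps.flatMap nats).length + 1 + (x.n + (x.apps.flatMap nats).sum) +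
    (x.apps.flatMap fun a => a.con.table).length ≤ B := hB
  have hE := encodes_append x.apps [x.enc.nats.length, x.enc.reals.length, x.n]
    (List.ofFn fun i => (σ i).toNat) []
  rw [← hN, ← hR] at hE
  have hg : ∀ i (h : i < x.n), (x.enc.pair (encAssignment σ)).nats.getD
      ((x.apps.flatMap nats).length + 3 + i) 0 = (σ ⟨i, h⟩).toNat := by
    intro i h
    rw [hN, List.getD_append_right _ _ _ _ (by simp),
      List.getD_eq_getElem _ _ (by simp; omega)]
    simp only [List.getElem_ofFn]
    congr 3
    simp
  have h0 : (x.enc.pair (encAssignment σ)).nats.getD 0 0 = (x.apps.flatMap nats).length + 1 := by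
    rw [hN]; rfl
  have h2 : (x.enc.pair (encAssignment σ)).nats.getD 2 0 = x.n := by rw [hN]; rfl
  refine runs_instr_seq (runs_instr_seq (runs_instr_seq (runs_instr_seq (runs_seq ?_))))
  refine runs_loop x.n (by omega) (fun i s' => s'.natReg 16 = i ∧
    s'.natArr 2 = (List.range i).map fun v => (extend σ v).toNat) ?_ ?_ ?_ ?_
  · simp [Instr.exec, State.init, NatExp.eval]
  · rintro i s' hf - ⟨h16, -⟩
    rw [Test.holds_lt]
    simp [NatExp.eval, h16, hf.nat 0 rfl, Instr.exec, State.init, h2]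
  · rintro i s' hf hi ⟨h16, hA⟩
    refine runs_instr_seq (runs_instr.2 ?_)
    simp [Instr.exec, NatExp.eval, h16, hA, hf.nat 21 rfl, hf.natArr 0 rfl, State.init, h0, hg i hi,
      List.range_succ, extend, hi]
  · rintro s' hf ⟨-, hA⟩
    refine (runs_evalTotal (L := x.apps) (extend σ) ?_ ?_ ?_ ?_).call_seq fun s2 hf2 h => ?_
    · simpa [hf.natArr 0 rfl, hf.realArr 0 rfl, hf.nat 20 rfl, hf.nat 21 rfl, Instr.exec,
        State.init, NatExp.eval, h0, Nat.add_comm 3] using hE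
    · have := length_le_flatMap x.apps
      omega
    · intro a ha
      have := arity_lt_flatMap ha
      omega
    · intro v hv
      rw [hA, getD_map_range _ _ hv]
    · refine runs_instr_seq (runs_instr_seq (runs_instr.2 ?_))
      simp [Instr.exec, State.output, RealExp.eval, h, total_extend]

end RealRAM

/-! ### Solutions and measure of the maximization problem -/

section Problem

open RealRAM

theorem maxProdCSP_solutionsRecognizable (F : Set Constraint) :
    (maxProdCSP F).SolutionsRecognizable := by
  obtain ⟨p, hp⟩ := solutionProg.exists_cost_poly
  refine ⟨solutionProg, p, ?_⟩
  rintro w ⟨x, v, rfl⟩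
  -- Pairing and the encoding of instances are injective, so only the second component remains to be
  -- tested.
  have hiff : Word.pair ((maxProdCSP F).encInst x) v ∈ {w | ∃ (x : (maxProdCSP F).Inst)
      (y : (maxProdCSP F).Sol x), w = Word.pair ((maxProdCSP F).encInst x)
        ((maxProdCSP F).encSol x y)} ↔ ∃ σ : Fin x.n → Bool, v = encAssignment σ := by
    constructor
    · rintro ⟨x', y, h⟩
      obtain ⟨h1, h2⟩ := Word.pair_injective h
      obtain rfl := (maxProdCSP F).encInst_injective h1
      exact ⟨y, h2⟩
    · rintro ⟨σ, rfl⟩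
      exact ⟨x, σ, rfl⟩
  have hB : x.n ≤ (Word.pair ((maxProdCSP F).encInst x) v).size := by
    simp [Word.size, Word.pair, maxProdCSP, CSPInstance.enc]
    omega
  have h := runs_solutionProg x v hB
  rw [hiff, hp]
  exact ⟨fun hs => (h.call fun s _ h => h.1 hs).yields le_rfl,
    fun hs => (h.call fun s _ h => h.2 hs).yields le_rfl⟩

theorem maxProdCSP_solutionsBounded (F : Set Constraint) :
    (maxProdCSP F).SolutionsBounded := by
  -- An assignment consists of `n` naturals with sum at most `n`.
  refine ⟨2 * Polynomial.X, fun x σ => ?_⟩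
  have h1 : (List.ofFn fun i => (σ i).toNat).sum ≤ x.n := by
    rw [List.sum_ofFn]
    refine (Finset.sum_le_card_nsmul _ _ 1 fun i _ => Bool.toNat_le _).trans ?_
    simp only [Finset.card_univ, smul_eq_mul, mul_one]
    exact (Fintype.card_fin _).le
  have h2 : ((maxProdCSP F).encSol x σ).size =
      x.n + (List.ofFn fun i => (σ i).toNat).sum := by
    simp only [Word.size, maxProdCSP, encAssignment, List.length_ofFn, List.length_nil, add_zero]
  have h3 : x.n ≤ ((maxProdCSP F).encInst x).size := by
    simp [Word.size, maxProdCSP, CSPInstance.enc]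
    omega
  rw [h2]
  simp only [Polynomial.eval_mul, Polynomial.eval_ofNat, Polynomial.eval_X]
  omega

theorem maxProdCSP_measureComputable (F : Set Constraint) :
    (maxProdCSP F).MeasureComputable := by
  obtain ⟨p, hp⟩ := measureProg.exists_cost_poly
  refine ⟨measureProg, p, fun x σ => (runs_measureProg x σ ?_).yields (hp _).ge⟩
  simp [Word.size, Word.pair, maxProdCSP, CSPInstance.enc]
  omega

end Problem

/-! ### The program for the optimum -/

namespace RealRAM

open Application

variable {B n : ℕ} {s : State} {Q : State → Prop} {L : List (Application n)}

/-! ## Classes of variables in memory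

Register `0` holds the number `n` of variables, array `1` the labels and array `2` the values of the
variables `0, …, n`. -/

/-- The arrays `1` and `2` hold `lab` and `σ`. -/
structure Rep (n : ℕ) (s : State) (lab : ℕ → ℕ) (σ : ℕ → Bool) : Prop where
  lab : s.natArr 1 = (List.range (n + 1)).map lab
  val : s.natArr 2 = (List.range (n + 1)).map fun w => (σ w).toNat

theorem map_range_set {α : Type*} (f : ℕ → α) (N i : ℕ) (a : α) :
    ((List.range N).map f).set i a = (List.range N).map (Function.update f i a) := by
  refine List.ext_getElem (by simp) fun j h1 h2 => ?_
  simp only [List.getElem_set, List.getElem_map, List.getElem_range, Function.update_apply,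
    eq_comm (a := i)]

/-- The sum modulo `2` of two bits is their distance, which truncated subtraction in both directions
expresses. -/
theorem toNat_xor (a b : Bool) :
    (a ^^ b).toNat = (a.toNat - b.toNat) + (b.toNat - a.toNat) := by
  cases a <;> cases b <;> rfl

/-- The sum modulo `2` of two bits. -/
abbrev NatExp.xor (e₁ e₂ : NatExp) : NatExp := (e₁ - e₂) + (e₂ - e₁)

/-- Rename the class in register `13` to the label in register `14` and add the bit in register `15`
to its values. -/
def relabelProg : Prog :=
  setN 16 (.const 0) ;; .loop (.lt (.reg 16) (.reg 0 + .const 1))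
    (.ite (.eq (.get 1 (.reg 16)) (.reg 13))
      (.instr (.writeNat 1 (.reg 16) (.reg 14)) ;;
        .instr (.writeNat 2 (.reg 16) (.xor (.get 2 (.reg 16)) (.reg 15))) ;;
        setN 16 (.reg 16 + .const 1))
      (setN 16 (.reg 16 + .const 1)))

theorem runs_relabelProg {lab : ℕ → ℕ} {σ : ℕ → Bool} {c c' : ℕ} {d : Bool} (hB : n + 1 ≤ B)
    (hr : Rep n s lab σ) (h0 : s.natReg 0 = n) (h13 : s.natReg 13 = c) (h14 : s.natReg 14 = c')
    (h15 : s.natReg 15 = d.toNat) :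
    Runs B relabelProg s fun s' => Rep n s' (relabel lab c c') (shiftClass lab σ c d) := by
  refine runs_instr_seq ?_
  -- Entries below `i` are updated and the others are untouched. Each entry is visited once and
  -- compared with the fixed label `c`, so the updates do not interfere, even if `c' = c`.
  refine runs_loop (n + 1) hB (fun i s' => s'.natReg 16 = i ∧
    Rep n s' (fun w => if w < i then relabel lab c c' w else lab w)
      (fun w => if w < i then shiftClass lab σ c d w else σ w)) ?_ ?_ ?_ ?_
  · refine ⟨by simp [Instr.exec, NatExp.eval], ?_, ?_⟩
    · simp [Instr.exec, hr.lab]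
    · simp [Instr.exec, hr.val]
  · rintro i s' hf - ⟨h16, -⟩
    rw [Test.holds_lt]
    simp [NatExp.eval, h16, hf.nat 0 rfl, Instr.exec, h0]
  · rintro i s' hf hi ⟨h16, hr'⟩
    have e0 : s'.natReg 13 = c := by rw [hf.nat 13 rfl]; simpa [Instr.exec] using h13
    have e1 : s'.natReg 14 = c' := by rw [hf.nat 14 rfl]; simpa [Instr.exec] using h14
    have e2 : s'.natReg 15 = d.toNat := by rw [hf.nat 15 rfl]; simpa [Instr.exec] using h15
    have e3 : (s'.natArr 1).getD i 0 = lab i := by rw [hr'.lab, getD_map_range _ _ hi]; simp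
    have e4 : (s'.natArr 2).getD i 0 = (σ i).toNat := by
      rw [hr'.val, getD_map_range _ _ hi]; simp
    refine runs_ite (fun h => ?_) fun h => ?_
    · rw [Test.holds_eq] at h
      simp only [NatExp.eval, h16, e0, e3] at h
      refine runs_instr_seq (runs_instr_seq (runs_instr.2 ⟨?_, ?_, ?_⟩))
      · simp [Instr.exec, NatExp.eval, h16]
      · simp only [Instr.exec, NatExp.eval, h16, e1, Function.update_apply, hr'.lab]
        simp only [map_range_set, if_true, OfNat.one_ne_ofNat, if_false]
        refine List.map_congr_left fun w _ => ?_
        rcases lt_trichotomy w i with hw | rfl | hw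
        · simp [hw, hw.ne, Nat.lt_succ_of_lt hw]
        · simp [relabel, h]
        · simp [hw.ne', not_lt.2 hw.le, not_lt.2 (Nat.succ_le_of_lt hw)]
      · have e5 : ∀ x : ℕ, x = (σ i).toNat →
            (x - d.toNat) + (d.toNat - x) = (σ i ^^ d).toNat := by
          rintro _ rfl; rw [toNat_xor]
        simp [Instr.exec, NatExp.eval, h16, e2, e4]
        rw [e5 _ rfl, hr'.val, map_range_set]
        refine List.map_congr_left fun w _ => ?_
        rcases lt_trichotomy w i with hw | rfl | hw
        · simp [hw, hw.ne, hw.le]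
        · simp [shiftClass, h]
        · simp [hw.ne', not_lt.2 hw.le, not_le.2 hw]
    · rw [Test.holds_eq] at h
      simp only [NatExp.eval, h16, e0, e3] at h
      refine runs_instr.2 ⟨?_, ?_, ?_⟩
      · simp [Instr.exec, NatExp.eval, h16]
      · simp only [Instr.exec, hr'.lab]
        refine List.map_congr_left fun w _ => ?_
        rcases lt_trichotomy w i with hw | rfl | hw
        · simp [hw, Nat.lt_succ_of_lt hw]
        · simp [relabel, h]
        · simp [not_lt.2 hw.le, not_lt.2 (Nat.succ_le_of_lt hw)]
      · simp only [Instr.exec, hr'.val]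
        refine List.map_congr_left fun w _ => ?_
        rcases lt_trichotomy w i with hw | rfl | hw
        · simp [hw, Nat.lt_succ_of_lt hw]
        · simp [shiftClass, h]
        · simp [not_lt.2 hw.le, not_lt.2 (Nat.succ_le_of_lt hw)]
  · rintro s' - ⟨-, hr'⟩
    refine ⟨hr'.lab.trans (List.map_congr_left fun w hw => ?_),
      hr'.val.trans (List.map_congr_left fun w hw => ?_)⟩ <;>
    simp [List.mem_range.1 hw]

/-! ## Search for ties -/

/-- Compute the bits of the table index in register `6`, in array `4`. -/
def decode : Prog :=
  .instr (.clearNat 4) ;; setN 7 (.reg 6) ;; setN 5 (.const 0) ;;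
  .loop (.lt (.reg 5) (.reg 3))
    (setN 7 (.reg 7 + .reg 7) ;;
      .ite (.natLe (.reg 4) (.reg 7))
        (.instr (.pushNat 4 (.const 1)) ;; setN 7 (.reg 7 - .reg 4) ;;
          setN 5 (.reg 5 + .const 1))
        (.instr (.pushNat 4 (.const 0)) ;; setN 5 (.reg 5 + .const 1)))

/-- Binary digits without division: doubling moves the bit `j` of `m` to the weight `2 ^ k`, where a
comparison reads it and a subtraction removes it. -/
theorem two_pow_mul_mod_pow_succ {m i j k : ℕ} (h : i + j + 1 = k) :
    2 ^ i * (m % 2 ^ (j + 1)) + 2 ^ i * (m % 2 ^ (j + 1)) =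
      2 ^ (i + 1) * (m % 2 ^ j) + if m.testBit j then 2 ^ k else 0 := by
  have h1 : m % 2 ^ (j + 1) = m % 2 ^ j + 2 ^ j * (m / 2 ^ j % 2) := Nat.mod_pow_succ
  rw [h1, Nat.testBit_eq_decide_div_mod_eq, ← h]
  rcases Nat.mod_two_eq_zero_or_one (m / 2 ^ j) with h2 | h2 <;> simp [h2] <;> ring

theorem runs_decode {k m : ℕ} (hB : k ≤ B) (h3 : s.natReg 3 = k) (h4 : s.natReg 4 = 2 ^ k)
    (h6 : s.natReg 6 = m) (hm : m < 2 ^ k) :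
    Runs B decode s fun s' =>
      s'.natArr 4 = (List.range k).map fun i => (m.testBit (k - 1 - i)).toNat := by
  refine runs_instr_seq (runs_instr_seq (runs_instr_seq ?_))
  refine runs_loop k hB (fun i s' => s'.natReg 5 = i ∧ s'.natReg 7 = 2 ^ i * (m % 2 ^ (k - i)) ∧
    s'.natArr 4 = (List.range i).map fun i => (m.testBit (k - 1 - i)).toNat) ?_ ?_ ?_ ?_
  · simp [Instr.exec, NatExp.eval, h6, Nat.mod_eq_of_lt hm]
  · rintro i s' hf - ⟨h5, -, -⟩
    rw [Test.holds_lt]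
    simp [NatExp.eval, h5, hf.nat 3 rfl, Instr.exec, h3]
  · rintro i s' hf hi ⟨h5, h7, hA⟩
    have e4 : s'.natReg 4 = 2 ^ k := by rw [hf.nat 4 rfl]; simpa [Instr.exec] using h4
    obtain ⟨j, rfl⟩ : ∃ j, k = i + j + 1 := ⟨k - i - 1, by omega⟩
    have hx := two_pow_mul_mod_pow_succ (m := m) (i := i) (j := j) rfl
    -- The part below the leading digit is less than `2 ^ k`, so the comparison with `2 ^ k` reads
    -- exactly that digit.
    have hlt : 2 ^ (i + 1) * (m % 2 ^ j) < 2 ^ (i + j + 1) := by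
      rw [show i + j + 1 = i + 1 + j by omega, pow_add 2 (i + 1)]
      exact Nat.mul_lt_mul_of_pos_left (Nat.mod_lt _ (by positivity)) (by positivity)
    rw [show i + j + 1 - i = j + 1 by omega] at h7
    refine runs_instr_seq (runs_ite (fun h => ?_) fun h => ?_)
    · simp [Test.Holds, Instr.exec, NatExp.eval, e4, h7, hx] at h
      have hb : m.testBit j = true := by
        by_contra hb
        simp [hb] at h
        omega
      refine runs_instr_seq (runs_instr_seq (runs_instr.2 ⟨?_, ?_, ?_⟩))
      · simp [Instr.exec, NatExp.eval, h5]
      · simp [Instr.exec, NatExp.eval, e4, h7, hx, hb, show i + j + 1 - (i + 1) = j by omega]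
      · simp [Instr.exec, NatExp.eval, hA, List.range_succ, hb, show i + j - i = j by omega]
    · simp [Test.Holds, Instr.exec, NatExp.eval, e4, h7, hx] at h
      have hb : m.testBit j = false := by
        by_contra hb
        rw [Bool.not_eq_false] at hb
        simp [hb] at h
      refine runs_instr_seq (runs_instr.2 ⟨?_, ?_, ?_⟩)
      · simp [Instr.exec, NatExp.eval, h5]
      · simp [Instr.exec, NatExp.eval, h7, hx, hb, show i + j + 1 - (i + 1) = j by omega]
      · simp [Instr.exec, NatExp.eval, hA, List.range_succ, hb, show i + j - i = j by omega]
  · rintro s' - ⟨-, -, h⟩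
    exact h

/-- The labels in memory are sound and identify the pairs in `C`. -/
def TieInv (L : List (Application n)) (C : ℕ → ℕ → Prop) (s : State) : Prop :=
  ∃ lab σ, Rep n s lab σ ∧ Sound L lab σ ∧ ∀ u v, C u v → lab u = lab v

theorem TieInv.mono {C C' : ℕ → ℕ → Prop} (h : TieInv L C s) (hC : ∀ u v, C' u v → C u v) :
    TieInv L C' s := by
  obtain ⟨lab, σ, h1, h2, h3⟩ := h
  exact ⟨lab, σ, h1, h2, fun u v huv => h3 u v (hC u v huv)⟩

theorem TieInv.congr {C : ℕ → ℕ → Prop} {s' : State} (h : TieInv L C s)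
    (h1 : s'.natArr 1 = s.natArr 1) (h2 : s'.natArr 2 = s.natArr 2) : TieInv L C s' := by
  obtain ⟨lab, σ, hr, h3⟩ := h
  exact ⟨lab, σ, ⟨h1.trans hr.lab, h2.trans hr.val⟩, h3⟩

/-- If the places in the registers `9` and `10` are tied with sum `e`, merge the classes of the
variables in the registers `11` and `12`. -/
def tieProg (e : Bool) : Prog :=
  setN 8 (.const 1) ;;
  checkAll 6 (.reg 4) decode
    (.not (.and (.not (.realEq (.get 0 (.reg 2 + .reg 6)) (.const 0)))
      (.not (.eq (.xor (.get 4 (.reg 9)) (.get 4 (.reg 10))) (.const e.toNat))))) 8 ;;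
  .ite (.eq (.reg 8) (.const 1))
    (setN 13 (.get 1 (.reg 11)) ;; setN 14 (.get 1 (.reg 12)) ;;
      -- Register `15` becomes `σ u + σ v + e`, the shift in `Sound.merge`.
      setN 15 (.xor (.get 2 (.reg 11)) (.get 2 (.reg 12))) ;;
      setN 15 (.xor (.reg 15) (.const e.toNat)) ;; relabelProg)
    skip

/-- Ties are a property of the values alone, hence decidable from the table without a decomposition
into factors. -/
theorem tied_iff_lexTuple (a : Application n) (x y : ℕ) (e : Bool) :
    a.Tied x y e ↔ ∀ m < 2 ^ a.con.arity,
      a.con.val (Constraint.lexTuple a.con.arity m) ≠ 0 →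
        (padTuple (Constraint.lexTuple a.con.arity m) x ^^
          padTuple (Constraint.lexTuple a.con.arity m) y) = e := by
  refine ⟨fun h m _ => h _, fun h z => ?_⟩
  obtain ⟨m, rfl⟩ := Constraint.lexTuple_surjective _ z
  exact h m m.2

/-- The place `k` lies outside the array and reads as `0`, exactly the padding bit that stands for
the variable `n`. -/
theorem getD_bits (k m x : ℕ) :
    ((List.range k).map fun i => (m.testBit (k - 1 - i)).toNat).getD x 0 =
      (padTuple (Constraint.lexTuple k m) x).toNat := by
  by_cases hx : x < k
  · rw [getD_map_range _ _ hx]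
    simp [padTuple, hx, Constraint.lexTuple]
  · rw [List.getD_eq_default _ _ (by simpa using hx)]
    simp [padTuple, hx]

theorem varAt_le (a : Application n) (x : ℕ) : a.varAt x ≤ n := by
  unfold varAt
  split_ifs
  · exact (a.vars _).2.le
  · exact le_rfl

/-- `C` collects the pairs identified so far. Merging keeps them identified because a new label
depends only on the old one. -/
theorem runs_tieProg {a : Application n} (ha : a ∈ L) {x y : ℕ} (e : Bool) {C : ℕ → ℕ → Prop}
    (hB1 : n + 1 ≤ B) (hB2 : a.con.arity ≤ B) (hB3 : 2 ^ a.con.arity ≤ B)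
    (hs : a.StoredAt (s.natArr 0) (s.realArr 0) (s.natReg 1) (s.natReg 2))
    (h0 : s.natReg 0 = n) (h3 : s.natReg 3 = a.con.arity) (h4 : s.natReg 4 = 2 ^ a.con.arity)
    (h9 : s.natReg 9 = x) (h10 : s.natReg 10 = y) (h11 : s.natReg 11 = a.varAt x)
    (h12 : s.natReg 12 = a.varAt y) (hI : TieInv L C s) :
    Runs B (tieProg e) s (TieInv L fun u v =>
      C u v ∨ a.Tied x y e ∧ u = a.varAt x ∧ v = a.varAt y) := by
  refine runs_instr_seq ?_
  refine (runs_checkAll (by decide) rfl rfl (2 ^ a.con.arity) hB3 True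
    (fun m => a.con.val (Constraint.lexTuple a.con.arity m) ≠ 0 →
        (padTuple (Constraint.lexTuple a.con.arity m) x ^^
          padTuple (Constraint.lexTuple a.con.arity m) y) = e) ?_ ?_ ?_).call_seq fun s1 hf1 h8 => ?_
  · simp [Instr.exec, NatExp.eval, flag_of]
  · intro s' hf
    simp [NatExp.eval, hf.nat 4 rfl, Instr.exec, h4]
  · intro m hm s' hf h6
    refine (runs_decode hB2 ?_ ?_ h6 hm).call fun s2 hf2 hA => ?_
    · simp [hf.nat 3 rfl, Instr.exec, h3]
    · simp [hf.nat 4 rfl, Instr.exec, h4]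
    · have ht := hs.table m hm
      have hbit : ∀ b : Bool, b.toNat = e.toNat ↔ b = e := by intro b; cases b <;> cases e <;> simp
      have e1 : s2.realArr 0 = s.realArr 0 := by
        rw [hf2.realArr 0 rfl, hf.realArr 0 rfl]; simp [Instr.exec]
      have e2 : s2.natReg 2 = s.natReg 2 := by
        rw [hf2.nat 2 rfl, hf.nat 2 rfl]; simp [Instr.exec]
      have e9 : s2.natReg 9 = x := by
        rw [hf2.nat 9 rfl, hf.nat 9 rfl]; simpa [Instr.exec] using h9
      have e10 : s2.natReg 10 = y := by
        rw [hf2.nat 10 rfl, hf.nat 10 rfl]; simpa [Instr.exec] using h10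
      have e6 : s2.natReg 6 = m := by rw [hf2.nat 6 rfl, h6]
      rw [Test.Holds, Test.Holds, Test.Holds, Test.Holds, Test.holds_realEq, Test.holds_eq]
      simp only [RealExp.eval, NatExp.eval, NatExp.eval_sub', e1, e2, e9, e10, e6,
        hA, getD_bits, ht, ← toNat_xor, hbit, NNReal.coe_eq_zero]
      tauto
  · rw [← tied_iff_lexTuple, true_and] at h8
    have hI1 : TieInv L C s1 := hI.congr (by rw [hf1.natArr 1 rfl]; rfl)
      (by rw [hf1.natArr 2 rfl]; rfl)
    refine runs_ite (fun h => ?_) fun h => ?_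
    · rw [Test.holds_eq, NatExp.eval, NatExp.eval, h8, flag_eq_one] at h
      obtain ⟨lab, σ, hr, hS, hC⟩ := hI1
      have e11 : s1.natReg 11 = a.varAt x := by
        rw [hf1.nat 11 rfl]; simpa [Instr.exec] using h11
      have e12 : s1.natReg 12 = a.varAt y := by
        rw [hf1.nat 12 rfl]; simpa [Instr.exec] using h12
      have hu := Nat.lt_succ_of_le (varAt_le a x)
      have hv := Nat.lt_succ_of_le (varAt_le a y)
      refine runs_instr_seq (runs_instr_seq (runs_instr_seq (runs_instr_seq ?_)))
      refine (runs_relabelProg (lab := lab) (σ := σ) (c := lab (a.varAt x))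
        (c' := lab (a.varAt y)) (d := (σ (a.varAt x) ^^ σ (a.varAt y) ^^ e))
        hB1 ?_ ?_ ?_ ?_ ?_).call fun s2 _ hr2 => ?_
      · exact ⟨by simpa [Instr.exec] using hr.lab, by simpa [Instr.exec] using hr.val⟩
      · simp [Instr.exec, hf1.nat 0 rfl, h0]
      · simp [Instr.exec, NatExp.eval, e11, hr.lab, getD_map_range _ _ hu]
      · simp [Instr.exec, NatExp.eval, e12, hr.lab, getD_map_range _ _ hv]
      · simp [Instr.exec, NatExp.eval, e11, e12, hr.val, getD_map_range _ _ hv,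
          getD_map_range _ _ hu, ← toNat_xor]
      · refine ⟨_, _, hr2, hS.merge _ _ e fun τ hτ hn => h.apply hτ hn ha, ?_⟩
        rintro u v (huv | ⟨-, rfl, rfl⟩)
        · simp only [relabel, hC u v huv]
        · simp only [relabel]
          split_ifs <;> simp_all
    · rw [Test.holds_eq, NatExp.eval, NatExp.eval, h8, flag_eq_one] at h
      refine runs_instr.2 (TieInv.mono (TieInv.congr hI1 rfl rfl) ?_)
      rintro u v (huv | ⟨ht, -⟩)
      · exact huv
      · exact absurd ht h

/-- Compute the power of two with exponent in register `3`, in register `4`. -/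
def powProg : Prog :=
  setN 4 (.const 1) ;; setN 5 (.const 0) ;;
  .loop (.lt (.reg 5) (.reg 3)) (setN 4 (.reg 4 + .reg 4) ;; setN 5 (.reg 5 + .const 1))

theorem runs_powProg (hB : s.natReg 3 ≤ B) :
    Runs B powProg s fun s' => s'.natReg 4 = 2 ^ s.natReg 3 := by
  refine runs_instr_seq (runs_instr_seq ?_)
  refine runs_loop (s.natReg 3) hB (fun i s' => s'.natReg 5 = i ∧ s'.natReg 4 = 2 ^ i) ?_ ?_ ?_ ?_
  · simp [Instr.exec, NatExp.eval]
  · rintro i s' hf - ⟨h5, -⟩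
    rw [Test.holds_lt]
    simp [NatExp.eval, h5, hf.nat 3 rfl, Instr.exec]
  · rintro i s' hf hi ⟨h5, h4⟩
    refine runs_instr_seq (runs_instr.2 ?_)
    simp [Instr.exec, NatExp.eval, h5, h4, pow_succ]
    omega
  · rintro s' - ⟨-, h4⟩
    exact h4

/-- Process the pair of places in the registers `9` and `10`. -/
def pairProg : Prog :=
  .ite (.lt (.reg 9) (.reg 3)) (setN 11 (.get 0 (.reg 1 + .const 1 + .reg 9)))
    (setN 11 (.reg 0)) ;;
  .ite (.lt (.reg 10) (.reg 3)) (setN 12 (.get 0 (.reg 1 + .const 1 + .reg 10)))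
    (setN 12 (.reg 0)) ;;
  tieProg false ;; tieProg true

theorem StoredAt.varAt {a : Application n} {N : List ℕ} {R : List ℝ} {p q : ℕ}
    (hs : a.StoredAt N R p q) (x : ℕ) :
    a.varAt x = if x < a.con.arity then N.getD (p + 1 + x) 0 else n := by
  unfold Application.varAt
  split_ifs with h
  · exact (hs.vars x h).symm
  · rfl

theorem runs_pairProg {a : Application n} (ha : a ∈ L) {x y : ℕ} {C : ℕ → ℕ → Prop}
    (hB1 : n + 1 ≤ B) (hB2 : a.con.arity ≤ B) (hB3 : 2 ^ a.con.arity ≤ B)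
    (hs : a.StoredAt (s.natArr 0) (s.realArr 0) (s.natReg 1) (s.natReg 2))
    (h0 : s.natReg 0 = n) (h3 : s.natReg 3 = a.con.arity) (h4 : s.natReg 4 = 2 ^ a.con.arity)
    (h9 : s.natReg 9 = x) (h10 : s.natReg 10 = y) (hI : TieInv L C s) :
    Runs B pairProg s (TieInv L fun u v =>
      C u v ∨ ∃ e, a.Tied x y e ∧ u = a.varAt x ∧ v = a.varAt y) := by
  refine Runs.call_seq (P := fun s' => s'.natReg 11 = a.varAt x)
    (runs_ite (fun h => runs_instr.2 ?_) fun h => runs_instr.2 ?_) fun s1 hf1 h11 => ?_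
  · rw [Test.holds_lt] at h
    simp only [NatExp.eval, h9, h3] at h
    simp [Instr.exec, NatExp.eval, StoredAt.varAt hs, h9, h]
  · rw [Test.holds_lt] at h
    simp only [NatExp.eval, h9, h3] at h
    simp [Instr.exec, NatExp.eval, StoredAt.varAt hs, h, h0]
  rw [← hf1.natArr 0 rfl, ← hf1.realArr 0 rfl, ← hf1.nat 1 rfl, ← hf1.nat 2 rfl] at hs
  rw [← hf1.nat 0 rfl] at h0
  rw [← hf1.nat 3 rfl] at h3
  rw [← hf1.nat 4 rfl] at h4
  rw [← hf1.nat 9 rfl] at h9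
  rw [← hf1.nat 10 rfl] at h10
  have hI := hI.congr (hf1.natArr 1 rfl) (hf1.natArr 2 rfl)
  clear hf1
  refine Runs.call_seq (P := fun s' => s'.natReg 12 = a.varAt y)
    (runs_ite (fun h => runs_instr.2 ?_) fun h => runs_instr.2 ?_) fun s2 hf1 h12 => ?_
  · rw [Test.holds_lt] at h
    simp only [NatExp.eval, h10, h3] at h
    simp [Instr.exec, NatExp.eval, StoredAt.varAt hs, h10, h]
  · rw [Test.holds_lt] at h
    simp only [NatExp.eval, h10, h3] at h
    simp [Instr.exec, NatExp.eval, StoredAt.varAt hs, h, h0]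
  rw [← hf1.natArr 0 rfl, ← hf1.realArr 0 rfl, ← hf1.nat 1 rfl, ← hf1.nat 2 rfl] at hs
  rw [← hf1.nat 0 rfl] at h0
  rw [← hf1.nat 3 rfl] at h3
  rw [← hf1.nat 4 rfl] at h4
  rw [← hf1.nat 9 rfl] at h9
  rw [← hf1.nat 10 rfl] at h10
  rw [← hf1.nat 11 rfl] at h11
  have hI := hI.congr (hf1.natArr 1 rfl) (hf1.natArr 2 rfl)
  clear hf1
  refine (runs_tieProg ha false hB1 hB2 hB3 hs h0 h3 h4 h9 h10 h11 h12 hI).call_seq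
    fun s3 hf1 hI => ?_
  rw [← hf1.natArr 0 rfl, ← hf1.realArr 0 rfl, ← hf1.nat 1 rfl, ← hf1.nat 2 rfl] at hs
  rw [← hf1.nat 0 rfl] at h0
  rw [← hf1.nat 3 rfl] at h3
  rw [← hf1.nat 4 rfl] at h4
  rw [← hf1.nat 9 rfl] at h9
  rw [← hf1.nat 10 rfl] at h10
  rw [← hf1.nat 11 rfl] at h11
  rw [← hf1.nat 12 rfl] at h12
  -- A pair tied with both sums means an empty support. Then no assignment has nonzero measure and
  -- soundness is vacuous, so the second merge does no harm.
  refine (runs_tieProg ha true hB1 hB2 hB3 hs h0 h3 h4 h9 h10 h11 h12 hI).call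
    fun s4 _ hI => hI.mono ?_
  rintro u v (h | ⟨e, h⟩)
  · exact .inl (.inl h)
  · cases e
    · exact .inl (.inr h)
    · exact .inr h

/-- Process all pairs of places of an application. -/
def pairsProg : Prog :=
  -- The additional place `k` takes part, since it represents the constant `false`.
  setN 9 (.const 0) ;; .loop (.lt (.reg 9) (.reg 3 + .const 1))
    (setN 10 (.const 0) ;;
      .loop (.lt (.reg 10) (.reg 3 + .const 1)) (pairProg ;; setN 10 (.reg 10 + .const 1)) ;;
      setN 9 (.reg 9 + .const 1))

theorem runs_pairsProg {a : Application n} (ha : a ∈ L) {C : ℕ → ℕ → Prop}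
    (hB1 : n + 1 ≤ B) (hB2 : a.con.arity + 1 ≤ B) (hB3 : 2 ^ a.con.arity ≤ B)
    (hs : a.StoredAt (s.natArr 0) (s.realArr 0) (s.natReg 1) (s.natReg 2))
    (h0 : s.natReg 0 = n) (h3 : s.natReg 3 = a.con.arity) (h4 : s.natReg 4 = 2 ^ a.con.arity)
    (hI : TieInv L C s) :
    Runs B pairsProg s (TieInv L fun u v => C u v ∨ ∃ x ≤ a.con.arity, ∃ y ≤ a.con.arity,
      ∃ e, a.Tied x y e ∧ u = a.varAt x ∧ v = a.varAt y) := by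
  refine runs_instr_seq ?_
  refine runs_loop (a.con.arity + 1) hB2 (fun i s' => s'.natReg 9 = i ∧ TieInv L (fun u v =>
    C u v ∨ ∃ x < i, ∃ y < a.con.arity + 1,
      ∃ e, a.Tied x y e ∧ u = a.varAt x ∧ v = a.varAt y) s') ?_ ?_ ?_ ?_
  · refine ⟨by simp [Instr.exec, NatExp.eval], TieInv.mono (TieInv.congr hI rfl rfl) ?_⟩
    rintro u v (h | ⟨x, hx, -⟩)
    · exact h
    · omega
  · rintro i s' hf - ⟨h9, -⟩
    rw [Test.holds_lt]
    simp [NatExp.eval, h9, hf.nat 3 rfl, Instr.exec, h3]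
  · rintro i s1 hf1 hi ⟨h9, hI1⟩
    refine runs_instr_seq (runs_seq ?_)
    refine runs_loop (a.con.arity + 1) hB2 (fun j s' => s'.natReg 10 = j ∧ TieInv L (fun u v =>
      (C u v ∨ ∃ x < i, ∃ y < a.con.arity + 1,
        ∃ e, a.Tied x y e ∧ u = a.varAt x ∧ v = a.varAt y) ∨
      ∃ y < j, ∃ e, a.Tied i y e ∧ u = a.varAt i ∧ v = a.varAt y) s') ?_ ?_ ?_ ?_
    · refine ⟨by simp [Instr.exec, NatExp.eval], TieInv.mono (TieInv.congr hI1 rfl rfl) ?_⟩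
      rintro u v (h | ⟨x, hx, -⟩)
      · exact h
      · omega
    · rintro j s' hf - ⟨h10, -⟩
      rw [Test.holds_lt]
      simp [NatExp.eval, h10, hf.nat 3 rfl, Instr.exec, hf1.nat 3 rfl, h3]
    · rintro j s2 hf2 hj ⟨h10, hI2⟩
      refine (runs_pairProg (x := i) ha hB1 (by omega) hB3 ?_ ?_ ?_ ?_ ?_ h10 hI2).call_seq
        fun s3 hf3 hI3 => runs_instr.2 ⟨?_, TieInv.mono (TieInv.congr hI3 rfl rfl) ?_⟩
      · simpa [hf2.natArr 0 rfl, hf2.realArr 0 rfl, hf2.nat 1 rfl, hf2.nat 2 rfl, Instr.exec,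
          hf1.natArr 0 rfl, hf1.realArr 0 rfl, hf1.nat 1 rfl, hf1.nat 2 rfl] using hs
      · simp [hf2.nat 0 rfl, Instr.exec, hf1.nat 0 rfl, h0]
      · simp [hf2.nat 3 rfl, Instr.exec, hf1.nat 3 rfl, h3]
      · simp [hf2.nat 4 rfl, Instr.exec, hf1.nat 4 rfl, h4]
      · simp [hf2.nat 9 rfl, Instr.exec, h9]
      · simp [Instr.exec, NatExp.eval, hf3.nat 10 rfl, h10]
      · rintro u v (h | ⟨y, hy, h⟩)
        · exact .inl (.inl h)
        · rcases Nat.lt_succ_iff_lt_or_eq.1 hy with hy | rfl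
          · exact .inl (.inr ⟨y, hy, h⟩)
          · exact .inr h
    · rintro s2 hf2 ⟨h10, hI2⟩
      refine runs_instr.2 ⟨?_, TieInv.mono (TieInv.congr hI2 rfl rfl) ?_⟩
      · simp [Instr.exec, NatExp.eval, hf2.nat 9 rfl, h9]
      · rintro u v (h | ⟨x, hx, h⟩)
        · exact .inl (.inl h)
        · rcases Nat.lt_succ_iff_lt_or_eq.1 hx with hx | rfl
          · exact .inl (.inr ⟨x, hx, h⟩)
          · exact .inr h
  · rintro s' - ⟨-, h⟩
    exact h.mono (by simp only [Nat.lt_succ_iff]; exact fun _ _ h => h)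

/-- Identify tied variables for all applications. -/
def tiesProg : Prog := scan (powProg ;; pairsProg)

/-- Soundness always refers to the whole list `L`, whereas the set of identified pairs grows with
the applications processed. At the end this set yields completeness. -/
theorem runs_tiesProg
    (hE : Encodes L (s.natArr 0) (s.realArr 0) (s.natReg 20) (s.natReg 21)) (hB : L.length ≤ B)
    (hB1 : n + 1 ≤ B) (hB2 : ∀ a ∈ L, a.con.arity + 1 ≤ B) (hB3 : ∀ a ∈ L, 2 ^ a.con.arity ≤ B)
    (h0 : s.natReg 0 = n) (hI : TieInv L (fun _ _ => False) s) :
    Runs B tiesProg s fun s' => ∃ lab σ, Rep n s' lab σ ∧ Sound L lab σ ∧ Complete L lab := by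
  refine runs_scan rfl rfl rfl rfl rfl rfl rfl hE hB
    (fun i s' => TieInv L (fun u v => ∃ a ∈ L.take i, ∃ x ≤ a.con.arity, ∃ y ≤ a.con.arity,
      ∃ e, a.Tied x y e ∧ u = a.varAt x ∧ v = a.varAt y) s') ?_ ?_ ?_ ?_
  · exact fun _ _ _ _ _ h => TieInv.congr h rfl rfl
  · exact hI.mono (by simp)
  · intro i hi s1 hf1 hI1 hs _ _ h3
    have ha := List.getElem_mem hi
    refine (runs_powProg (by rw [h3]; have := hB2 _ ha; omega)).call_seq fun s2 hf2 h4 => ?_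
    rw [h3] at h4
    rw [← hf2.natArr 0 rfl, ← hf2.realArr 0 rfl, ← hf2.nat 1 rfl, ← hf2.nat 2 rfl] at hs
    rw [← hf2.nat 3 rfl] at h3
    refine (runs_pairsProg ha hB1 (hB2 _ ha) (hB3 _ ha) hs ?_ h3 h4
      (hI1.congr (hf2.natArr 1 rfl) (hf2.natArr 2 rfl))).call fun s3 hf3 hI3 => ⟨?_, hI3.mono ?_⟩
    · rw [hf2.nat 0 rfl, hf1.nat 0 rfl, h0]
    · rw [hf3.nat 4 rfl, h4]
    · rintro u v ⟨a, ha, h⟩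
      rw [List.take_succ_eq_append_getElem hi, List.mem_append, List.mem_singleton] at ha
      rcases ha with ha | rfl
      · exact .inl ⟨a, ha, h⟩
      · exact .inr h
  · rintro s' - ⟨lab, σ, hr, hS, hC⟩
    refine ⟨lab, σ, hr, hS, fun a ha x hx y hy e h => hC _ _ ⟨a, ?_, x, hx, y, hy, e, h, rfl, rfl⟩⟩
    rwa [List.take_length]

/-! ## Greedy improvement -/

/-- Flip every class once, and flip it back if that was no improvement. -/
def improveProg : Prog :=
  setN 17 (.const 0) ;; .loop (.lt (.reg 17) (.reg 0 + .const 1))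
    (setN 13 (.get 1 (.reg 17)) ;; setN 14 (.reg 13) ;; setN 15 (.const 1) ;;
      evalTotal ;; setR 1 (.reg 0) ;; relabelProg ;; evalTotal ;;
      -- With equal labels in the registers `13` and `14`, `relabelProg` only flips the class; a
      -- second call undoes the first.
      .ite (.realLe (.reg 1) (.reg 0)) skip relabelProg ;; setN 17 (.reg 17 + .const 1))

theorem shiftClass_true (lab : ℕ → ℕ) (σ : ℕ → Bool) (c : ℕ) :
    shiftClass lab σ c true = flipBy lab (fun b => b == c) σ := by
  simp [shiftClass_eq_flipBy]

theorem runs_improveProg (hL : ∀ a ∈ L, a.con ∈ Constraint.ED) {lab : ℕ → ℕ} {σ : ℕ → Bool}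
    (hE : Encodes L (s.natArr 0) (s.realArr 0) (s.natReg 20) (s.natReg 21)) (hB : L.length ≤ B)
    (hB1 : n + 1 ≤ B) (hB2 : ∀ a ∈ L, a.con.arity ≤ B) (h0 : s.natReg 0 = n)
    (hr : Rep n s lab σ) (hC : Complete L lab) (hS : Sound L lab σ) (hσ : σ n = false) :
    Runs B improveProg s fun s' => ∃ σ', Rep n s' lab σ' ∧ ∀ τ, total L τ ≤ total L σ' := by
  refine runs_instr_seq ?_
  -- The optimality part is claimed only if some assignment has nonzero measure. Otherwise all
  -- assignments are optimal.
  refine runs_loop (n + 1) hB1 (fun i s' => s'.natReg 17 = i ∧ ∃ σ', Rep n s' lab σ' ∧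
    ∀ τ, total L τ ≠ 0 → τ n = false →
      Sound L lab σ' ∧ total L σ' ≠ 0 ∧ BestBelow L lab σ' i) ?_ ?_ ?_ ?_
  · refine ⟨by simp [Instr.exec, NatExp.eval], σ, ⟨hr.lab, hr.val⟩, fun τ hτ hn => ⟨hS, ?_, ?_⟩⟩
    · exact total_ne_zero hL hS hC hσ hτ hn
    · exact bestBelow_zero L lab σ
  · rintro i s' hf - ⟨h17, -⟩
    rw [Test.holds_lt]
    simp [NatExp.eval, h17, hf.nat 0 rfl, Instr.exec, h0]
  · rintro i s1 hf1 hi ⟨h17, σ1, hr1, h⟩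
    have hE1 : Encodes L (s1.natArr 0) (s1.realArr 0) (s1.natReg 20) (s1.natReg 21) := by
      rw [hf1.natArr 0 rfl, hf1.realArr 0 rfl, hf1.nat 20 rfl, hf1.nat 21 rfl]
      simpa [Instr.exec] using hE
    have h01 : s1.natReg 0 = n := by rw [hf1.nat 0 rfl]; simpa [Instr.exec] using h0
    have hrep : ∀ {s : State} {σ : ℕ → Bool}, Rep n s lab σ → ∀ v < n,
        (s.natArr 2).getD v 0 = (σ v).toNat := fun hr v hv => by
      rw [hr.val, getD_map_range _ _ (by omega)]
    refine runs_instr_seq (runs_instr_seq (runs_instr_seq ?_))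
    refine Runs.call_seq (runs_evalTotal σ1 (by exact hE1) hB hB2 (fun v hv => hrep hr1 v hv)) fun s2 hf2 hM2 => ?_
    have h132 : s2.natReg 13 = lab i := by
      simp [hf2.nat 13 rfl, Instr.exec, NatExp.eval, h17, hr1.lab, getD_map_range _ _ hi]
    have h142 : s2.natReg 14 = lab i := by
      simp [hf2.nat 14 rfl, Instr.exec, NatExp.eval, h17, hr1.lab, getD_map_range _ _ hi]
    have h152 : s2.natReg 15 = 1 := by simp [hf2.nat 15 rfl, Instr.exec, NatExp.eval]
    have h172 : s2.natReg 17 = i := by simp [hf2.nat 17 rfl, Instr.exec, h17]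
    have h02 : s2.natReg 0 = n := by simp [hf2.nat 0 rfl, Instr.exec, h01]
    have hr2 : Rep n s2 lab σ1 := ⟨(hf2.natArr 1 rfl).trans hr1.lab,
      (hf2.natArr 2 rfl).trans hr1.val⟩
    refine runs_instr_seq ?_
    refine Runs.call_seq (runs_relabelProg (lab := lab) (σ := σ1) (c := lab i) (c' := lab i)
      (d := true) hB1 ⟨by exact hr2.lab, by exact hr2.val⟩ (by exact h02) (by exact h132)
      (by exact h142) (by exact h152)) fun s3 hf3 hr3 => ?_
    rw [relabel_self, shiftClass_true] at hr3
    have hE3 : Encodes L (s3.natArr 0) (s3.realArr 0) (s3.natReg 20) (s3.natReg 21) := by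
      simpa [hf3.natArr 0 rfl, hf3.realArr 0 rfl, hf3.nat 20 rfl, hf3.nat 21 rfl, Instr.exec,
        hf2.natArr 0 rfl, hf2.realArr 0 rfl, hf2.nat 20 rfl, hf2.nat 21 rfl] using hE1
    refine (runs_evalTotal _ hE3 hB hB2 (hrep hr3)).call_seq fun s4 hf4 hM4 => ?_
    have hM1 : s4.realReg 1 = total L σ1 := by
      simp [hf4.real 1 rfl, hf3.real 1 rfl, Instr.exec, RealExp.eval, hM2]
    have hr4 : Rep n s4 lab (flipBy lab (fun b => b == lab i) σ1) :=
      ⟨(hf4.natArr 1 rfl).trans hr3.lab, (hf4.natArr 2 rfl).trans hr3.val⟩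
    have h174 : s4.natReg 17 = i := by
      simp [hf4.nat 17 rfl, hf3.nat 17 rfl, Instr.exec, h172]
    refine Runs.call_seq (P := fun s5 => s5.natReg 17 = i ∧ ∃ σ', Rep n s5 lab σ' ∧
      ∀ τ, total L τ ≠ 0 → τ n = false → Sound L lab σ' ∧ total L σ' ≠ 0 ∧
        BestBelow L lab σ' (i + 1)) (runs_ite (fun hle => ?_) fun hle => ?_) ?_
    · simp only [Test.Holds, RealExp.eval, hM1, hM4, NNReal.coe_le_coe] at hle
      refine runs_instr.2 ⟨by simp [Instr.exec, NatExp.eval, h174], _, ⟨hr4.lab, hr4.val⟩,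
        fun τ hτ hn => ?_⟩
      obtain ⟨h1, h2, h3⟩ := h τ hτ hn
      exact ⟨h1.flipBy _, ((pos_iff_ne_zero.2 h2).trans_le hle).ne', h3.flip hL hC h2 hle⟩
    · simp only [Test.Holds, RealExp.eval, hM1, hM4, NNReal.coe_le_coe] at hle
      refine (runs_relabelProg (c := lab i) (c' := lab i) (d := true) hB1 hr4 ?_ ?_ ?_ ?_).call
        fun s5 hf5 hr5 => ⟨?_, σ1, ?_, fun τ hτ hn => ?_⟩
      · simp [hf4.nat 0 rfl, hf3.nat 0 rfl, Instr.exec, h02]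
      · simp [hf4.nat 13 rfl, hf3.nat 13 rfl, Instr.exec, h132]
      · simp [hf4.nat 14 rfl, hf3.nat 14 rfl, Instr.exec, h142]
      · simp [hf4.nat 15 rfl, hf3.nat 15 rfl, Instr.exec, h152]
      · rw [hf5.nat 17 rfl, h174]
      · rw [relabel_self, shiftClass_true, flipBy_flipBy] at hr5
        convert hr5 using 1
        funext w
        simp [flipBy]
      · obtain ⟨h1, h2, h3⟩ := h τ hτ hn
        exact ⟨h1, h2, h3.keep hL hC h2 (not_le.1 hle).le⟩
    · rintro s5 - ⟨h175, σ', hr5, h⟩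
      exact runs_instr.2 ⟨by simp [Instr.exec, NatExp.eval, h175], σ', ⟨hr5.lab, hr5.val⟩, h⟩
  · rintro s' - ⟨-, σ', hr', h⟩
    refine ⟨σ', hr', fun τ => ?_⟩
    -- The variable `n` occurs in no application, so its value can be normalized without changing
    -- the measure.
    set τ' : ℕ → Bool := Function.update τ n false with hτ'
    have hτn : τ' n = false := by simp [hτ']
    have htot : total L τ' = total L τ := by
      unfold total
      congr 1
      refine List.map_congr_left fun a _ => ?_
      congr 1
      funext v
      simp [hτ', v.2.ne]
    rw [← htot]
    by_cases h0 : total L τ' = 0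
    · rw [h0]
      exact zero_le
    · obtain ⟨h1, -, h3⟩ := h τ' h0 hτn
      exact h3.optimal h1 h0 hτn

/-- Compute an optimal assignment. -/
def optimumProg : Prog :=
  setN 0 (.get 0 (.const 0)) ;; setN 20 (.const 1) ;; setN 21 (.natLen 0) ;;
  setN 16 (.const 0) ;;
  .loop (.lt (.reg 16) (.reg 0 + .const 1))
    (.instr (.pushNat 1 (.reg 16)) ;; .instr (.pushNat 2 (.const 0)) ;;
      setN 16 (.reg 16 + .const 1)) ;;
  tiesProg ;;
  -- If `σ` is true at `n`, flip the class of `n`. This preserves soundness and gives the additional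
  -- variable its intended value `false`.
  setN 13 (.get 1 (.reg 0)) ;; setN 14 (.reg 13) ;; setN 15 (.get 2 (.reg 0)) ;; relabelProg ;;
  improveProg ;;
  .instr (.clearReal 0) ;; .instr (.clearNat 0) ;; setN 16 (.const 0) ;;
  .loop (.lt (.reg 16) (.reg 0))
    (.instr (.pushNat 0 (.get 2 (.reg 16))) ;; setN 16 (.reg 16 + .const 1))

theorem runs_optimumProg {F : Set Constraint} (hF : F ⊆ Constraint.ED) (x : CSPInstance F)
    (hB : x.enc.size ≤ B) : Runs B optimumProg (State.init x.enc) fun s =>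
      ∃ σ : Fin x.n → Bool, s.output = encAssignment σ ∧ ∀ τ : Fin x.n → Bool,
        (x.apps.map fun a => a.value τ).prod ≤ (x.apps.map fun a => a.value σ).prod := by
  have hsz : (x.apps.flatMap nats).length + 1 + (x.n + (x.apps.flatMap nats).sum) +
    (x.apps.flatMap fun a => a.con.table).length ≤ B := hB
  have hE := encodes_append x.apps [x.n] [] []
  rw [List.append_nil, List.append_nil] at hE
  have hL : ∀ a ∈ x.apps, a.con ∈ Constraint.ED := fun a ha => hF (x.mem a ha)
  have hB0 : x.apps.length ≤ B := by have := length_le_flatMap x.apps; omega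
  have hB1 : x.n + 1 ≤ B := by omega
  have hB2 : ∀ a ∈ x.apps, a.con.arity + 1 ≤ B := fun a ha => by
    have := arity_lt_flatMap ha
    omega
  have hB3 : ∀ a ∈ x.apps, 2 ^ a.con.arity ≤ B := fun a ha => by
    have := two_pow_le_flatMap ha
    omega
  refine runs_instr_seq (runs_instr_seq (runs_instr_seq (runs_instr_seq (Runs.call_seq
    (P := fun s => Rep x.n s id fun _ => false) ?_ fun s1 hf1 hr1 => ?_))))
  · refine runs_loop (x.n + 1) hB1 (fun i s' => s'.natReg 16 = i ∧
      s'.natArr 1 = List.range i ∧ s'.natArr 2 = (List.range i).map fun _ => 0) ?_ ?_ ?_ ?_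
    · simp [Instr.exec, State.init, NatExp.eval]
    · rintro i s' hf - ⟨h16, -⟩
      rw [Test.holds_lt]
      simp [NatExp.eval, h16, hf.nat 0 rfl, Instr.exec, State.init, CSPInstance.enc,
        List.getD_cons_zero]
    · rintro i s' hf hi ⟨h16, h1, h2⟩
      refine runs_instr_seq (runs_instr_seq (runs_instr.2 ⟨?_, ?_, ?_⟩))
      · simp [Instr.exec, NatExp.eval, h16]
      · simp [Instr.exec, NatExp.eval, h16, h1, List.range_succ]
      · simp only [Instr.exec, NatExp.eval, Function.update_apply]
        simp [h2, List.range_succ]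
    · rintro s' - ⟨-, h1, h2⟩
      exact ⟨by rw [h1, List.map_id], h2⟩
  have hE1 : Encodes x.apps (s1.natArr 0) (s1.realArr 0) (s1.natReg 20) (s1.natReg 21) := by
    simpa [hf1.natArr 0 rfl, hf1.realArr 0 rfl, hf1.nat 20 rfl, hf1.nat 21 rfl, Instr.exec,
      State.init, NatExp.eval, CSPInstance.enc, Nat.add_comm 1] using hE
  have h01 : s1.natReg 0 = x.n := by
    simp [hf1.nat 0 rfl, Instr.exec, State.init, NatExp.eval, CSPInstance.enc, List.getD_cons_zero]
  refine (runs_tiesProg hE1 hB0 hB1 hB2 hB3 h01 ⟨_, _, hr1, ?_, by simp⟩).call_seq ?_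
  -- Initially all classes are singletons, so soundness is trivial.
  · rintro τ - - u v (rfl : u = v)
    simp
  rintro s2 hf2 ⟨lab, σ, hr2, hS, hC⟩
  have hlt : x.n < x.n + 1 := Nat.lt_succ_self _
  have h02 : s2.natReg 0 = x.n := (hf2.nat 0 rfl).trans h01
  refine runs_instr_seq (runs_instr_seq (runs_instr_seq ?_))
  refine Runs.call_seq (runs_relabelProg (lab := lab) (σ := σ) (c := lab x.n) (c' := lab x.n)
    (d := σ x.n) hB1 ⟨by exact hr2.lab, by exact hr2.val⟩ (by exact h02) ?_ ?_ ?_)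
    fun s3 hf3 hr3 => ?_
  · simp [Instr.exec, NatExp.eval, h02, hr2.lab, getD_map_range _ _ hlt]
  · simp [Instr.exec, NatExp.eval, h02, hr2.lab, getD_map_range _ _ hlt]
  · simp [Instr.exec, NatExp.eval, h02, hr2.val, getD_map_range _ _ hlt]
  rw [relabel_self] at hr3
  have hE3 : Encodes x.apps (s3.natArr 0) (s3.realArr 0) (s3.natReg 20) (s3.natReg 21) := by
    simpa [hf3.natArr 0 rfl, hf3.realArr 0 rfl, hf3.nat 20 rfl, hf3.nat 21 rfl, Instr.exec,
      hf2.natArr 0 rfl, hf2.realArr 0 rfl, hf2.nat 20 rfl, hf2.nat 21 rfl] using hE1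
  have h03 : s3.natReg 0 = x.n := by simp [hf3.nat 0 rfl, Instr.exec, h02]
  refine (runs_improveProg hL hE3 hB0 hB1 (fun a ha => (Nat.le_succ _).trans (hB2 a ha)) h03 hr3 hC
    (by rw [shiftClass_eq_flipBy]; exact hS.flipBy _) (by simp [shiftClass])).call_seq ?_
  rintro s4 hf4 ⟨σ', hr4, hopt⟩
  refine runs_instr_seq (runs_instr_seq (runs_instr_seq ?_))
  refine runs_loop x.n (by omega) (fun i s' => s'.natReg 16 = i ∧
    s'.natArr 0 = (List.range i).map fun w => (σ' w).toNat) ?_ ?_ ?_ ?_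
  · simp [Instr.exec, NatExp.eval]
  · rintro i s' hf - ⟨h16, -⟩
    rw [Test.holds_lt]
    simp [NatExp.eval, h16, hf.nat 0 rfl, Instr.exec, hf4.nat 0 rfl, h03]
  · rintro i s' hf hi ⟨h16, h0⟩
    refine runs_instr_seq (runs_instr.2 ⟨?_, ?_⟩)
    · simp [Instr.exec, NatExp.eval, h16]
    · have hi' := getD_map_range (fun w => (σ' w).toNat) 0 (Nat.lt_succ_of_lt hi)
      rw [← hr4.val] at hi'
      simp [Instr.exec, NatExp.eval, h16, h0, List.range_succ, hf.natArr 2 rfl, hi']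
  · rintro s' hf ⟨-, h0⟩
    refine ⟨fun v => σ' v, ?_, fun τ => ?_⟩
    · simp only [State.output, h0, hf.realArr 0 rfl, encAssignment, Word.mk.injEq]
      refine ⟨List.ext_getElem (by simp) fun i _ _ => by simp, by simp [Instr.exec]⟩
    · rw [← total_extend]
      exact hopt _

end RealRAM

theorem maxProdCSP_optimumComputable {F : Set Constraint} (hF : F ⊆ Constraint.ED) :
    (maxProdCSP F).OptimumComputable := by
  obtain ⟨p, hp⟩ := RealRAM.optimumProg.exists_cost_poly
  refine ⟨RealRAM.optimumProg, p, fun x => ?_⟩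
  obtain ⟨s, t, h1, h2, σ, h3, h4⟩ := RealRAM.runs_optimumProg hF x le_rfl
  exact ⟨σ, h4, s, t, h1, h2.trans (hp _).ge, h3⟩

/-! ### Subroutine calls and the recognition of instances -/

namespace RealRAM

variable {B n : ℕ} {s : State} {Q : State → Prop}

/-! ## Programs as subroutines

A program is moved to registers and arrays with larger numbers. -/

/-- Add `K` to all numbers of registers and arrays. -/
def NatExp.shift (K : ℕ) : NatExp → NatExp
  | .const c => .const c
  | .reg r => .reg (K + r)
  | .natLen a => .natLen (K + a)
  | .realLen a => .realLen (K + a)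
  | .get a i => .get (K + a) (i.shift K)
  | .add e₁ e₂ => .add (e₁.shift K) (e₂.shift K)
  | .sub e₁ e₂ => .sub (e₁.shift K) (e₂.shift K)

def RealExp.shift (K : ℕ) : RealExp → RealExp
  | .const c => .const c
  | .reg r => .reg (K + r)
  | .get a i => .get (K + a) (i.shift K)
  | .add e₁ e₂ => .add (e₁.shift K) (e₂.shift K)
  | .sub e₁ e₂ => .sub (e₁.shift K) (e₂.shift K)
  | .mul e₁ e₂ => .mul (e₁.shift K) (e₂.shift K)
  | .div e₁ e₂ => .div (e₁.shift K) (e₂.shift K)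

def Test.shift (K : ℕ) : Test → Test
  | .natLe e₁ e₂ => .natLe (e₁.shift K) (e₂.shift K)
  | .realLe e₁ e₂ => .realLe (e₁.shift K) (e₂.shift K)
  | .not b => .not (b.shift K)
  | .and b₁ b₂ => .and (b₁.shift K) (b₂.shift K)

def Instr.shift (K : ℕ) : Instr → Instr
  | .setNat r e => .setNat (K + r) (e.shift K)
  | .setReal r e => .setReal (K + r) (e.shift K)
  | .clearNat a => .clearNat (K + a)
  | .clearReal a => .clearReal (K + a)
  | .pushNat a e => .pushNat (K + a) (e.shift K)
  | .pushReal a e => .pushReal (K + a) (e.shift K)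
  | .popNat a => .popNat (K + a)
  | .popReal a => .popReal (K + a)
  | .writeNat a i e => .writeNat (K + a) (i.shift K) (e.shift K)
  | .writeReal a i e => .writeReal (K + a) (i.shift K) (e.shift K)

def Prog.shift (K : ℕ) : Prog → Prog
  | .instr a => .instr (a.shift K)
  | .seq c d => .seq (c.shift K) (d.shift K)
  | .ite b c d => .ite (b.shift K) (c.shift K) (d.shift K)
  | .loop b c => .loop (b.shift K) (c.shift K)

/-- The part of the memory that a shifted program can access. -/
def State.view (K : ℕ) (s : State) : State where
  natReg r := s.natReg (K + r)
  realReg r := s.realReg (K + r)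
  natArr r := s.natArr (K + r)
  realArr r := s.realArr (K + r)

theorem NatExp.eval_shift (K : ℕ) (s : State) (e : NatExp) :
    (e.shift K).eval s = e.eval (s.view K) := by
  induction e <;> simp_all [NatExp.shift, NatExp.eval, State.view]

theorem RealExp.eval_shift (K : ℕ) (s : State) (e : RealExp) :
    (e.shift K).eval s = e.eval (s.view K) := by
  induction e <;> simp_all [RealExp.shift, RealExp.eval, NatExp.eval_shift] <;> rfl

theorem Test.holds_shift (K : ℕ) (s : State) (b : Test) :
    (b.shift K).Holds s ↔ b.Holds (s.view K) := by
  induction b <;>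
    simp_all [Test.shift, Test.Holds, NatExp.eval_shift, RealExp.eval_shift]

theorem update_add_left {α : Type*} (f : ℕ → α) (K r : ℕ) (a : α) :
    (fun x => Function.update f (K + r) a (K + x)) = Function.update (fun x => f (K + x)) r a := by
  funext x
  simp [Function.update_apply]

theorem Instr.view_exec_shift (K : ℕ) (s : State) (a : Instr) :
    ((a.shift K).exec s).view K = a.exec (s.view K) := by
  cases a <;>
    simp only [Instr.shift, Instr.exec, State.view, update_add_left, NatExp.eval_shift,
      RealExp.eval_shift]

/-- The shifted program simulates the original step by step, with the same running time, and does
not see the memory below `K`. -/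
theorem Exec.shift {c : Prog} {s₀ s' : State} {t : ℕ} (h : Exec c s₀ s' t) (K : ℕ) :
    ∀ s : State, s.view K = s₀ → ∃ s'', Exec (c.shift K) s s'' t ∧ s''.view K = s' := by
  induction h with
  | instr a _ =>
    rintro s rfl
    exact ⟨_, .instr _ s, a.view_exec_shift K s⟩
  | seq _ _ h1 h2 =>
    intro s hs
    obtain ⟨s1, e1, v1⟩ := h1 s hs
    obtain ⟨s2, e2, v2⟩ := h2 s1 v1
    exact ⟨s2, .seq e1 e2, v2⟩
  | iteTrue hb _ h1 =>
    rintro s rfl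
    obtain ⟨s1, e1, v1⟩ := h1 s rfl
    exact ⟨s1, .iteTrue ((Test.holds_shift K s _).2 hb) e1, v1⟩
  | iteFalse hb _ h1 =>
    rintro s rfl
    obtain ⟨s1, e1, v1⟩ := h1 s rfl
    exact ⟨s1, .iteFalse ((Test.holds_shift K s _).not.2 hb) e1, v1⟩
  | loopTrue hb _ _ h1 h2 =>
    rintro s rfl
    obtain ⟨s1, e1, v1⟩ := h1 s rfl
    obtain ⟨s2, e2, v2⟩ := h2 s1 v1
    exact ⟨s2, .loopTrue ((Test.holds_shift K s _).2 hb) e1 e2, v2⟩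
  | loopFalse hb =>
    rintro s rfl
    exact ⟨s, .loopFalse ((Test.holds_shift K s _).not.2 hb), rfl⟩

/-- The number of the register or array that an instruction changes. -/
def Instr.target : Instr → ℕ
  | .setNat r _ => r
  | .setReal r _ => r
  | .clearNat a => a
  | .clearReal a => a
  | .pushNat a _ => a
  | .pushReal a _ => a
  | .popNat a => a
  | .popReal a => a
  | .writeNat a _ _ => a
  | .writeReal a _ _ => a

/-- A bound for the numbers of the registers and arrays that a program changes. -/
def Prog.bound : Prog → ℕ
  | .instr a => a.target + 1
  | .seq c d => max c.bound d.bound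
  | .ite _ c d => max c.bound d.bound
  | .loop _ c => c.bound

theorem Instr.w_eq_false_of_ne {a : Instr} {r : ℕ} (h : a.target ≠ r) :
    a.wNat r = false ∧ a.wReal r = false ∧ a.wNatArr r = false ∧ a.wRealArr r = false := by
  cases a <;> simp_all [Instr.target, Instr.wNat, Instr.wReal, Instr.wNatArr, Instr.wRealArr]

theorem Prog.any_eq_false_of_forall {c : Prog} {r : ℕ} {f : Instr → Bool}
    (h : ∀ a, a.target ≠ r → f a = false)
    (hc : c.bound ≤ r) : c.any f = false := by
  induction c with
  | instr a => exact h a (by simp only [Prog.bound] at hc; omega)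
  | seq c d h1 h2 =>
    simp only [Prog.bound, max_le_iff] at hc
    simp [Prog.any, h1 hc.1, h2 hc.2]
  | ite b c d h1 h2 =>
    simp only [Prog.bound, max_le_iff] at hc
    simp [Prog.any, h1 hc.1, h2 hc.2]
  | loop b c h1 => exact h1 hc

theorem Prog.any_shift_of_lt {c : Prog} {K r : ℕ} {f : Instr → Bool}
    (h : ∀ a, a.target ≠ r → f a = false) (hr : r < K) : (c.shift K).any f = false := by
  induction c with
  | instr a => exact h _ (by cases a <;> simp only [Instr.shift, Instr.target] <;> omega)
  | seq c d h1 h2 => simp [Prog.shift, Prog.any, h1, h2]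
  | ite b c d h1 h2 => simp [Prog.shift, Prog.any, h1, h2]
  | loop b c h1 => exact h1

theorem Prog.bound_shift (c : Prog) (K : ℕ) : (c.shift K).bound = K + c.bound := by
  induction c with
  | instr a => cases a <;> simp only [Prog.shift, Prog.bound, Instr.shift, Instr.target] <;> omega
  | seq c d h1 h2 => simp only [Prog.shift, Prog.bound, h1, h2]; omega
  | ite b c d h1 h2 => simp only [Prog.shift, Prog.bound, h1, h2]; omega
  | loop b c h1 => exact h1

/-- Registers and arrays from number `M` on are in their initial state. -/
structure Clean (M : ℕ) (s : State) : Prop where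
  nat : ∀ r, M ≤ r → s.natReg r = 0
  real : ∀ r, M ≤ r → s.realReg r = 0
  natArr : ∀ r, M ≤ r → s.natArr r = []
  realArr : ∀ r, M ≤ r → s.realArr r = []

theorem Clean.frame {M : ℕ} {s s' : State} (h : Clean M s) {c : Prog} (hf : Frame c s s')
    (hc : c.bound ≤ M) : Clean M s' := by
  constructor <;> intro r hr
  · rw [hf.nat r (c.any_eq_false_of_forall (fun _ h => (Instr.w_eq_false_of_ne h).1)
      (hc.trans hr)), h.nat r hr]
  · rw [hf.real r (c.any_eq_false_of_forall (fun _ h => (Instr.w_eq_false_of_ne h).2.1)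
      (hc.trans hr)), h.real r hr]
  · rw [hf.natArr r (c.any_eq_false_of_forall (fun _ h => (Instr.w_eq_false_of_ne h).2.2.1)
      (hc.trans hr)), h.natArr r hr]
  · rw [hf.realArr r (c.any_eq_false_of_forall (fun _ h => (Instr.w_eq_false_of_ne h).2.2.2)
      (hc.trans hr)), h.realArr r hr]

/-- Reset the registers and arrays number `r`. -/
def resetOne (r : ℕ) : Prog :=
  setN r (.const 0) ;; setR r (.const 0) ;; .instr (.clearNat r) ;; .instr (.clearReal r)

/-- Reset the registers and arrays from number `K` to number `K + N`. -/
def resetProg (K : ℕ) : ℕ → Prog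
  | 0 => resetOne K
  | N + 1 => resetOne (K + N + 1) ;; resetProg K N

theorem runs_resetOne {r : ℕ} (h : Clean (r + 1) s) : Runs B (resetOne r) s (Clean r) := by
  refine runs_instr_seq (runs_instr_seq (runs_instr_seq (runs_instr.2 ?_)))
  constructor <;> intro x hx <;> rcases Nat.eq_or_lt_of_le hx with rfl | hx'
  · simp [Instr.exec, NatExp.eval]
  · simp [Instr.exec, hx'.ne', h.nat x hx']
  · simp [Instr.exec, RealExp.eval]
  · simp [Instr.exec, hx'.ne', h.real x hx']
  · simp [Instr.exec]
  · simp [Instr.exec, hx'.ne', h.natArr x hx']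
  · simp [Instr.exec]
  · simp [Instr.exec, hx'.ne', h.realArr x hx']

/-- A program can have changed only finitely many registers and arrays, so a fixed number of resets
makes its workspace fresh for the next call. -/
theorem runs_resetProg {K N : ℕ} (h : Clean (K + N + 1) s) :
    Runs B (resetProg K N) s (Clean K) := by
  induction N generalizing s with
  | zero => exact runs_resetOne h
  | succ N ih => exact (runs_resetOne h).call_seq fun s' _ h' => ih h'

theorem any_resetProg_of_lt {K N r : ℕ} {f : Instr → Bool}
    (h : ∀ a, a.target ≠ r → f a = false) (hr : r < K) : (resetProg K N).any f = false := by
  have hone : ∀ x, r < x → (resetOne x).any f = false := fun x hx => by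
    simp [resetOne, Prog.any, h _ (show Instr.target (.setNat x (.const 0)) ≠ r from hx.ne'),
      h _ (show Instr.target (.setReal x (.const 0)) ≠ r from hx.ne'),
      h _ (show Instr.target (.clearNat x) ≠ r from hx.ne'),
      h _ (show Instr.target (.clearReal x) ≠ r from hx.ne')]
  induction N with
  | zero => exact hone _ hr
  | succ N ih => simp [resetProg, Prog.any, ih, hone (K + N + 1) (by omega)]

/-! ## Recognition of constraints as a subroutine

Registers: `22` and `23` hold the positions of the current application, `24` its arity `k` and `25`
the power `2 ^ k`; `8` is a flag. -/

/-- Run the program `c` on the constraint of the current application, and clear the flag if the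
answer is negative. -/
def callProg (c : Prog) : Prog :=
  resetProg 30 c.bound ;; .instr (.pushNat 30 (.reg 24)) ;; setN 16 (.const 0) ;;
  .loop (.lt (.reg 16) (.reg 25))
    (.instr (.pushReal 30 (.get 0 (.reg 23 + .reg 16))) ;; setN 16 (.reg 16 + .const 1)) ;;
  c.shift 30 ;; .ite (.eq (.get 30 (.const 0)) (.const 1)) skip (setN 8 (.const 0))

/-- Below number `30`, a call writes only the registers `5`, `8` and `16`; the caller's data
survive. -/
theorem any_callProg (c : Prog) {r : ℕ} {f : Instr → Bool}
    (h : ∀ a, a.target ≠ r → f a = false) (hr : r < 30) (h16 : f (.setNat 16 (.const 0)) = false)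
    (h16' : f (.setNat 16 (.reg 16 + .const 1)) = false)
    (h5 : f (.setNat 5 (.reg 5)) = false) (h8 : f (.setNat 8 (.const 0)) = false) :
    (callProg c).any f = false := by
  have e1 := h (.pushNat 30 (.reg 24)) (show (30 : ℕ) ≠ r from hr.ne')
  have e2 := h (.pushReal 30 (.get 0 (.reg 23 + .reg 16))) (show (30 : ℕ) ≠ r from hr.ne')
  simp only [callProg, Prog.any, any_resetProg_of_lt h hr, Prog.any_shift_of_lt h hr, e1, e2, h16,
    h16', h5, h8, skip, Bool.or_self]

theorem Clean.view_eq_init {K : ℕ} {s s' : State} {w : Word} (h : Clean K s)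
    (hn : ∀ r, s'.natReg (K + r) = s.natReg (K + r))
    (hr : ∀ r, s'.realReg (K + r) = s.realReg (K + r))
    (hna : ∀ r, s'.natArr (K + (r + 1)) = s.natArr (K + (r + 1)))
    (hra : ∀ r, s'.realArr (K + (r + 1)) = s.realArr (K + (r + 1)))
    (h0 : s'.natArr K = w.nats) (h0' : s'.realArr K = w.reals) : s'.view K = State.init w := by
  simp only [State.view, State.init, State.mk.injEq]
  refine ⟨?_, ?_, ?_, ?_⟩ <;> funext r
  · rw [hn, h.nat _ (by omega)]
  · rw [hr, h.real _ (by omega)]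
  · cases r with
    | zero => simpa using h0
    | succ r => rw [hna, h.natArr _ (by omega)]; simp
  · cases r with
    | zero => simpa using h0'
    | succ r => rw [hra, h.realArr _ (by omega)]; simp

/-- Cleanness of the memory beyond the workspace is returned so that calls can be repeated. About
`c` only its answers and a time bound `T` are known, hence the assumption that `B` exceeds `T` on
the word passed. -/
theorem runs_callProg {c : Prog} {D : Set Word} {T : Word → ℕ}
    (hc : ∀ w, (w ∈ D → c.Yields w Word.yes (T w)) ∧ (w ∉ D → c.Yields w Word.no (T w)))
    {p : Prop} (hcl : Clean (30 + c.bound + 1) s) (h8 : s.natReg 8 = flag p)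
    (hB : s.natReg 25 ≤ B)
    (hT : T ⟨[s.natReg 24], (List.range (s.natReg 25)).map fun i =>
      (s.realArr 0).getD (s.natReg 23 + i) 0⟩ ≤ B) :
    Runs B (callProg c) s fun s' => Clean (30 + c.bound + 1) s' ∧
      s'.natReg 8 = flag (p ∧ (⟨[s.natReg 24], (List.range (s.natReg 25)).map fun i =>
        (s.realArr 0).getD (s.natReg 23 + i) 0⟩ : Word) ∈ D) := by
  set w : Word := ⟨[s.natReg 24], (List.range (s.natReg 25)).map fun i =>
      (s.realArr 0).getD (s.natReg 23 + i) 0⟩ with hw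
  have hwN : ∀ r a, Instr.target a ≠ r → a.wNat r = false :=
    fun r a h => (Instr.w_eq_false_of_ne h).1
  have hwNA : ∀ r a, Instr.target a ≠ r → a.wNatArr r = false :=
    fun r a h => (Instr.w_eq_false_of_ne h).2.2.1
  have hwRA : ∀ r a, Instr.target a ≠ r → a.wRealArr r = false :=
    fun r a h => (Instr.w_eq_false_of_ne h).2.2.2
  refine (runs_resetProg hcl).call_seq fun s1 hf1 hcl1 => ?_
  have e24 : s1.natReg 24 = s.natReg 24 := hf1.nat 24 (any_resetProg_of_lt (hwN 24) (by decide))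
  have e25 : s1.natReg 25 = s.natReg 25 := hf1.nat 25 (any_resetProg_of_lt (hwN 25) (by decide))
  have e23 : s1.natReg 23 = s.natReg 23 := hf1.nat 23 (any_resetProg_of_lt (hwN 23) (by decide))
  have e8 : s1.natReg 8 = s.natReg 8 := hf1.nat 8 (any_resetProg_of_lt (hwN 8) (by decide))
  have eR : s1.realArr 0 = s.realArr 0 :=
    hf1.realArr 0 (any_resetProg_of_lt (hwRA 0) (by decide))
  refine runs_instr_seq (runs_instr_seq (Runs.call_seq (P := fun s' => s'.natReg 8 = flag p ∧
    s'.view 30 = State.init w) ?_ ?_))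
  · refine runs_loop (s.natReg 25) hB (fun i s' => s'.natReg 16 = i ∧ s'.realArr 30 =
      (List.range i).map fun i => (s.realArr 0).getD (s.natReg 23 + i) 0) ?_ ?_ ?_ ?_
    · simp [Instr.exec, NatExp.eval, hcl1.realArr 30 le_rfl]
    · rintro i s' hf - ⟨h16, -⟩
      rw [Test.holds_lt]
      simp [NatExp.eval, h16, hf.nat 25 rfl, Instr.exec, e25]
    · rintro i s' hf hi ⟨h16, hA⟩
      refine runs_instr_seq (runs_instr.2 ?_)
      simp [Instr.exec, NatExp.eval, RealExp.eval, h16, hA, hf.nat 23 rfl, hf.realArr 0 rfl, e23, eR,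
        List.range_succ]
    · rintro s' hf ⟨-, hA⟩
      refine ⟨by simp [hf.nat 8 rfl, Instr.exec, e8, h8], hcl1.view_eq_init ?_ ?_ ?_ ?_ ?_ hA⟩
      · intro r
        rw [hf.nat _ (by simp [Prog.any, Instr.wNat]; omega)]
        simp [Instr.exec, show 30 + r ≠ 16 by omega]
      · intro r
        rw [hf.real _ (by simp [Prog.any, Instr.wReal])]
        simp [Instr.exec]
      · intro r
        rw [hf.natArr _ (by simp [Prog.any, Instr.wNatArr])]
        simp [Instr.exec]
      · intro r
        rw [hf.realArr _ (by simp [Prog.any, Instr.wRealArr])]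
        simp [Instr.exec]
      · simp [hf.natArr 30 rfl, Instr.exec, NatExp.eval, hcl1.natArr 30 le_rfl, e24, hw]
  · rintro s2 hf2 ⟨h82, hv⟩
    have hcl2 : Clean (30 + c.bound + 1) s2 := by
      refine Clean.frame (Clean.frame (Clean.frame (c := .instr (.pushNat 30 (.reg 24)))
        ?_ (Frame.exec _ _) ?_) (c := setN 16 (.const 0)) (Frame.exec _ _) ?_) hf2 ?_
      · exact ⟨fun r hr => hcl1.nat r (by omega), fun r hr => hcl1.real r (by omega),
          fun r hr => hcl1.natArr r (by omega), fun r hr => hcl1.realArr r (by omega)⟩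
      all_goals simp [Prog.bound, Instr.target] <;> omega
    have key : ∃ s' t, Exec c (State.init w) s' t ∧ t ≤ B ∧ (s'.natArr 0).getD 0 0 = flag (w ∈ D) := by
      by_cases hD : w ∈ D
      · obtain ⟨s', t, h1, h2, h3⟩ := (hc w).1 hD
        refine ⟨s', t, h1, h2.trans hT, ?_⟩
        have : s'.natArr 0 = [1] := congrArg Word.nats h3
        simp [this, flag_of hD, List.getD_cons_zero]
      · obtain ⟨s', t, h1, h2, h3⟩ := (hc w).2 hD
        refine ⟨s', t, h1, h2.trans hT, ?_⟩
        have : s'.natArr 0 = [0] := congrArg Word.nats h3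
        simp [this, flag_of_not hD, List.getD_cons_zero]
    obtain ⟨s', t, h1, h2, h3⟩ := key
    obtain ⟨s3, h4, h5⟩ := h1.shift 30 s2 hv
    refine Runs.call_seq (P := fun x => (x.natArr 30).getD 0 0 = flag (w ∈ D))
      ⟨s3, t, h4, h4.le_cost h2, by rw [← h3, ← h5]; rfl⟩ fun s3 hf3 hA => ?_
    have hcl3 : Clean (30 + c.bound + 1) s3 := hcl2.frame hf3 (by rw [Prog.bound_shift]; omega)
    have h83 : s3.natReg 8 = flag p := by
      rw [hf3.nat 8 (Prog.any_shift_of_lt (hwN 8) (by decide)), h82]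
    refine runs_ite (fun h => runs_instr.2 ⟨?_, ?_⟩) fun h => runs_instr.2 ⟨?_, ?_⟩
    · exact hcl3.frame (Frame.exec _ _) (by simp [Prog.bound, Instr.target]; omega)
    · rw [Test.holds_eq] at h
      simp only [NatExp.eval, hA, flag_eq_one] at h
      simp [Instr.exec, h83, h]
    · exact hcl3.frame (Frame.exec _ _) (by simp [Prog.bound, Instr.target]; omega)
    · rw [Test.holds_eq] at h
      simp only [NatExp.eval, hA, flag_eq_one] at h
      simp [Instr.exec, NatExp.eval, h, flag_of_not]

open Application

/-! ## Recognition of instances -/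

/-- Clear the flag in register `8` if the current application occurs among the previous ones. -/
def distinctProg : Prog :=
  -- With the limit set to the current position, the scan runs through the previous applications
  -- only.
  setN 21 (.reg 22) ;; scan
    (powProg ;; setN 26 (.const 1) ;;
      checkAll 16 (.reg 24 + .const 1) skip
        (.eq (.get 0 (.reg 1 + .reg 16)) (.get 0 (.reg 22 + .reg 16))) 26 ;;
      checkAll 16 (.reg 25) skip
        (.realEq (.get 0 (.reg 2 + .reg 16)) (.get 0 (.reg 23 + .reg 16))) 26 ;;
      .ite (.eq (.reg 26) (.const 1)) (setN 8 (.const 0)) skip)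

/-- Descriptions of applications with arity `k` at the positions `p`, `q` and `p'`, `q'` agree. -/
def SameData (N : List ℕ) (R : List ℝ) (k p q p' q' : ℕ) : Prop :=
  (∀ i < k + 1, N.getD (p + i) 0 = N.getD (p' + i) 0) ∧
    ∀ m < 2 ^ k, R.getD (q + m) 0 = R.getD (q' + m) 0

theorem runs_distinctProg {L : List (Application n)} {p : Prop} {k : ℕ}
    (hE : Encodes L (s.natArr 0) (s.realArr 0) (s.natReg 20) (s.natReg 22)) (hB : L.length ≤ B)
    (hB1 : ∀ a ∈ L, a.con.arity ≤ B) (hB2 : k + 1 ≤ B) (hB3 : 2 ^ k ≤ B)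
    (h24 : s.natReg 24 = k) (h25 : s.natReg 25 = 2 ^ k) (h8 : s.natReg 8 = flag p) :
    Runs B distinctProg s fun s' => s'.natReg 8 = flag (p ∧ ∀ i < L.length,
      ¬ SameData (s.natArr 0) (s.realArr 0) k (natPos (s.natReg 20) L i) (realPos L i)
        (s.natReg 22) (s.natReg 23)) := by
  refine runs_instr_seq ?_
  refine runs_scan (L := L) rfl rfl rfl rfl rfl rfl rfl (by simpa [Instr.exec, NatExp.eval] using hE)
    hB (fun j s' => s'.natReg 8 = flag (p ∧ ∀ i < j,
      ¬ SameData (s.natArr 0) (s.realArr 0) k (natPos (s.natReg 20) L i) (realPos L i)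
        (s.natReg 22) (s.natReg 23))) ?_ ?_ ?_ ?_
  · rintro i s r v (rfl | rfl | rfl) h <;> simpa using h
  · simp [Instr.exec, h8]
  · intro i hi s1 hf1 hI hs h1 h2 h3
    refine (runs_powProg (by rw [h3]; exact hB1 _ (List.getElem_mem hi))).call_seq
      fun s2 hf2 h42 => runs_instr_seq ?_
    have eN : s2.natArr 0 = s.natArr 0 := by simp [hf2.natArr 0 rfl, hf1.natArr 0 rfl, Instr.exec]
    have eR : s2.realArr 0 = s.realArr 0 := by
      simp [hf2.realArr 0 rfl, hf1.realArr 0 rfl, Instr.exec]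
    have e1 : s2.natReg 1 = natPos (s.natReg 20) L i := by
      simp [hf2.nat 1 rfl, h1, Instr.exec]
    have e2 : s2.natReg 2 = realPos L i := by simp [hf2.nat 2 rfl, h2]
    have e22 : s2.natReg 22 = s.natReg 22 := by simp [hf2.nat 22 rfl, hf1.nat 22 rfl, Instr.exec]
    have e23 : s2.natReg 23 = s.natReg 23 := by simp [hf2.nat 23 rfl, hf1.nat 23 rfl, Instr.exec]
    have e24 : s2.natReg 24 = k := by simp [hf2.nat 24 rfl, hf1.nat 24 rfl, Instr.exec, h24]
    have e25 : s2.natReg 25 = 2 ^ k := by simp [hf2.nat 25 rfl, hf1.nat 25 rfl, Instr.exec, h25]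
    refine (runs_checkAll (by decide) rfl rfl (k + 1) hB2 True
      (fun j => (s.natArr 0).getD (natPos (s.natReg 20) L i + j) 0 =
        (s.natArr 0).getD (s.natReg 22 + j) 0) ?_ ?_ ?_).call_seq fun s3 hf3 h263 => ?_
    · simp [Instr.exec, NatExp.eval, flag_of]
    · intro s' hf
      simp [NatExp.eval, hf.nat 24 rfl, Instr.exec, e24]
    · intro j hj s' hf h16
      refine runs_instr.2 ?_
      rw [Test.holds_eq]
      simp [NatExp.eval, Instr.exec, h16, hf.natArr 0 rfl, hf.nat 1 rfl, hf.nat 22 rfl, eN, e1, e22]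
    refine (runs_checkAll (by decide) rfl rfl (2 ^ k) hB3 _
      (fun j => (s.realArr 0).getD (realPos L i + j) 0 =
        (s.realArr 0).getD (s.natReg 23 + j) 0) h263 ?_ ?_).call_seq fun s4 hf4 h264 => ?_
    · intro s' hf
      simp [NatExp.eval, hf.nat 25 rfl, hf3.nat 25 rfl, Instr.exec, e25]
    · intro j hj s' hf h16
      refine runs_instr.2 ?_
      rw [Test.holds_realEq]
      simp [RealExp.eval, NatExp.eval, Instr.exec, h16, hf.realArr 0 rfl, hf.nat 2 rfl,
        hf.nat 23 rfl, hf3.realArr 0 rfl, hf3.nat 2 rfl, hf3.nat 23 rfl, eR, e2, e23]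
    have e84 : s4.natReg 8 = s1.natReg 8 := by
      simp [hf4.nat 8 rfl, hf3.nat 8 rfl, Instr.exec, hf2.nat 8 rfl]
    have e44 : s4.natReg 4 = 2 ^ L[i].con.arity := by
      simp [hf4.nat 4 rfl, hf3.nat 4 rfl, Instr.exec, h42, h3]
    rw [true_and] at h264
    refine runs_ite (fun h => runs_instr.2 ⟨by simpa [Instr.exec] using e44, ?_⟩)
      fun h => runs_instr.2 ⟨by simpa [Instr.exec] using e44, ?_⟩
    · rw [Test.holds_eq, NatExp.eval, NatExp.eval, h264, flag_eq_one] at h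
      rw [flag_of_not fun h' => h'.2 i (Nat.lt_succ_self i) h]
      simp [Instr.exec, NatExp.eval]
    · rw [Test.holds_eq, NatExp.eval, NatExp.eval, h264, flag_eq_one] at h
      simp only [Instr.exec, Function.update_apply]
      rw [if_neg (by decide), e84, hI]
      refine flag_congr (and_congr_right fun _ => ?_)
      rw [Nat.forall_lt_succ_right]
      exact (and_iff_left h).symm
  · exact fun s' _ h => h

/-- Read one application. -/
def readProg (c : Prog) : Prog :=
  setN 3 (.get 0 (.reg 22)) ;; powProg ;; setN 24 (.reg 3) ;; setN 25 (.reg 4) ;;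
  -- The data must fit into the input. Otherwise default values would be read, and `2 ^ k` would not
  -- be bounded by the input size; its computation above takes only `k` doublings.
  .ite (.and (.natLe (.reg 22 + .reg 24 + .const 1) (.natLen 0))
      (.natLe (.reg 23 + .reg 25) (.realLen 0)))
    (checkAll 16 (.reg 24) skip (.lt (.get 0 (.reg 22 + .const 1 + .reg 16)) (.reg 0)) 8 ;;
      callProg c ;; distinctProg ;;
      setN 22 (.reg 22 + .reg 24 + .const 1) ;; setN 23 (.reg 23 + .reg 25))
    (setN 8 (.const 0))

/-- The condition under which reading an application succeeds. -/
def ReadOk (D : Set Word) (L : List (Application n)) (N : List ℕ) (R : List ℝ) (k p q : ℕ) :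
    Prop :=
  ((∀ i < k, N.getD (p + 1 + i) 0 < n) ∧
      (⟨[k], (List.range (2 ^ k)).map fun i => R.getD (q + i) 0⟩ : Word) ∈ D) ∧
    ∀ i < L.length, ¬ SameData N R k (natPos 1 L i) (realPos L i) p q

theorem runs_readProg {c : Prog} {D : Set Word} {T : Word → ℕ}
    (hc : ∀ w, (w ∈ D → c.Yields w Word.yes (T w)) ∧ (w ∉ D → c.Yields w Word.no (T w)))
    {L : List (Application n)} {N : List ℕ} {R : List ℝ} {k p q : ℕ}
    (hcl : Clean (30 + c.bound + 1) s) (hN : s.natArr 0 = N) (hR : s.realArr 0 = R)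
    (h0 : s.natReg 0 = n) (h20 : s.natReg 20 = 1) (h22 : s.natReg 22 = p) (h23 : s.natReg 23 = q)
    (hk : N.getD p 0 = k) (h8 : s.natReg 8 = 1) (hE : Encodes L N R 1 p)
    (hB : L.length ≤ B) (hB1 : ∀ a ∈ L, a.con.arity ≤ B) (hB2 : k + 1 ≤ B)
    (hB3 : R.length ≤ B) (hT : q + 2 ^ k ≤ R.length →
      T ⟨[k], (List.range (2 ^ k)).map fun i => R.getD (q + i) 0⟩ ≤ B) :
    Runs B (readProg c) s fun s' => Clean (30 + c.bound + 1) s' ∧ s'.natArr 0 = N ∧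
      s'.realArr 0 = R ∧ s'.natReg 0 = n ∧ s'.natReg 20 = 1 ∧
      (p + k + 1 ≤ N.length ∧ q + 2 ^ k ≤ R.length →
        s'.natReg 8 = flag (ReadOk D L N R k p q) ∧ s'.natReg 22 = p + k + 1 ∧
          s'.natReg 23 = q + 2 ^ k) ∧
      (¬ (p + k + 1 ≤ N.length ∧ q + 2 ^ k ≤ R.length) →
        s'.natReg 8 = 0 ∧ s'.natReg 22 = p) := by
  refine runs_instr_seq ?_
  refine Runs.call_seq (runs_powProg ?_) fun s1 hf1 h41 => ?_
  · simp only [Instr.exec, NatExp.eval, hN, h22, hk, Function.update_self]; omega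
  have e3 : s1.natReg 3 = k := by simp [hf1.nat 3 rfl, Instr.exec, NatExp.eval, hN, h22, hk]
  have e4 : s1.natReg 4 = 2 ^ k := by simp [h41, Instr.exec, NatExp.eval, hN, h22, hk]
  have eN : s1.natArr 0 = N := by simp [hf1.natArr 0 rfl, Instr.exec, hN]
  have eR : s1.realArr 0 = R := by simp [hf1.realArr 0 rfl, Instr.exec, hR]
  have e0 : s1.natReg 0 = n := by simp [hf1.nat 0 rfl, Instr.exec, h0]
  have e20 : s1.natReg 20 = 1 := by simp [hf1.nat 20 rfl, Instr.exec, h20]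
  have e22 : s1.natReg 22 = p := by simp [hf1.nat 22 rfl, Instr.exec, h22]
  have e23 : s1.natReg 23 = q := by simp [hf1.nat 23 rfl, Instr.exec, h23]
  have e8 : s1.natReg 8 = 1 := by simp [hf1.nat 8 rfl, Instr.exec, h8]
  have hcl1 : Clean (30 + c.bound + 1) s1 := by
    refine (hcl.frame (c := setN 3 (.get 0 (.reg 22))) (Frame.exec _ _) ?_).frame hf1 ?_
    · simp [Prog.bound, Instr.target]; omega
    · exact (show powProg.bound ≤ 30 by decide).trans (by omega)
  clear hcl hf1 h41 hN hR h0 h20 h22 h23 h8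
  refine runs_instr_seq (runs_instr_seq ?_)
  set s2 := Instr.exec (Instr.exec s1 (.setNat 24 (.reg 3))) (.setNat 25 (.reg 4)) with hs2
  have hf2 : Frame (setN 24 (.reg 3) ;; setN 25 (.reg 4)) s1 s2 :=
    ((Frame.exec _ _).mono (by simp +contextual [Prog.any])).trans
      ((Frame.exec _ _).mono (by simp +contextual [Prog.any]))
  have e24 : s2.natReg 24 = k := by simp [hs2, Instr.exec, NatExp.eval, e3]
  have e25 : s2.natReg 25 = 2 ^ k := by simp [hs2, Instr.exec, NatExp.eval, e4]
  rw [← hf2.natArr 0 rfl] at eN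
  rw [← hf2.realArr 0 rfl] at eR
  rw [← hf2.nat 0 rfl] at e0
  rw [← hf2.nat 20 rfl] at e20
  rw [← hf2.nat 22 rfl] at e22
  rw [← hf2.nat 23 rfl] at e23
  rw [← hf2.nat 8 rfl] at e8
  have hcl2 : Clean (30 + c.bound + 1) s2 := hcl1.frame hf2 (by
    simp [Prog.bound, Instr.target]; omega)
  clear hf2 e3 e4 hcl1
  clear_value s2
  refine runs_ite (fun h => ?_) fun h => ?_
  · simp only [Test.Holds, NatExp.eval, e22, e24, e23, e25, eN, eR] at h
    have hpk : 2 ^ k ≤ B := by omega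
    refine (runs_checkAll (by decide) rfl rfl k (by omega) True
      (fun i => N.getD (p + 1 + i) 0 < n) (by rw [e8, flag_of trivial]) ?_ ?_).call_seq
      fun s3 hf3 h83 => ?_
    · intro s' hf
      simp [NatExp.eval, hf.nat 24 rfl, e24]
    · intro j hj s' hf h16
      refine runs_instr.2 ?_
      rw [Test.holds_lt]
      simp [NatExp.eval, Instr.exec, h16, hf.natArr 0 rfl, hf.nat 22 rfl, hf.nat 0 rfl, eN, e22, e0]
    rw [← hf3.natArr 0 rfl] at eN
    rw [← hf3.realArr 0 rfl] at eR
    rw [← hf3.nat 0 rfl] at e0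
    rw [← hf3.nat 20 rfl] at e20
    rw [← hf3.nat 22 rfl] at e22
    rw [← hf3.nat 23 rfl] at e23
    rw [← hf3.nat 24 rfl] at e24
    rw [← hf3.nat 25 rfl] at e25
    have hcl3 := hcl2.frame hf3
      ((show Prog.bound (checkAll 16 (.reg 24) skip
        (.lt (.get 0 (.reg 22 + .const 1 + .reg 16)) (.reg 0)) 8) ≤ 30 by decide).trans
          (by omega))
    clear hf3 hcl2 e8
    rw [true_and] at h83
    refine (runs_callProg hc hcl3 h83 (by rw [e25]; exact hpk) ?_).call_seq ?_
    · rw [e24, e25, e23, eR]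
      exact hT h.2
    rw [e24, e25, e23, eR]
    rintro s4 hf4 ⟨hcl4, h84⟩
    have hw : ∀ r a, Instr.target a ≠ r → a.wNat r = false :=
      fun r a h => (Instr.w_eq_false_of_ne h).1
    rw [← hf4.natArr 0 (any_callProg c (fun a h => (Instr.w_eq_false_of_ne h).2.2.1)
      (by decide) rfl rfl rfl rfl)] at eN
    rw [← hf4.realArr 0 (any_callProg c (fun a h => (Instr.w_eq_false_of_ne h).2.2.2)
      (by decide) rfl rfl rfl rfl)] at eR
    rw [← hf4.nat 0 (any_callProg c (hw _) (by decide) rfl rfl rfl rfl)] at e0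
    rw [← hf4.nat 20 (any_callProg c (hw _) (by decide) rfl rfl rfl rfl)] at e20
    rw [← hf4.nat 22 (any_callProg c (hw _) (by decide) rfl rfl rfl rfl)] at e22
    rw [← hf4.nat 23 (any_callProg c (hw _) (by decide) rfl rfl rfl rfl)] at e23
    rw [← hf4.nat 24 (any_callProg c (hw _) (by decide) rfl rfl rfl rfl)] at e24
    rw [← hf4.nat 25 (any_callProg c (hw _) (by decide) rfl rfl rfl rfl)] at e25
    clear hf4 hcl3
    refine (runs_distinctProg (L := L) (by rw [eN, eR, e20, e22]; exact hE) hB hB1 hB2 hpk e24 e25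
      h84).call_seq fun s5 hf5 h85 => ?_
    rw [eN, eR, e20, e22, e23] at h85
    refine runs_instr_seq (runs_instr.2 ⟨?_, ?_, ?_, ?_, ?_, fun _ => ⟨?_, ?_, ?_⟩,
      fun h' => absurd h h'⟩)
    · refine Clean.frame (Clean.frame (hcl4.frame hf5
        ((show distinctProg.bound ≤ 30 by decide).trans (by omega)))
        (c := setN 22 (.reg 22 + .reg 24 + .const 1)) (Frame.exec _ _) ?_)
        (c := setN 23 (.reg 23 + .reg 25)) (Frame.exec _ _) ?_ <;>
      · simp [Prog.bound, Instr.target]; omega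
    · simp [Instr.exec, hf5.natArr 0 rfl, eN]
    · simp [Instr.exec, hf5.realArr 0 rfl, eR]
    · simp [Instr.exec, hf5.nat 0 rfl, e0]
    · simp [Instr.exec, hf5.nat 20 rfl, e20]
    · simpa [Instr.exec, ReadOk] using h85
    · simp [Instr.exec, NatExp.eval, hf5.nat 22 rfl, hf5.nat 24 rfl, e22, e24]
    · simp [Instr.exec, NatExp.eval, hf5.nat 23 rfl, hf5.nat 25 rfl, e23, e25]
  · simp only [Test.Holds, NatExp.eval, e22, e24, e23, e25, eN, eR] at h
    refine runs_instr.2 ⟨?_, ?_, ?_, ?_, ?_, fun h' => absurd h' h, fun _ => ⟨?_, ?_⟩⟩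
    · exact hcl2.frame (Frame.exec _ _) (by simp [Prog.bound, Instr.target]; omega)
    · simp [Instr.exec, eN]
    · simp [Instr.exec, eR]
    · simp [Instr.exec, e0]
    · simp [Instr.exec, e20]
    · simp [Instr.exec, NatExp.eval]
    · simp [Instr.exec, e22]

/-- Offset `0` compares the arities. Once they agree, the other offsets compare corresponding
variables and table entries. -/
theorem sameData_iff {a b : Application n} {N : List ℕ} {R : List ℝ} {p q p' q' : ℕ}
    (hb : b.StoredAt N R p q) (ha : a.StoredAt N R p' q') :
    SameData N R a.con.arity p q p' q' ↔ b = a := by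
  constructor
  · rintro ⟨h1, h2⟩
    obtain ⟨⟨k, f⟩, v⟩ := a
    obtain ⟨⟨k', f'⟩, v'⟩ := b
    have hk : k' = k := by
      have := h1 0 (by omega)
      rw [Nat.add_zero, Nat.add_zero, hb.arity, ha.arity] at this
      exact this
    subst hk
    have hf : f' = f := by
      funext z
      obtain ⟨m, rfl⟩ := Constraint.lexTuple_surjective k' z
      have := h2 m m.2
      rw [hb.table m m.2, ha.table m m.2] at this
      exact NNReal.coe_injective this
    subst hf
    have hv : v' = v := by
      funext i
      have := h1 (1 + i) (by have := i.2; simp only at this ⊢; omega)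
      rw [← Nat.add_assoc, ← Nat.add_assoc, hb.vars i i.2, ha.vars i i.2] at this
      exact Fin.ext this
    rw [hv]
  · rintro rfl
    refine ⟨fun i hi => ?_, fun m hm => ?_⟩
    · rcases i with _ | i
      · rw [Nat.add_zero, Nat.add_zero, hb.arity, ha.arity]
      · rw [Nat.add_comm i 1, ← Nat.add_assoc, ← Nat.add_assoc, hb.vars i (by omega),
          ha.vars i (by omega)]
    · rw [hb.table m hm, ha.table m hm]

/-- The naturals `N'` and the reals `R'` describe the rest of an instance that starts with the
applications in `L`. -/
def Rest (F : Set Constraint) (L : List (Application n)) (N' : List ℕ) (R' : List ℝ) : Prop :=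
  ∃ L' : List (Application n), N' = L'.flatMap nats ∧ R' = L'.flatMap (fun a => a.con.table) ∧
    (L ++ L').Nodup ∧ ∀ a ∈ L', a.con ∈ F

theorem rest_nil {F : Set Constraint} {L : List (Application n)} (hL : L.Nodup) (R' : List ℝ) :
    Rest F L [] R' ↔ R' = [] := by
  constructor
  · rintro ⟨_ | ⟨a, L'⟩, h1, h2, -, -⟩
    · simpa using h2
    · simp [nats] at h1
  · rintro rfl
    exact ⟨[], rfl, rfl, by simpa using hL, by simp⟩

/-- The arity at the head determines how many naturals and reals belong to the first application, so
decoding is unique. -/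
theorem rest_append_iff {F : Set Constraint} {L : List (Application n)} {a : Application n}
    (ha : a.con ∈ F) (N' : List ℕ) (R' : List ℝ) :
    Rest F L (a.nats ++ N') (a.con.table ++ R') ↔ Rest F (L ++ [a]) N' R' := by
  constructor
  · rintro ⟨_ | ⟨b, L'⟩, h1, h2, h3, h4⟩
    · simp [nats] at h1
    · have hk : a.con.arity = b.con.arity := by
        simp only [nats, List.flatMap_cons, List.cons_append, List.cons.injEq] at h1
        exact h1.1
      rw [List.flatMap_cons] at h1 h2
      obtain ⟨h5, h6⟩ := List.append_inj h1 (by simp [nats_length, hk])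
      obtain ⟨h7, h8⟩ := List.append_inj h2 (by simp [Constraint.table_length, hk])
      have hab : [a] = [b] := flatMap_inj [a] [b] (by simpa using h5) (by simpa using h7)
      obtain rfl : a = b := by simpa using hab
      exact ⟨L', h6, h8, by simpa using h3, fun c hc => h4 c (by simp [hc])⟩
  · rintro ⟨L', rfl, rfl, h3, h4⟩
    refine ⟨a :: L', by simp, by simp, by simpa using h3, fun c hc => ?_⟩
    rcases List.mem_cons.1 hc with rfl | hc
    · exact ha
    · exact h4 c hc

theorem Rest.exists_cons {F : Set Constraint} {L : List (Application n)} {k : ℕ} {N' : List ℕ}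
    {R' : List ℝ} (h : Rest F L (k :: N') R') : ∃ (a : Application n) (N₂ : List ℕ) (R₂ : List ℝ),
      a.con ∈ F ∧ a ∉ L ∧ k :: N' = a.nats ++ N₂ ∧ R' = a.con.table ++ R₂ := by
  obtain ⟨_ | ⟨a, L'⟩, h1, h2, h3, h4⟩ := h
  · simp at h1
  · refine ⟨a, L'.flatMap nats, L'.flatMap fun a => a.con.table, h4 a (by simp), fun ha => ?_,
      by simpa using h1, by simpa using h2⟩
    exact (List.nodup_append.1 h3).2.2 a ha a (by simp) rfl

/-- The local tests succeed exactly if another application can be split off. The index tests provide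
its variables. Membership in `enc '' F` provides the constraint itself, and with it the
nonnegativity of the reals. -/
theorem readOk_iff {F : Set Constraint} {L : List (Application n)} {k : ℕ} {N₁ N' : List ℕ}
    {R₁ R' : List ℝ} {p q : ℕ} (hE : Encodes L (N₁ ++ k :: N') (R₁ ++ R') 1 p)
    (hp : N₁.length = p) (hq : R₁.length = q) :
    ((p + k + 1 ≤ (N₁ ++ k :: N').length ∧ q + 2 ^ k ≤ (R₁ ++ R').length) ∧
      ReadOk (Constraint.enc '' F) L (N₁ ++ k :: N') (R₁ ++ R') k p q) ↔
    ∃ (a : Application n) (N₂ : List ℕ) (R₂ : List ℝ), a.con ∈ F ∧ a ∉ L ∧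
      k :: N' = a.nats ++ N₂ ∧ R' = a.con.table ++ R₂ := by
  subst hp hq
  have hsame : ∀ a : Application n, a.con.arity = k →
      a.StoredAt (N₁ ++ k :: N') (R₁ ++ R') N₁.length R₁.length →
      ((∀ i < L.length, ¬ SameData (N₁ ++ k :: N') (R₁ ++ R') k (natPos 1 L i) (realPos L i)
        N₁.length R₁.length) ↔ a ∉ L) := by
    rintro a rfl ha
    rw [List.mem_iff_getElem]
    push Not
    exact forall_congr' fun i => forall_congr' fun hi => (sameData_iff (hE.stored i hi) ha).not
  constructor
  · rintro ⟨⟨h1, h2⟩, ⟨h3, f, hf, hfe⟩, h4⟩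
    simp only [Constraint.enc, Word.mk.injEq, List.cons.injEq, and_true] at hfe
    obtain ⟨hk, ht⟩ := hfe
    subst hk
    simp only [List.length_append, List.length_cons] at h1 h2
    have hN : ∀ i < f.arity, (N₁ ++ f.arity :: N').getD (N₁.length + 1 + i) 0 = N'.getD i 0 := by
      intro i _
      rw [List.getD_append_right _ _ _ _ (by omega),
        show N₁.length + 1 + i - N₁.length = i + 1 by omega, List.getD_cons_succ]
    have hR : f.table = R'.take (2 ^ f.arity) := by
      rw [ht]
      refine List.ext_getElem (by simp; omega) fun i hi1 hi2 => ?_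
      simp only [List.getElem_map, List.getElem_range, List.getElem_take]
      rw [List.getD_append_right _ _ _ _ (by omega), Nat.add_sub_cancel_left,
        List.getD_eq_getElem]
    let a : Application n := ⟨f, fun i => ⟨_, h3 i i.2⟩⟩
    have e1 : f.arity :: N' = a.nats ++ N'.drop f.arity := by
      have : N'.take f.arity = List.ofFn fun i => (a.vars i : ℕ) := by
        refine List.ext_getElem (by simp [a]; omega) fun i hi1 hi2 => ?_
        have hi : i < f.arity := by simp at hi1; omega
        simp only [List.getElem_take, List.getElem_ofFn, a, hN i hi]
        rw [List.getD_eq_getElem]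
      rw [nats, List.cons_append, ← this, List.take_append_drop]
    have e2 : R' = a.con.table ++ R'.drop (2 ^ f.arity) := by
      rw [show a.con.table = _ from hR, List.take_append_drop]
    refine ⟨a, _, _, hf, (hsame a rfl ?_).1 h4, e1, e2⟩
    have := storedAt_append a N₁ (N'.drop f.arity) R₁ (R'.drop (2 ^ f.arity))
    rwa [List.append_assoc, List.append_assoc, ← e1, ← e2] at this
  · rintro ⟨a, N₂, R₂, ha, haL, h1, rfl⟩
    have hk : k = a.con.arity := by
      simp only [nats, List.cons_append, List.cons.injEq] at h1
      exact h1.1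
    have hs := storedAt_append a N₁ N₂ R₁ R₂
    rw [List.append_assoc, List.append_assoc, ← h1] at hs
    refine ⟨⟨?_, ?_⟩, ⟨fun i hi => ?_, a.con, ha, ?_⟩, (hsame a hk.symm hs).2 haL⟩
    · rw [h1]
      simp [nats_length, hk]
      omega
    · simp [Constraint.table_length, hk]
    · rw [hs.vars i (hk ▸ hi)]
      exact (a.vars _).2
    · subst hk
      simp only [Constraint.enc, Word.mk.injEq, true_and]
      refine List.ext_getElem (by simp [Constraint.table_length]) fun i hi1 hi2 => ?_
      simp only [List.getElem_map, List.getElem_range]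
      rw [hs.table i (by simpa using hi2)]
      simp [Constraint.table]

/-- Decide whether the input is an instance, where `c` recognizes the available constraints. -/
def instanceProg (c : Prog) : Prog :=
  setN 0 (.get 0 (.const 0)) ;; setN 20 (.const 1) ;; setN 22 (.const 1) ;;
  .ite (.natLe (.const 1) (.natLen 0)) (setN 8 (.const 1)) (setN 8 (.const 0)) ;;
  .loop (.and (.eq (.reg 8) (.const 1)) (.lt (.reg 22) (.natLen 0))) (readProg c) ;;
  .ite (.eq (.reg 23) (.realLen 0)) skip (setN 8 (.const 0)) ;;
  answer

theorem getD_le_sum (N : List ℕ) (i : ℕ) : N.getD i 0 ≤ N.sum := by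
  by_cases hi : i < N.length
  · rw [List.getD_eq_getElem _ _ hi]
    exact List.le_sum_of_mem (List.getElem_mem hi)
  · rw [List.getD_eq_default _ _ (by omega)]
    exact Nat.zero_le _

theorem mem_range_enc_iff {F : Set Constraint} {n : ℕ} {N : List ℕ} {R : List ℝ} :
    (⟨n :: N, R⟩ : Word) ∈ Set.range (CSPInstance.enc (F := F)) ↔
      Rest (n := n) F [] N R := by
  constructor
  · rintro ⟨⟨m, L, h1, h2⟩, h⟩
    simp only [CSPInstance.enc, Word.mk.injEq, List.cons.injEq] at h
    obtain ⟨⟨rfl, rfl⟩, rfl⟩ := h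
    exact ⟨L, rfl, rfl, by simpa using h1, h2⟩
  · rintro ⟨L, rfl, rfl, h1, h2⟩
    exact ⟨⟨n, L, by simpa using h1, h2⟩, rfl⟩

/-- Loop invariant of `instanceProg`. -/
structure ReadInv (F : Set Constraint) (M n : ℕ) (w : Word) (s : State) : Prop where
  clean : Clean M s
  nats : s.natArr 0 = w.nats
  reals : s.realArr 0 = w.reals
  num : s.natReg 0 = n
  start : s.natReg 20 = 1
  state : (s.natReg 8 = 0 ∧ w ∉ Set.range (CSPInstance.enc (F := F))) ∨
    (s.natReg 8 = 1 ∧ ∃ (L : List (Application n)) (N' : List ℕ) (R' : List ℝ),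
      w.nats = (n :: L.flatMap Application.nats) ++ N' ∧
      w.reals = L.flatMap (fun a => a.con.table) ++ R' ∧
      s.natReg 22 = 1 + (L.flatMap Application.nats).length ∧
      s.natReg 23 = (L.flatMap fun a => a.con.table).length ∧ L.Nodup ∧
      (w ∈ Set.range (CSPInstance.enc (F := F)) ↔ Rest F L N' R'))

theorem runs_instanceProg {F : Set Constraint} {c : Prog} {T : Word → ℕ}
    (hc : ∀ w, (w ∈ Constraint.enc '' F → c.Yields w Word.yes (T w)) ∧
      (w ∉ Constraint.enc '' F → c.Yields w Word.no (T w))) (w : Word) (hB : w.size + 1 ≤ B)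
    (hT : ∀ v : Word, v.size ≤ w.size → T v ≤ B) :
    Runs B (instanceProg c) (State.init w) fun s =>
      (w ∈ Set.range (CSPInstance.enc (F := F)) → s.output = Word.yes) ∧
      (w ∉ Set.range (CSPInstance.enc (F := F)) → s.output = Word.no) := by
  simp only [Word.size] at hB hT
  have hcl : Clean (30 + c.bound + 1) (State.init w) := by
    constructor <;> intro r hr <;> simp only [State.init, ite_eq_right_iff] <;> omega
  obtain ⟨n, hn⟩ : ∃ n, n = w.nats.getD 0 0 := ⟨_, rfl⟩
  refine runs_instr_seq (runs_instr_seq (runs_instr_seq ?_))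
  refine Runs.call_seq (P := ReadInv F (30 + c.bound + 1) n w)
    (runs_ite (fun h => runs_instr.2 ?_) fun h => runs_instr.2 ?_) fun s1 hf1 hI1 => ?_
  · subst hn
    obtain ⟨_ | ⟨n, N⟩, R⟩ := w
    · simp [Test.Holds, Instr.exec, NatExp.eval, State.init] at h
    refine ⟨?_, ?_, ?_, ?_, ?_, .inr ⟨?_, [], N, R, rfl, rfl, ?_, ?_, List.nodup_nil,
      mem_range_enc_iff⟩⟩
    · refine Clean.frame (c := setN 8 (.const 1)) (Clean.frame (c := setN 22 (.const 1))
        (Clean.frame (c := setN 20 (.const 1)) (Clean.frame (c := setN 0 (.get 0 (.const 0))) hcl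
          (Frame.exec _ _) ?_) (Frame.exec _ _) ?_) (Frame.exec _ _) ?_) (Frame.exec _ _) ?_ <;>
      · simp [Prog.bound, Instr.target] <;> omega
    all_goals simp [Instr.exec, NatExp.eval, State.init]
  · subst hn
    obtain ⟨_ | ⟨n, N⟩, R⟩ := w
    · refine ⟨?_, ?_, ?_, ?_, ?_, .inl ⟨?_, ?_⟩⟩
      · refine Clean.frame (c := setN 8 (.const 0)) (Clean.frame (c := setN 22 (.const 1))
          (Clean.frame (c := setN 20 (.const 1)) (Clean.frame (c := setN 0 (.get 0 (.const 0))) hcl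
            (Frame.exec _ _) ?_) (Frame.exec _ _) ?_) (Frame.exec _ _) ?_) (Frame.exec _ _) ?_ <;>
        · simp [Prog.bound, Instr.target] <;> omega
      · simp [Instr.exec, State.init]
      · simp [Instr.exec, State.init]
      · simp [Instr.exec, NatExp.eval, State.init]
      · simp [Instr.exec, NatExp.eval]
      · simp [Instr.exec, NatExp.eval]
      · rintro ⟨x, hx⟩
        simp [CSPInstance.enc] at hx
    · simp [Test.Holds, Instr.exec, NatExp.eval, State.init] at h
  refine Runs.call_seq (P := fun s => ReadInv F (30 + c.bound + 1) n w s ∧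
    ¬ (s.natReg 8 = 1 ∧ s.natReg 22 < w.nats.length)) ?_ ?_
  · refine runs_while (ReadInv F (30 + c.bound + 1) n w)
      -- Every iteration either advances the position, or clears the flag while the position does
      -- not go back.
      (fun s => s.natReg 8 + (w.nats.length - s.natReg 22)) hI1 ?_ ?_ ?_
    · rcases hI1.state with ⟨h, -⟩ | ⟨h, -⟩ <;> simp only [h] <;> omega
    · intro s2 _ hI hb
      simp only [Test.Holds] at hb
      simp only [NatExp.eval, hI.nats] at hb
      obtain ⟨hb1, hb2⟩ := hb
      have h8 : s2.natReg 8 = 1 := le_antisymm hb1.1 hb1.2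
      rw [not_le] at hb2
      obtain ⟨h, -⟩ | ⟨-, L, N', R', hN, hR, h22, h23, hnd, hiff⟩ := hI.state
      · omega
      obtain _ | ⟨k, N'⟩ := N'
      · rw [hN] at hb2
        simp at hb2
        omega
      have hE := encodes_append L [n] (k :: N') R'
      simp only [List.singleton_append, List.length_singleton] at hE
      have hk : w.nats.getD (1 + (L.flatMap Application.nats).length) 0 = k := by
        rw [hN, List.getD_append_right _ _ _ _ (by simp)]
        simp [Nat.add_comm 1, List.getD_cons_zero]
      have hkS := getD_le_sum w.nats (1 + (L.flatMap Application.nats).length)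
      rw [hk] at hkS
      have hlen : w.nats.length = (L.flatMap Application.nats).length + 1 + (N'.length + 1) := by
        rw [hN]; simp; omega
      have hok := readOk_iff (F := F) (L := L) (N₁ := n :: L.flatMap Application.nats)
        (R₁ := L.flatMap fun a => a.con.table) (p := 1 + (L.flatMap Application.nats).length) hE
        (by simp; omega) rfl
      rw [← hN, ← hR] at hok
      rw [← hN, ← hR] at hE
      refine (runs_readProg hc hI.clean hI.nats hI.reals hI.num hI.start h22 h23 hk h8 hE ?_ ?_ ?_ ?_
        ?_).call fun s3 _ h3 => ?_
      · have := length_le_flatMap L; omega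
      · intro a ha
        have := arity_lt_flatMap ha
        omega
      · omega
      · omega
      -- The word passed to `c` has size `1 + k + 2 ^ k`. Here `k` is an entry of the input and `2 ^
      -- k` of its reals are present, so it is no larger than the input.
      · intro h
        refine hT _ ?_
        simp only [List.length_cons, List.length_nil, List.sum_cons, List.sum_nil, List.length_map,
          List.length_range]
        omega
      · obtain ⟨g1, g2, g3, g4, g5, g6, g7⟩ := h3
        by_cases hfit : 1 + (L.flatMap Application.nats).length + k + 1 ≤ w.nats.length ∧
            (L.flatMap fun a => a.con.table).length + 2 ^ k ≤ w.reals.length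
        · obtain ⟨g8, g9, g10⟩ := g6 hfit
          by_cases hr : ReadOk (Constraint.enc '' F) L w.nats w.reals k
              (1 + (L.flatMap Application.nats).length) (L.flatMap fun a => a.con.table).length
          · rw [flag_of hr] at g8
            obtain ⟨a, N₂, R₂, haF, haL, e1, e2⟩ := hok.1 ⟨hfit, hr⟩
            have hka : k = a.con.arity := by
              simp only [Application.nats, List.cons_append, List.cons.injEq] at e1
              exact e1.1
            refine ⟨⟨g1, g2, g3, g4, g5, .inr ⟨g8, L ++ [a], N₂, R₂, ?_, ?_, ?_, ?_, ?_, ?_⟩⟩, ?_⟩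
            · rw [hN, e1]; simp
            · rw [hR, e2]; simp
            · rw [g9]; simp [nats_length, hka]; omega
            · rw [g10]; simp [Constraint.table_length, hka]
            · rw [List.nodup_append]
              refine ⟨hnd, by simp, fun x hx y hy => ?_⟩
              rw [List.mem_singleton] at hy
              rintro rfl
              exact haL (hy ▸ hx)
            · rw [hiff, e1, e2, rest_append_iff haF]
            · simp only [g8, g9, h8, h22]; omega
          · rw [flag_of_not hr] at g8
            refine ⟨⟨g1, g2, g3, g4, g5, .inl ⟨g8, ?_⟩⟩, ?_⟩
            · rw [hiff]
              exact fun h => hr (hok.2 h.exists_cons).2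
            · simp only [g8, g9, h8, h22]; omega
        · obtain ⟨g8, g9⟩ := g7 hfit
          refine ⟨⟨g1, g2, g3, g4, g5, .inl ⟨g8, ?_⟩⟩, ?_⟩
          · rw [hiff]
            exact fun h => hfit (hok.2 h.exists_cons).1
          · simp only [g8, g9, h8, h22]; omega
    · intro s2 _ hI hb
      refine ⟨hI, fun h => hb ?_⟩
      simp only [Test.Holds]
      simp only [NatExp.eval, hI.nats]
      omega
  -- Leaving the loop with the flag set means that all naturals are consumed. The input is then an
  -- instance exactly if no reals are left.
  · rintro s2 - ⟨hI, hexit⟩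
    refine Runs.call_seq (P := fun s => s.natReg 8 =
      flag (w ∈ Set.range (CSPInstance.enc (F := F)))) (runs_ite (fun h => runs_instr.2 ?_)
        fun h => runs_instr.2 ?_) fun s3 _ h => runs_answer h
    all_goals
      rw [Test.holds_eq] at h
      simp only [NatExp.eval, hI.reals] at h
      obtain ⟨h8, hw⟩ | ⟨h8, L, N', R', hN, hR, h22, h23, hnd, hiff⟩ := hI.state
    · rw [flag_of_not hw]
      simp [Instr.exec, h8]
    · have hN' : N' = [] := by
        rw [h8, h22, hN] at hexit
        simp at hexit
        rw [← List.length_eq_zero_iff]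
        omega
      have hR' : R' = [] := by
        rw [h23, hR] at h
        simpa using h
      rw [flag_of (hiff.2 (by rw [hN', rest_nil hnd, hR']))]
      simp [Instr.exec, h8]
    · rw [flag_of_not hw]
      simp [Instr.exec, NatExp.eval]
    · have hN' : N' = [] := by
        rw [h8, h22, hN] at hexit
        simp at hexit
        rw [← List.length_eq_zero_iff]
        omega
      have hR' : R' ≠ [] := by
        rintro rfl
        rw [h23, hR] at h
        simp at h
      rw [flag_of_not fun hw => hR' ((rest_nil hnd R').1 (hN' ▸ hiff.1 hw))]
      simp [Instr.exec, NatExp.eval]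

/-! ## Sets of words that a single test recognizes -/

/-- The set of inputs on which the test holds. -/
def Test.words (b : Test) : Set Word := {w | b.Holds (State.init w)}

theorem Test.exists_forall (n : ℕ) (b : ℕ → Test) :
    ∃ c : Test, ∀ s, c.Holds s ↔ ∀ i < n, (b i).Holds s := by
  induction n with
  | zero => exact ⟨.natLe (.const 0) (.const 0), by simp [Test.Holds]⟩
  | succ n ih =>
    obtain ⟨c, hc⟩ := ih
    refine ⟨.and c (b n), fun s => ?_⟩
    simp only [Test.Holds, hc, Nat.lt_succ_iff_lt_or_eq, or_imp, forall_and, forall_eq]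

theorem list_eq_iff_getD {α : Type*} (l m : List α) (d : α) :
    l = m ↔ l.length = m.length ∧ ∀ i < m.length, l.getD i d = m.getD i d := by
  refine ⟨fun h => h ▸ ⟨rfl, fun _ _ => rfl⟩, fun ⟨h, h'⟩ => List.ext_getElem h fun i h1 h2 => ?_⟩
  have := h' i h2
  rwa [List.getD_eq_getElem _ _ h1, List.getD_eq_getElem _ _ h2] at this

/-- Programs may contain arbitrary real constants, so a fixed word can be compared entry by entry in
one test. -/
theorem Test.exists_words_singleton (v : Word) : ∃ b : Test, b.words = {v} := by
  obtain ⟨b, hb⟩ := Test.exists_forall v.nats.length fun i =>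
    .eq (.get 0 (.const i)) (.const (v.nats.getD i 0))
  obtain ⟨c, hc⟩ := Test.exists_forall v.reals.length fun i =>
    .realEq (.get 0 (.const i)) (.const (v.reals.getD i 0))
  refine ⟨.and (.and (.eq (.natLen 0) (.const v.nats.length)) b)
    (.and (.eq (.realLen 0) (.const v.reals.length)) c), Set.ext fun w => ?_⟩
  obtain ⟨l, m⟩ := v
  obtain ⟨l', m'⟩ := w
  simp only [Test.holds_eq, Test.holds_realEq, NatExp.eval, RealExp.eval] at hb hc
  simp only [Test.words, Set.mem_ofPred_eq, Set.mem_singleton_iff, Word.mk.injEq,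
    list_eq_iff_getD l' l 0, list_eq_iff_getD m' m 0]
  exact and_congr (and_congr (Test.holds_eq _ _) (hb _)) (and_congr (Test.holds_eq _ _) (hc _))

theorem Test.exists_words_union (b c : Test) : ∃ d : Test, d.words = b.words ∪ c.words :=
  ⟨.not (.and (.not b) (.not c)), Set.ext fun w => by
    simp only [Test.words, Test.Holds, Set.mem_ofPred_eq, Set.mem_union]; tauto⟩

theorem Test.exists_words_of_finite {S : Set Word} (hS : S.Finite) : ∃ b : Test, b.words = S := by
  induction S, hS using Set.Finite.induction_on with
  | empty =>
    exact ⟨.natLe (.const 1) (.const 0), by simp [Test.words, Test.Holds, NatExp.eval]⟩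
  | @insert v S _ _ ih =>
    obtain ⟨b, rfl⟩ := ih
    obtain ⟨c, hc⟩ := Test.exists_words_singleton v
    obtain ⟨d, hd⟩ := Test.exists_words_union c b
    exact ⟨d, by rw [hd, hc, Set.insert_eq]⟩

theorem Test.polyDecidableOn_words (b : Test) : PolyDecidableOn Set.univ b.words := by
  let c : Prog := .ite b (setN 8 (.const 1)) (setN 8 (.const 0)) ;; answer
  obtain ⟨p, hp⟩ := c.exists_cost_poly
  have h : ∀ w, Runs (w.size) c (State.init w) fun s =>
      (w ∈ b.words → s.output = Word.yes) ∧ (w ∉ b.words → s.output = Word.no) := by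
    intro w
    refine Runs.call_seq (P := fun s => s.natReg 8 = flag (w ∈ b.words))
      (runs_ite (fun h => runs_instr.2 ?_) fun h => runs_instr.2 ?_) fun s _ h => runs_answer h
    · rw [flag_of (show w ∈ b.words from h)]; simp [Instr.exec, NatExp.eval]
    · rw [flag_of_not (show w ∉ b.words from h)]; simp [Instr.exec, NatExp.eval]
  exact ⟨c, p, fun w _ => ⟨fun hw => ((h w).call fun _ _ h' => h'.1 hw).yields (hp _).ge,
    fun hw => ((h w).call fun _ _ h' => h'.2 hw).yields (hp _).ge⟩⟩

end RealRAM

/-! ### Recognition of finite sets of constraints together with the unary ones -/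

namespace Constraint

open RealRAM

/-- The table of a unary constraint is an arbitrary pair of nonnegative reals, so the infinite set
of unary constraints is also recognized by a single test. -/
theorem mem_enc_image_unary (w : Word) :
    w ∈ enc '' unary ↔ ∃ x y : ℝ, 0 ≤ x ∧ 0 ≤ y ∧ w = ⟨[1], [x, y]⟩ := by
  constructor
  · rintro ⟨⟨k, f⟩, hk, rfl⟩
    obtain rfl : k = 1 := hk
    exact ⟨_, _, NNReal.coe_nonneg _, NNReal.coe_nonneg _, rfl⟩
  · rintro ⟨x, y, hx, hy, rfl⟩
    refine ⟨⟨1, fun z => if z 0 then ⟨y, hy⟩ else ⟨x, hx⟩⟩, rfl, ?_⟩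
    simp [enc, table, lexTuple, List.ofFn_succ]
    exact ⟨rfl, rfl⟩

theorem exists_words_unary : ∃ b : Test, b.words = enc '' unary := by
  refine ⟨.and (.and (.eq (.natLen 0) (.const 1)) (.eq (.get 0 (.const 0)) (.const 1)))
    (.and (.eq (.realLen 0) (.const 2)) (.and (.realLe (.const 0) (.get 0 (.const 0)))
      (.realLe (.const 0) (.get 0 (.const 1))))), Set.ext fun w => ?_⟩
  obtain ⟨l, m⟩ := w
  rw [mem_enc_image_unary, Test.words, Set.mem_ofPred_eq]
  simp only [Test.Holds, NatExp.eval, RealExp.eval, State.init, if_true, Word.mk.injEq]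
  constructor
  · rintro ⟨⟨h1, h2⟩, h3, h4, h5⟩
    obtain ⟨a, rfl⟩ := List.length_eq_one_iff.1 (le_antisymm h1.1 h1.2)
    obtain ⟨x, y, rfl⟩ := List.length_eq_two.1 (le_antisymm h3.1 h3.2)
    obtain rfl : a = 1 := le_antisymm h2.1 h2.2
    exact ⟨x, y, h4, h5, rfl, rfl⟩
  · rintro ⟨x, y, hx, hy, rfl, rfl⟩
    exact ⟨⟨⟨le_rfl, le_rfl⟩, le_rfl, le_rfl⟩, ⟨le_rfl, le_rfl⟩, hx, hy⟩

theorem recognizable_union_unary {F : Set Constraint} (hF : F.Finite) :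
    Recognizable (F ∪ unary) := by
  obtain ⟨b, hb⟩ := Test.exists_words_of_finite (hF.image enc)
  obtain ⟨c, hc⟩ := exists_words_unary
  obtain ⟨d, hd⟩ := Test.exists_words_union b c
  have := d.polyDecidableOn_words
  rwa [hd, hb, hc, ← Set.image_union] at this

end Constraint

/-! ### Recognition of instances in polynomial time -/

namespace RealRAM

/-- Transfers the time bound of the recognizer from a constraint inside the input to the size of the
whole input. -/
theorem monotone_eval_nat (p : Polynomial ℕ) : Monotone fun n => p.eval n := by
  intro m n h
  simp only [Polynomial.eval_eq_sum, Polynomial.sum]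
  gcongr

theorem maxProdCSP_instancesRecognizable {F : Set Constraint} (hF : Constraint.Recognizable F) :
    (maxProdCSP F).InstancesRecognizable := by
  obtain ⟨c, q, hq⟩ := hF
  -- The iteration bound has to cover both the loops over the input, by `X + 1`, and every call of
  -- the recognizer, by `q`.
  obtain ⟨p, hp⟩ := (instanceProg c).exists_poly_comp_cost (Polynomial.X + 1 + q)
  refine ⟨instanceProg c, p, fun w _ => ?_⟩
  have h := runs_instanceProg (B := (Polynomial.X + 1 + q).eval w.size) (T := fun v => q.eval v.size)
    (fun v => hq v trivial) w (by simp) fun v hv => (monotone_eval_nat q hv).trans (by simp)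
  exact ⟨fun hw => (h.call fun _ _ h' => h'.1 hw).yields (hp _).ge,
    fun hw => (h.call fun _ _ h' => h'.2 hw).yields (hp _).ge⟩

end RealRAM

end

theorem mainTheorem3 (F : Set Constraint)
    (hF : F ⊆ Constraint.AF ∨ F ⊆ Constraint.ED) :
    ((maxProdCSPStar F).SolutionsRecognizable ∧ (maxProdCSPStar F).SolutionsBounded ∧
      (maxProdCSPStar F).MeasureComputable ∧ (maxProdCSPStar F).OptimumComputable) ∧
    (F.Finite ∨ Constraint.Recognizable (F ∪ Constraint.unary) → (maxProdCSPStar F).InPO) := by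
  have hED : F ∪ Constraint.unary ⊆ Constraint.ED :=
    Set.union_subset (hF.elim (fun h => h.trans Constraint.AF_subset_ED) id)
      Constraint.unary_subset_ED
  have hsol := maxProdCSP_solutionsRecognizable (F ∪ Constraint.unary)
  have hbdd := maxProdCSP_solutionsBounded (F ∪ Constraint.unary)
  have hmeas := maxProdCSP_measureComputable (F ∪ Constraint.unary)
  have hopt := maxProdCSP_optimumComputable hED
  exact ⟨⟨hsol, hbdd, hmeas, hopt⟩, fun h =>
    ⟨⟨RealRAM.maxProdCSP_instancesRecognizable (h.elim Constraint.recognizable_union_unary id),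
      hsol, hbdd, hmeas⟩, hopt⟩⟩
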